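/- All $C^*$-algebras are over $\mathbb{C}$ and need not be unital. A completely positive map $\varphi : F=\bigoplus_{i=1}^s M_{r_i} \to A$ has *strict order zero* if $\varphi(e)\varphi(f)=0$ for any two orthogonal minimal projections $e,f\in F$; it is *$n$-decomposable* if $\{1,\dots,s\}$ is a disjoint union of (possibly empty) sets $I_0,\dots,I_n$ such that the restriction of $\varphi$ to each $\bigoplus_{i\in I_j} M_{r_i}$ has strict order zero. The *decomposition rank* $\mathrm{dr}\,A\in\{0,1,2,\dots\}\cup\{\infty\}$ of a separable $C^*$-algebra $A$ is the least integer $n\ge 0$ such that for all $b_1,\dots,b_m\in A$ and $\varepsilon>0$ there are a finite-dimensional $C^*$-algebra $F=\bigoplus_{i=1}^s M_{r_i}$ and completely positive contractive maps $\psi : A\to F$, $\varphi : F\to A$ such that $\varphi$ is $n$-decomposable and $\|\varphi(\psi(b_k))-b_k\|<\varepsilon$ for all $k$; $\mathrm{dr}\,A=\infty$ if there is no such $n$. Let $A$ and $B$ be separable $C^*$-algebras. Then: 1. $\mathrm{dr}(A\oplus B)=\max\{\mathrm{dr}\,A,\mathrm{dr}\,B\}$. 2. If $A=\varinjlim A_n$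 is the inductive limit of a sequence $A_0\to A_1\to A_2\to\cdots$ of separable $C^*$-algebras and $*$-homomorphisms (not necessarily injective), then $\mathrm{dr}\,A\le\liminf_{n\to\infty}\mathrm{dr}\,A_n$. 3. $\mathrm{dr}(A/J)\le\mathrm{dr}\,A$ for every closed two-sided ideal $J$ of $A$. 4. $\mathrm{dr}\,S\le\mathrm{dr}\,A$ for every hereditary $C^*$-subalgebra $S$ of $A$. 5. $\mathrm{dr}(A\otimes B)\le(\mathrm{dr}\,A+1)(\mathrm{dr}\,B+1)-1$, where $\otimes$ denotes the minimal (spatial) tensor product. 6. If $B$ is AF (the closure of the union of an increasing sequence of finite-dimensional $C^*$-subalgebras), then $\mathrm{dr}(A\otimes B)\le\mathrm{dr}\,A$. -/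

import Mathlib

open scoped ComplexOrder TensorProduct ENNReal

noncomputable section

namespace DecRank

/-! ## Completely positive maps, order zero maps and decomposition rank -/

section Basic

attribute [local instance 50] CStarAlgebra.spectralOrder CStarAlgebra.spectralOrderedRing

/-- A linear map between C*-algebras is completely positive, with respect to the order for which
the positive elements are those of the form `x* x`. -/
def IsCompletelyPositive {A B : Type*} [NonUnitalCStarAlgebra A] [NonUnitalCStarAlgebra B]
    (φ : A →ₗ[ℂ] B) : Prop :=
  ∃ Φ : CompletelyPositiveMap A B, Φ.toLinearMap = φ

/-- A C*-subalgebra `S` of `A` is hereditary if `0 ≤ a ≤ b` and `b ∈ S` imply `a ∈ S`. -/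
def IsHereditary {A : Type*} [NonUnitalCStarAlgebra A] (S : NonUnitalStarSubalgebra ℂ A) : Prop :=
  ∀ a b : A, 0 ≤ a → a ≤ b → b ∈ S → a ∈ S

end Basic

/-- Completely positive contractive maps. -/
def IsCPC {A B : Type*} [NonUnitalCStarAlgebra A] [NonUnitalCStarAlgebra B]
    (φ : A →ₗ[ℂ] B) : Prop :=
  IsCompletelyPositive φ ∧ ∀ x, ‖φ x‖ ≤ ‖x‖

/-- The finite-dimensional C*-algebra `⨁ i, M_{r i}` (a summand with `r i = 0` is zero). -/
abbrev MatrixSum {ι : Type*} (r : ι → ℕ) : Type _ :=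
  ∀ i, CStarMatrix (Fin (r i)) (Fin (r i)) ℂ

/-- A minimal projection: a nonzero projection whose only subprojections are `0` and itself. -/
def IsMinimalProjection {F : Type*} [NonUnitalCStarAlgebra F] (e : F) : Prop :=
  IsStarProjection e ∧ e ≠ 0 ∧ ∀ p : F, IsStarProjection p → p * e = p → p = 0 ∨ p = e

/-- Strict order zero: orthogonal minimal projections are mapped to orthogonal elements
(for a completely positive `φ` these images are positive, so that orthogonality means that their
product vanishes). The zero map has strict order zero. -/
def HasStrictOrderZero {F A : Type*} [NonUnitalCStarAlgebra F] [NonUnitalCStarAlgebra A]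
    (φ : F →ₗ[ℂ] A) : Prop :=
  ∀ e f : F, IsMinimalProjection e → IsMinimalProjection f → e * f = 0 → φ e * φ f = 0

/-- The inclusion of the partial sum `⨁ i ∈ I, M_{r i}` into `⨁ i, M_{r i}`. -/
def partialSumInclusion {ι : Type*} (r : ι → ℕ) (I : Set ι) [DecidablePred (· ∈ I)] :
    MatrixSum (fun i : I => r i) →ₗ[ℂ] MatrixSum r :=
  LinearMap.pi fun i => if h : i ∈ I then LinearMap.proj (⟨i, h⟩ : I) else 0

open Classical in
/-- `φ : ⨁ i, M_{r i} → A` is `n`-decomposable: the index set can be partitioned into `n + 1`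
(possibly empty) sets `I j = {i | c i = j}` such that the restriction of `φ` to each
`⨁ i ∈ I j, M_{r i}` has strict order zero. -/
def IsDecomposable {A : Type*} [NonUnitalCStarAlgebra A] (n : ℕ) {s : ℕ} {r : Fin s → ℕ}
    (φ : MatrixSum r →ₗ[ℂ] A) : Prop :=
  ∃ c : Fin s → Fin (n + 1), ∀ j : Fin (n + 1),
    HasStrictOrderZero (φ ∘ₗ partialSumInclusion r {i | c i = j})

/-- Every finite subset of `A` has, within every `ε > 0`, a completely positive (contractive)
approximation `A → F → A` through a finite-dimensional `F` with `n`-decomposable second map. -/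
def HasDecomposableApproximations (A : Type*) [NonUnitalCStarAlgebra A] (n : ℕ) : Prop :=
  ∀ (S : Finset A) (ε : ℝ), 0 < ε →
    ∃ (s : ℕ) (r : Fin s → ℕ) (ψ : A →ₗ[ℂ] MatrixSum r) (φ : MatrixSum r →ₗ[ℂ] A),
      IsCPC ψ ∧ IsCPC φ ∧ IsDecomposable n φ ∧ ∀ b ∈ S, ‖φ (ψ b) - b‖ < ε

/-- The decomposition rank: the least `n` as above, and `⊤` if there is none. -/
def decompositionRank (A : Type*) [NonUnitalCStarAlgebra A] : ℕ∞ :=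
  sInf {N : ℕ∞ | ∃ n : ℕ, N = n ∧ HasDecomposableApproximations A n}

/-! ## Inductive limits and AF algebras -/

/-- The composition `D n → D (n + 1) → ⋯ → D (n + k)` of connecting maps. -/
def connectingMap {D : ℕ → Type*} [∀ n, NonUnitalCStarAlgebra (D n)]
    (σ : ∀ n, D n →⋆ₙₐ[ℂ] D (n + 1)) (n : ℕ) : ∀ k : ℕ, D n →⋆ₙₐ[ℂ] D (n + k)
  | 0 => NonUnitalStarAlgHom.id ℂ (D n)
  | k + 1 => (σ (n + k)).comp (connectingMap σ n k)

/-- `A`, with the canonical maps `μ n : D n → A`, is the inductive limit of the sequence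
`D 0 → D 1 → D 2 → ⋯`, that is, the completion of the algebraic direct limit with respect to
the limit of the norms. The connecting maps need not be injective. -/
structure IsInductiveLimit {D : ℕ → Type*} [∀ n, NonUnitalCStarAlgebra (D n)]
    (σ : ∀ n, D n →⋆ₙₐ[ℂ] D (n + 1)) {A : Type*} [NonUnitalCStarAlgebra A]
    (μ : ∀ n, D n →⋆ₙₐ[ℂ] A) : Prop where
  compatible : ∀ n x, μ (n + 1) (σ n x) = μ n x
  dense : Dense (⋃ n, Set.range (μ n))
  norm_eq : ∀ n x,
    Filter.Tendsto (fun k => ‖connectingMap σ n k x‖) Filter.atTop (nhds ‖μ n x‖)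

/-- AF algebras: the closure of the union of an increasing sequence of finite-dimensional
C*-subalgebras. -/
def IsAF (B : Type*) [NonUnitalCStarAlgebra B] : Prop :=
  ∃ S : ℕ → NonUnitalStarSubalgebra ℂ B,
    Monotone S ∧ (∀ n, FiniteDimensional ℂ (S n)) ∧ Dense (⋃ n, (S n : Set B))

/-! ## Quotients by closed ideals -/

/-- Closed two-sided ideals of a C*-algebra. -/
structure ClosedIdeal (A : Type*) [NonUnitalCStarAlgebra A] extends Submodule ℂ A where
  mul_mem_left : ∀ (a : A) {x : A}, x ∈ carrier → a * x ∈ carrier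
  mul_mem_right : ∀ (a : A) {x : A}, x ∈ carrier → x * a ∈ carrier
  isClosed : IsClosed carrier

namespace ClosedIdeal

variable {A : Type*} [NonUnitalCStarAlgebra A] (J : ClosedIdeal A)

/-- The largest *-subalgebra `J ∩ J*` of `J` (it turns out to be `J`). -/
def selfAdjointPart : NonUnitalStarSubalgebra ℂ A where
  carrier := {x | x ∈ J.toSubmodule ∧ star x ∈ J.toSubmodule}
  add_mem' ha hb := ⟨add_mem ha.1 hb.1, by rw [star_add]; exact add_mem ha.2 hb.2⟩
  zero_mem' := ⟨zero_mem _, by rw [star_zero]; exact zero_mem _⟩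
  mul_mem' {a b} ha hb :=
    ⟨J.mul_mem_left a hb.1, by rw [star_mul]; exact J.mul_mem_right _ hb.2⟩
  smul_mem' c x hx :=
    ⟨J.toSubmodule.smul_mem c hx.1, by rw [star_smul]; exact J.toSubmodule.smul_mem _ hx.2⟩
  star_mem' {a} ha := ⟨ha.2, by rw [star_star]; exact ha.1⟩

instance isClosed_toSubmodule : IsClosed (J.toSubmodule : Set A) := J.isClosed

instance isClosed_selfAdjointPart : IsClosed (J.selfAdjointPart : Set A) :=
  J.isClosed.inter (J.isClosed.preimage continuous_star)

section ApproximateUnit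

attribute [local instance 50] CStarAlgebra.spectralOrder CStarAlgebra.spectralOrderedRing

open scoped CStarAlgebra in
lemma norm_sub_mul_le {e : A} (he : 0 ≤ e) (he1 : ‖e‖ ≤ 1) (x : A) : ‖x - e * x‖ ≤ ‖x‖ := by
  have h0 : (0 : Unitization ℂ A) ≤ (e : Unitization ℂ A) := Unitization.inr_nonneg_iff.2 he
  have h1 : (e : Unitization ℂ A) ≤ 1 := by
    rw [← CStarAlgebra.norm_le_one_iff_of_nonneg _ h0, Unitization.norm_inr]
    exact he1
  have h2 : ‖1 - (e : Unitization ℂ A)‖ ≤ 1 :=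
    (CStarAlgebra.norm_le_one_iff_of_nonneg _ (sub_nonneg.2 h1)).2 (sub_le_self _ h0)
  rw [← Unitization.norm_inr (𝕜 := ℂ) (x - e * x), ← Unitization.norm_inr (𝕜 := ℂ) x]
  have h3 : ((x - e * x : A) : Unitization ℂ A) = (1 - (e : Unitization ℂ A)) * x := by
    rw [sub_mul, one_mul, Unitization.inr_sub, Unitization.inr_mul]
  rw [h3]
  exact (norm_mul_le _ _).trans (mul_le_of_le_one_left (norm_nonneg _) h2)

/-- Elements of an approximate unit of `J ∩ J*`. -/
lemma exists_approx (x : A) (hx : x ∈ J.selfAdjointPart) {ε : ℝ} (hε : 0 < ε) :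
    ∃ e ∈ J.selfAdjointPart, star e = e ∧ (∀ y : A, ‖y - e * y‖ ≤ ‖y‖) ∧ ‖x - x * e‖ < ε := by
  let _ := CStarAlgebra.spectralOrder J.selfAdjointPart
  have := CStarAlgebra.spectralOrderedRing J.selfAdjointPart
  have hu := CStarAlgebra.increasingApproximateUnit J.selfAdjointPart
  have h1 := (Metric.tendsto_nhds.1 (hu.tendsto_mul_left ⟨x, hx⟩)) ε hε
  obtain ⟨e, ⟨he0, he1⟩, he2⟩ := ((hu.eventually_nonneg.and hu.eventually_norm).and h1).exists
  have he0' : 0 ≤ (e : A) := by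
    rw [StarOrderedRing.nonneg_iff] at he0
    have := AddSubmonoid.mem_map_of_mem 
      (NonUnitalStarSubalgebraClass.subtype J.selfAdjointPart : J.selfAdjointPart →+ A) he0
    rw [AddMonoidHom.map_mclosure, ← Set.range_comp] at this
    refine StarOrderedRing.nonneg_iff.2 (AddSubmonoid.closure_mono ?_ this)
    rintro _ ⟨s, rfl⟩
    exact ⟨s, rfl⟩
  refine ⟨e, e.2, (IsSelfAdjoint.of_nonneg he0').star_eq, norm_sub_mul_le he0' he1, ?_⟩
  rw [dist_comm, dist_eq_norm] at he2
  exact he2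

end ApproximateUnit

lemma star_mem {x : A} (hx : x ∈ J.toSubmodule) : star x ∈ J.toSubmodule := by
  have hxx : x * star x ∈ J.selfAdjointPart :=
    ⟨J.mul_mem_right _ hx, by rw [star_mul, star_star]; exact J.mul_mem_right _ hx⟩
  refine J.isClosed.closure_subset (Metric.mem_closure_iff.2 fun ε hε => ?_)
  obtain ⟨e, he, hes, hec, heε⟩ := J.exists_approx _ hxx (mul_pos hε hε)
  refine ⟨star x * e, J.mul_mem_left _ he.1, ?_⟩
  rw [dist_eq_norm]
  refine lt_of_mul_self_lt_mul_self₀ hε.le ?_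
  refine lt_of_le_of_lt ?_ heε
  rw [← CStarRing.norm_star_mul_self]
  have : star (star x - star x * e) * (star x - star x * e)
      = (x * star x - x * star x * e) - e * (x * star x - x * star x * e) := by
    simp only [star_sub, star_mul, star_star, hes]
    noncomm_ring
  rw [this]
  exact hec _

/-- The quotient C*-algebra `A / J`, with the quotient norm. -/
def Quotient : Type _ := A ⧸ J.toSubmodule

instance : NormedAddCommGroup J.Quotient :=
  inferInstanceAs (NormedAddCommGroup (A ⧸ J.toSubmodule))

instance : NormedSpace ℂ J.Quotient :=
  inferInstanceAs (NormedSpace ℂ (A ⧸ J.toSubmodule))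

instance : CompleteSpace J.Quotient :=
  inferInstanceAs (CompleteSpace (A ⧸ J.toSubmodule))

/-- The quotient map `A → A / J`. -/
def toQuotient : A →ₗ[ℂ] J.Quotient := J.toSubmodule.mkQ

lemma toQuotient_surjective : Function.Surjective J.toQuotient := Submodule.mkQ_surjective _

lemma toQuotient_eq_iff {a b : A} : J.toQuotient a = J.toQuotient b ↔ a - b ∈ J.toSubmodule :=
  Submodule.Quotient.eq _

lemma norm_toQuotient_le (a : A) : ‖J.toQuotient a‖ ≤ ‖a‖ :=
  Submodule.Quotient.norm_mk_le J.toSubmodule a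

lemma exists_norm_lt (x : J.Quotient) {ε : ℝ} (hε : 0 < ε) :
    ∃ a, J.toQuotient a = x ∧ ‖a‖ < ‖x‖ + ε :=
  Submodule.Quotient.norm_mk_lt (S := J.toSubmodule) x hε

lemma mul_sub_mul_mem {a a' b b' : A} (ha : a - a' ∈ J.toSubmodule) (hb : b - b' ∈ J.toSubmodule) :
    a * b - a' * b' ∈ J.toSubmodule := by
  have : a * b - a' * b' = (a - a') * b + a' * (b - b') := by noncomm_ring
  rw [this]
  exact add_mem (J.mul_mem_right _ ha) (J.mul_mem_left _ hb)

instance : Mul J.Quotient where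
  mul := Quotient.map₂ (· * ·) fun a a' ha b b' hb => by
    rw [← Quotient.eq_iff_equiv] at ha hb ⊢
    exact J.toQuotient_eq_iff.2
      (J.mul_sub_mul_mem (J.toQuotient_eq_iff.1 ha) (J.toQuotient_eq_iff.1 hb))

instance : Star J.Quotient where
  star := Quotient.map star fun a b h => by
    rw [← Quotient.eq_iff_equiv] at h ⊢
    refine J.toQuotient_eq_iff.2 ?_
    rw [← star_sub]
    exact J.star_mem (J.toQuotient_eq_iff.1 h)

lemma toQuotient_mul (a b : A) : J.toQuotient (a * b) = J.toQuotient a * J.toQuotient b := rfl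

lemma toQuotient_star (a : A) : J.toQuotient (star a) = star (J.toQuotient a) := rfl

instance : NonUnitalRing J.Quotient where
  left_distrib x y z := by
    obtain ⟨a, rfl⟩ := J.toQuotient_surjective x
    obtain ⟨b, rfl⟩ := J.toQuotient_surjective y
    obtain ⟨c, rfl⟩ := J.toQuotient_surjective z
    simp only [← map_add, ← toQuotient_mul, mul_add]
  right_distrib x y z := by
    obtain ⟨a, rfl⟩ := J.toQuotient_surjective x
    obtain ⟨b, rfl⟩ := J.toQuotient_surjective y
    obtain ⟨c, rfl⟩ := J.toQuotient_surjective z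
    simp only [← map_add, ← toQuotient_mul, add_mul]
  zero_mul x := by
    obtain ⟨a, rfl⟩ := J.toQuotient_surjective x
    rw [← map_zero J.toQuotient, ← toQuotient_mul, zero_mul]
  mul_zero x := by
    obtain ⟨a, rfl⟩ := J.toQuotient_surjective x
    rw [← map_zero J.toQuotient, ← toQuotient_mul, mul_zero]
  mul_assoc x y z := by
    obtain ⟨a, rfl⟩ := J.toQuotient_surjective x
    obtain ⟨b, rfl⟩ := J.toQuotient_surjective y
    obtain ⟨c, rfl⟩ := J.toQuotient_surjective z
    simp only [← toQuotient_mul, mul_assoc]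

instance : StarRing J.Quotient where
  star_involutive x := by
    obtain ⟨a, rfl⟩ := J.toQuotient_surjective x
    simp only [← toQuotient_star, star_star]
  star_mul x y := by
    obtain ⟨a, rfl⟩ := J.toQuotient_surjective x
    obtain ⟨b, rfl⟩ := J.toQuotient_surjective y
    simp only [← toQuotient_star, ← toQuotient_mul, star_mul]
  star_add x y := by
    obtain ⟨a, rfl⟩ := J.toQuotient_surjective x
    obtain ⟨b, rfl⟩ := J.toQuotient_surjective y
    simp only [← toQuotient_star, ← map_add, star_add]

instance : NonUnitalNormedRing J.Quotient where
  dist_eq := dist_eq_norm_neg_add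
  norm_mul_le x y := by
    refine le_of_forall_pos_le_add fun ε hε => ?_
    have hc : Filter.Tendsto (fun δ : ℝ => (‖x‖ + δ) * (‖y‖ + δ)) (nhdsWithin 0 (Set.Ioi 0))
        (nhds ((‖x‖ + 0) * (‖y‖ + 0))) :=
      (Continuous.tendsto (by fun_prop) 0).mono_left nhdsWithin_le_nhds
    rw [add_zero, add_zero] at hc
    obtain ⟨δ, hδ, hδ0⟩ := ((hc.eventually (gt_mem_nhds (lt_add_of_pos_right _ hε))).and
      self_mem_nhdsWithin).exists
    obtain ⟨a, rfl, ha⟩ := J.exists_norm_lt x hδ0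
    obtain ⟨b, rfl, hb⟩ := J.exists_norm_lt y hδ0
    rw [← toQuotient_mul]
    calc _ ≤ ‖a * b‖ := J.norm_toQuotient_le _
      _ ≤ ‖a‖ * ‖b‖ := norm_mul_le _ _
      _ ≤ _ := by gcongr
      _ ≤ _ := hδ.le

instance : CStarRing J.Quotient where
  norm_mul_self_le x := by
    obtain ⟨a, rfl⟩ := J.toQuotient_surjective x
    refine le_of_forall_pos_le_add fun ε hε => ?_
    rw [← toQuotient_star, ← toQuotient_mul]
    obtain ⟨c, hc, hcε⟩ := J.exists_norm_lt (J.toQuotient (star a * a)) (half_pos hε)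
    have hj : star a * a - c ∈ J.toSubmodule := J.toQuotient_eq_iff.1 hc.symm
    obtain ⟨e, he, hes, hec, heε⟩ := J.exists_approx _ ⟨hj, J.star_mem hj⟩ (half_pos hε)
    have h1 : J.toQuotient a = J.toQuotient (a - a * e) := by
      rw [toQuotient_eq_iff, sub_sub_cancel]
      exact J.mul_mem_left _ he.1
    have h2 : star (a - a * e) * (a - a * e)
        = (star a * a - star a * a * e) - e * (star a * a - star a * a * e) := by
      simp only [star_sub, star_mul, hes]
      noncomm_ring
    have h3 : ‖c - c * e‖ ≤ ‖c‖ := by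
      rw [← norm_star, ← norm_star c, star_sub, star_mul, hes]
      exact hec _
    calc ‖J.toQuotient a‖ * ‖J.toQuotient a‖ ≤ ‖a - a * e‖ * ‖a - a * e‖ := by
          rw [h1]
          gcongr <;> exact J.norm_toQuotient_le _
      _ ≤ ‖star a * a - star a * a * e‖ := by
          rw [← CStarRing.norm_star_mul_self, h2]
          exact hec _
      _ = ‖(c - c * e) + ((star a * a - c) - (star a * a - c) * e)‖ := by
          congr 1
          noncomm_ring
      _ ≤ ‖c‖ + ε / 2 := (norm_add_le _ _).trans (add_le_add h3 heε.le)
      _ ≤ _ := by linarith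

instance : NonUnitalCStarAlgebra J.Quotient where
  smul_assoc c x y := by
    obtain ⟨a, rfl⟩ := J.toQuotient_surjective x
    obtain ⟨b, rfl⟩ := J.toQuotient_surjective y
    simp only [smul_eq_mul, ← toQuotient_mul, ← map_smul, smul_mul_assoc]
  smul_comm c x y := by
    obtain ⟨a, rfl⟩ := J.toQuotient_surjective x
    obtain ⟨b, rfl⟩ := J.toQuotient_surjective y
    simp only [smul_eq_mul, ← toQuotient_mul, ← map_smul, mul_smul_comm]
  star_smul c x := by
    obtain ⟨a, rfl⟩ := J.toQuotient_surjective x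
    simp only [← toQuotient_star, ← map_smul, star_smul]

end ClosedIdeal
/-! ## The minimal (spatial) tensor product -/

section Tensor

/-- The Hilbert space tensor product of two Hilbert spaces. -/
abbrev HilbertTensor (H K : Type*) [NormedAddCommGroup H] [InnerProductSpace ℂ H]
    [NormedAddCommGroup K] [InnerProductSpace ℂ K] : Type _ :=
  UniformSpace.Completion (H ⊗[ℂ] K)

variable {H K : Type*} [NormedAddCommGroup H] [InnerProductSpace ℂ H]
    [NormedAddCommGroup K] [InnerProductSpace ℂ K]

/-- The C*-algebra of bounded operators on the Hilbert space tensor product. -/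
def TensorOperators (H K : Type*) [NormedAddCommGroup H] [InnerProductSpace ℂ H]
    [NormedAddCommGroup K] [InnerProductSpace ℂ K] : Type _ :=
  HilbertTensor H K →L[ℂ] HilbertTensor H K

instance : CStarAlgebra (TensorOperators H K) :=
  inferInstanceAs (CStarAlgebra (HilbertTensor H K →L[ℂ] HilbertTensor H K))

/-- The bounded operator `S ⊗ T` on the Hilbert space tensor product. -/
def operatorTensor (S : H →L[ℂ] H) (T : K →L[ℂ] K) :
    TensorOperators H K :=
  (TensorProduct.mapL S T).completion

lemma norm_operatorTensor_le (S : H →L[ℂ] H) (T : K →L[ℂ] K) :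
    ‖operatorTensor S T‖ ≤ ‖S‖ * ‖T‖ := by
  refine ContinuousLinearMap.opNorm_le_bound (TensorProduct.mapL S T).completion (by positivity) fun x => ?_
  induction x using UniformSpace.Completion.induction_on with
  | hp => exact isClosed_le (by fun_prop) (by fun_prop)
  | ih x =>
    rw [ContinuousLinearMap.completion_apply_coe, UniformSpace.Completion.norm_coe,
      UniformSpace.Completion.norm_coe]
    exact (ContinuousLinearMap.le_opNorm _ x).trans
      (mul_le_mul_of_nonneg_right (TensorProduct.norm_mapL_le S T) (norm_nonneg x))
end Tensor

section Family
variable {A B I : Type*} [NonUnitalCStarAlgebra A] [NonUnitalCStarAlgebra B]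
  {H K : I → Type*} [∀ i, NormedAddCommGroup (H i)] [∀ i, InnerProductSpace ℂ (H i)]
  [∀ i, CompleteSpace (H i)] [∀ i, NormedAddCommGroup (K i)] [∀ i, InnerProductSpace ℂ (K i)]
  [∀ i, CompleteSpace (K i)]

/-- The bounded family `i ↦ π i a ⊗ σ i b`. -/
def repTensor (π : ∀ i, A →⋆ₙₐ[ℂ] (H i →L[ℂ] H i)) (σ : ∀ i, B →⋆ₙₐ[ℂ] (K i →L[ℂ] K i))
    (a : A) (b : B) :
    lp (fun i => TensorOperators (H i) (K i)) ∞ :=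
  ⟨fun i => operatorTensor (π i a) (σ i b), memℓp_infty ⟨‖a‖ * ‖b‖, by
    rintro _ ⟨i, rfl⟩
    refine (norm_operatorTensor_le _ _).trans ?_
    gcongr
    · exact NonUnitalStarAlgHom.norm_apply_le (π i) a
    · exact NonUnitalStarAlgHom.norm_apply_le (σ i) b⟩⟩

/-- The C*-algebra generated by the elements `(π i a ⊗ σ i b)_i`. -/
def repTensorAlgebra (π : ∀ i, A →⋆ₙₐ[ℂ] (H i →L[ℂ] H i)) (σ : ∀ i, B →⋆ₙₐ[ℂ] (K i →L[ℂ] K i)) :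
    NonUnitalStarSubalgebra ℂ
      (lp (fun i => TensorOperators (H i) (K i)) ∞) :=
  (NonUnitalStarAlgebra.adjoin ℂ
    (Set.range fun p : A × B => repTensor π σ p.1 p.2)).topologicalClosure

instance (π : ∀ i, A →⋆ₙₐ[ℂ] (H i →L[ℂ] H i)) (σ : ∀ i, B →⋆ₙₐ[ℂ] (K i →L[ℂ] K i)) :
    IsClosed (repTensorAlgebra π σ :
      Set (lp (fun i => TensorOperators (H i) (K i)) ∞)) :=
  NonUnitalStarSubalgebra.isClosed_topologicalClosure _

instance (π : ∀ i, A →⋆ₙₐ[ℂ] (H i →L[ℂ] H i)) (σ : ∀ i, B →⋆ₙₐ[ℂ] (K i →L[ℂ] K i)) :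
    NonUnitalCStarAlgebra (repTensorAlgebra π σ) := inferInstance
end Family

section Min

attribute [local instance 50] CStarAlgebra.spectralOrder CStarAlgebra.spectralOrderedRing

/-- The minimal tensor product `A ⊗ B`: the C*-algebra generated by the elementary tensors in the
product of the representations `π_f ⊗ π_g`, where `π_f` and `π_g` are the GNS representations for
the positive functionals `f` on `A` and `g` on `B`. Hence the norm of a finite sum
`∑ a k ⊗ b k` is the supremum over `f, g` of the operator norms of `∑ π_f (a k) ⊗ π_g (b k)`. -/
def MinTensor (A B : Type*) [NonUnitalCStarAlgebra A] [NonUnitalCStarAlgebra B] : Type _ :=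
  repTensorAlgebra (I := (A →ₚ[ℂ] ℂ) × (B →ₚ[ℂ] ℂ))
    (fun p => p.1.gnsNonUnitalStarAlgHom) (fun p => p.2.gnsNonUnitalStarAlgHom)

instance (A B : Type*) [NonUnitalCStarAlgebra A] [NonUnitalCStarAlgebra B] :
    NonUnitalCStarAlgebra (MinTensor A B) :=
  inferInstanceAs <| NonUnitalCStarAlgebra (repTensorAlgebra (I := (A →ₚ[ℂ] ℂ) × (B →ₚ[ℂ] ℂ))
    (fun p => p.1.gnsNonUnitalStarAlgHom) (fun p => p.2.gnsNonUnitalStarAlgHom))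

end Min

end DecRank

end

open scoped ComplexOrder TensorProduct ENNReal

noncomputable section

namespace DecRank

/-! ### Complete positivity through Gram matrices; the Kadison–Schwarz inequality. -/

section CompletelyPositive

attribute [local instance 50] CStarAlgebra.spectralOrder CStarAlgebra.spectralOrderedRing

variable {A B C : Type*} [NonUnitalCStarAlgebra A] [NonUnitalCStarAlgebra B]
  [NonUnitalCStarAlgebra C]

/-! The maps ψ out of the algebra are what makes the decomposition rank hard to transport: along a
quotient map or into an inductive limit they go the wrong way. The proof therefore replaces
approximations B → F → B by models. A model of a finite set is a completely positive contraction φ :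
F → B, of order zero on each of N + 1 colours of blocks, such that every b in the set has some y ∈ F
with φ(y) ≈ b and φ(y y*) ≈ b b*. By `decompositionRank_le_iff`, dr B ≤ N holds exactly when all
finite sets have models of all precisions.

Approximations give models with y = ψ(b): by Kadison–Schwarz, φ(y) φ(y)* ≤ φ(y y*) ≤ φ(ψ(b b*)), and
both ends are close to b b*. Conversely, φ(y y*) ≈ φ(y) φ(y)* puts y almost into the multiplicative
domain of φ, whence b φ(x) ≈ φ(y x), uniformly for ‖x‖ ≤ 1. On a single block an order zero map φ_i
is a multiple of an isometry, and φ_i(x) φ_i(x') depends only on x x'. Let t = ‖φ_i(e_aa)‖ be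
nonzero and let ρ be a contractive positive functional with ρ(φ_i(e_aa)²) = t². Then b ↦ t⁻²
(ρ(φ_i(e_pa)* b φ_i(e_qa)))_{p,q} is a completely positive contraction which recovers y_i from b,
with an error controlled after multiplication by t (`PreservesZeroProducts.exists_leftInverse`).
Blocks of one colour have orthogonal images, so these weighted errors add up to (N + 1) δ, whatever
the number of blocks (`OrderZeroOn.norm_map_le`).

Models push forward along *-homomorphisms, which settles quotients and inductive limits. In a direct
sum the two models can share their colours. For tensor products it suffices to model elementary
tensors, because they have dense span (`hasApproximateModels_of_span`), and the tensor product of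
two models is a model coloured by pairs. An AF algebra has exact models of one colour, because
finite-dimensional *-subalgebras are images of sums of matrix algebras (`exists_hom_range_eq`).

Hereditary subalgebras S require a perturbation. Choose d ∈ S almost acting as a unit on the given
set, and cut F down to the spectral subspace of a = ψ(d²) for [1/2, ∞). This hardly changes the
relevant elements (`OrderZeroOn.exists_corner`), and the unit of the corner is now sent below 2 φ(a)
≈ 2 d². Each colour is then conjugated by an element y_j of the closed right ideal generated by some
e ∈ S with e d ≈ d. The choice is made so that y_j* y_j is a function of the image of the unit of
that colour. It hence commutes with the images of the blocks of that colour, and order zero survives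
(`exists_multiplier`, `OrderZeroOn.twist`, `IsHereditary.exists_orderZeroOn`). -/

lemma cstarMatrix_gram_nonneg {ι κ : Type*} [Fintype ι] [Fintype κ] (z : κ → ι → A) :
    0 ≤ (CStarMatrix.ofMatrix fun i j => ∑ c, star (z c i) * z c j : CStarMatrix ι ι A) := by
  classical
  have h : (CStarMatrix.ofMatrix fun i j => ∑ c, star (z c i) * z c j : CStarMatrix ι ι A) =
      ∑ c, (CStarMatrix.ofMatrix fun i j => star (z c i) * z c j : CStarMatrix ι ι A) := by
    ext i j
    change ∑ c, star (z c i) * z c j =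
      (∑ c, (Matrix.of fun i j => star (z c i) * z c j : Matrix ι ι A)) i j
    rw [Matrix.sum_apply]
    rfl
  rw [h]
  refine Finset.sum_nonneg fun c _ => ?_
  rcases isEmpty_or_nonempty ι with hι | ⟨⟨i₀⟩⟩
  · exact le_of_eq (by ext i; exact (hι.false i).elim)
  -- The matrix whose only nonzero row, in position `i₀`, is `z c`.
  · let N : CStarMatrix ι ι A := CStarMatrix.ofMatrix fun i j => if i = i₀ then z c j else 0
    have : (CStarMatrix.ofMatrix fun i j => star (z c i) * z c j : CStarMatrix ι ι A) =
        star N * N := by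
      ext i j
      rw [CStarMatrix.mul_apply]
      simp_rw [CStarMatrix.star_apply]
      change star (z c i) * z c j =
        ∑ x, star (if x = i₀ then z c i else 0) * (if x = i₀ then z c j else 0)
      rw [Finset.sum_eq_single i₀ (by intro b _ hb; simp [hb]) (by simp)]
      simp
    rw [this]
    exact star_mul_self_nonneg N

lemma exists_eq_star_mul_self {E : Type*} [NonUnitalCStarAlgebra E] [PartialOrder E]
    [StarOrderedRing E] {a : E} (ha : 0 ≤ a) : ∃ b, a = star b * b :=
  CStarAlgebra.nonneg_iff_eq_star_mul_self.1 ha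

lemma exists_cstarMatrix_gram {ι : Type*} [Fintype ι] {M : CStarMatrix ι ι A} (hM : 0 ≤ M) :
    ∃ w : ι → ι → A, ∀ i j, M i j = ∑ c, star (w c i) * w c j := by
  obtain ⟨N, rfl⟩ := exists_eq_star_mul_self hM
  exact ⟨fun c i => N c i, fun i j => by simp [CStarMatrix.mul_apply, CStarMatrix.star_apply]⟩

/-- A completely positive map sends Gram matrices to Gram matrices. -/
lemma IsCompletelyPositive.exists_gram {φ : A →ₗ[ℂ] B} (hφ : IsCompletelyPositive φ)
    {ι κ : Type*} [Fintype ι] [Fintype κ] (z : κ → ι → A) :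
    ∃ w : ι → ι → B, ∀ i j,
      φ (∑ c, star (z c i) * z c j) = ∑ c, star (w c i) * w c j := by
  obtain ⟨Φ, rfl⟩ := hφ
  exact exists_cstarMatrix_gram (Φ.map_cstarMatrix_nonneg _ (cstarMatrix_gram_nonneg z))

/-- The positive matrices over a C*-algebra are exactly the Gram matrices. The summation index `κ`
is left free, so that families can be concatenated without being reshaped into square ones. -/
lemma IsCompletelyPositive.of_gram {φ : A →ₗ[ℂ] B}
    (h : ∀ (k : ℕ) (z : Fin k → Fin k → A), ∃ (κ : Type) (_ : Fintype κ) (w : κ → Fin k → B),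
      ∀ i j, φ (∑ c, star (z c i) * z c j) = ∑ c, star (w c i) * w c j) :
    IsCompletelyPositive φ := by
  refine ⟨⟨φ, fun k M hM => ?_⟩, rfl⟩
  obtain ⟨z, hz⟩ := exists_cstarMatrix_gram hM
  obtain ⟨κ, _, w, hw⟩ := h k z
  convert cstarMatrix_gram_nonneg w using 1
  ext i j
  rw [CStarMatrix.map_apply, hz]
  exact hw i j

/-- A map is completely positive if it is, on products `star x * y`, a finite sum of maps of the
form `star (T x) * T y` with `T` additive. -/
lemma IsCompletelyPositive.of_forall_star_mul {φ : A →ₗ[ℂ] B} {κ : Type} [Fintype κ]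
    (T : κ → A → B) (h : ∀ x y, φ (star x * y) = ∑ c, star (T c x) * T c y) :
    IsCompletelyPositive φ := by
  refine .of_gram fun k z => ⟨Fin k × κ, inferInstance, fun c i => T c.2 (z c.1 i), fun i j => ?_⟩
  simp only [map_sum, h, Fintype.sum_prod_type]

lemma IsCompletelyPositive.comp {ψ : B →ₗ[ℂ] C} {φ : A →ₗ[ℂ] B} (hψ : IsCompletelyPositive ψ)
    (hφ : IsCompletelyPositive φ) : IsCompletelyPositive (ψ ∘ₗ φ) := by
  refine .of_gram fun k z => ?_
  obtain ⟨w, hw⟩ := hφ.exists_gram z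
  obtain ⟨v, hv⟩ := hψ.exists_gram w
  exact ⟨Fin k, inferInstance, v, fun i j => by rw [LinearMap.comp_apply, hw, hv]⟩

lemma IsCompletelyPositive.add {ψ φ : A →ₗ[ℂ] B} (hψ : IsCompletelyPositive ψ)
    (hφ : IsCompletelyPositive φ) : IsCompletelyPositive (ψ + φ) := by
  refine .of_gram fun k z => ?_
  obtain ⟨w, hw⟩ := hψ.exists_gram z
  obtain ⟨v, hv⟩ := hφ.exists_gram z
  exact ⟨Fin k ⊕ Fin k, inferInstance, Sum.elim w v, fun i j => by
    rw [LinearMap.add_apply, hw, hv, Fintype.sum_sum_type]; simp⟩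

lemma isCompletelyPositive_zero : IsCompletelyPositive (0 : A →ₗ[ℂ] B) :=
  .of_gram fun k _ => ⟨Fin 0, inferInstance, fun _ _ => 0, fun i j => by simp⟩

lemma IsCompletelyPositive.sum {ι : Type*} {φ : ι → A →ₗ[ℂ] B} (s : Finset ι)
    (h : ∀ i, IsCompletelyPositive (φ i)) : IsCompletelyPositive (∑ i ∈ s, φ i) :=
  Finset.sum_induction _ _ (fun _ _ => IsCompletelyPositive.add) isCompletelyPositive_zero
    fun i _ => h i

lemma isCompletelyPositive_hom (π : A →⋆ₙₐ[ℂ] B) :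
    IsCompletelyPositive (π : A →ₗ[ℂ] B) :=
  .of_forall_star_mul (κ := Fin 1) (fun _ => π) fun x y => by simp [StarHomClass.map_star]

/-- The map `a ↦ y * a * star y`. -/
def conjMap (y : A) : A →ₗ[ℂ] A := LinearMap.mulLeft ℂ y ∘ₗ LinearMap.mulRight ℂ (star y)

@[simp]
lemma conjMap_apply (y a : A) : conjMap y a = y * a * star y := by simp [conjMap, mul_assoc]

lemma isCompletelyPositive_conjMap (y : A) : IsCompletelyPositive (conjMap y) :=
  .of_forall_star_mul (κ := Fin 1) (fun _ x => x * star y) fun x z => by simp [mul_assoc]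

lemma IsCompletelyPositive.smul {φ : A →ₗ[ℂ] B} (hφ : IsCompletelyPositive φ) {t : ℝ}
    (ht : 0 ≤ t) : IsCompletelyPositive ((t : ℂ) • φ) := by
  refine .of_gram fun k z => ?_
  obtain ⟨w, hw⟩ := hφ.exists_gram z
  refine ⟨Fin k, inferInstance, fun c i => ((√t : ℝ) : ℂ) • w c i, fun i j => ?_⟩
  rw [LinearMap.smul_apply, hw, Finset.smul_sum]
  refine Finset.sum_congr rfl fun c _ => ?_
  rw [star_smul, smul_mul_smul_comm]
  congr 1
  simp [← Complex.ofReal_mul, Real.mul_self_sqrt ht]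

lemma isCompletelyPositive_pi {ι : Type} [Fintype ι] {G : ι → Type*}
    [∀ i, NonUnitalCStarAlgebra (G i)] {φ : ∀ i, A →ₗ[ℂ] G i}
    (h : ∀ i, IsCompletelyPositive (φ i)) : IsCompletelyPositive (LinearMap.pi φ) := by
  refine .of_gram fun k z => ?_
  choose w hw using fun i => (h i).exists_gram z
  refine ⟨Fin k, inferInstance, fun c a i => w i c a, fun a b => ?_⟩
  ext i
  simp [hw i a b]

lemma IsCompletelyPositive.map_star_mul_self_nonneg {φ : A →ₗ[ℂ] B} (hφ : IsCompletelyPositive φ)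
    (x : A) : 0 ≤ φ (star x * x) := by
  obtain ⟨w, hw⟩ := hφ.exists_gram (ι := Fin 1) (κ := Fin 1) fun _ _ => x
  have := hw 0 0
  simp only [Finset.univ_unique, Finset.sum_singleton] at this
  rw [this]
  exact star_mul_self_nonneg _

lemma IsCompletelyPositive.map_nonneg {φ : A →ₗ[ℂ] B} (hφ : IsCompletelyPositive φ)
    {x : A} (hx : 0 ≤ x) : 0 ≤ φ x := by
  obtain ⟨y, rfl⟩ := exists_eq_star_mul_self hx
  exact hφ.map_star_mul_self_nonneg y

lemma IsCompletelyPositive.mono {φ : A →ₗ[ℂ] B} (hφ : IsCompletelyPositive φ)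
    {x y : A} (h : x ≤ y) : φ x ≤ φ y := by
  rw [← sub_nonneg, ← map_sub]
  exact hφ.map_nonneg (sub_nonneg.2 h)

lemma IsCompletelyPositive.map_star {φ : A →ₗ[ℂ] B} (hφ : IsCompletelyPositive φ) (x : A) :
    φ (star x) = star (φ x) := by
  obtain ⟨Φ, rfl⟩ := hφ
  exact StarHomClass.map_star Φ x

open CStarModule WithCStarModule in
/-- The Cauchy–Schwarz inequality in the Hilbert C*-module `Bⁿ`. -/
lemma star_sum_mul_sum_le {κ : Type*} [Fintype κ] (u x : κ → B) :
    star (∑ c, star (u c) * x c) * (∑ c, star (u c) * x c) ≤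
      ‖∑ c, star (u c) * u c‖ • ∑ c, star (x c) * x c := by
  -- The inner product of the module is ∑ y_c x_c*, so the vectors are entered through their
  -- adjoints.
  let U : C⋆ᵐᵒᵈ(B, κ → B) := (WithCStarModule.equiv B (κ → B)).symm fun c => star (u c)
  let X : C⋆ᵐᵒᵈ(B, κ → B) := (WithCStarModule.equiv B (κ → B)).symm fun c => star (x c)
  have hi : ∀ p q : κ → B, inner B ((WithCStarModule.equiv B (κ → B)).symm fun c => star (p c))
      ((WithCStarModule.equiv B (κ → B)).symm fun c => star (q c)) = ∑ c, star (q c) * p c := by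
    intro p q
    rw [WithCStarModule.pi_inner]
    simp [WithCStarModule.inner_def]
  have h := CStarModule.inner_mul_inner_swap_le (A := B) (x := U) (y := X)
  rw [CStarModule.norm_sq_eq B, hi, hi, hi, hi] at h
  refine le_trans (le_of_eq ?_) h
  congr 1
  simp [star_sum]

/-- The Kadison–Schwarz inequality. -/
lemma IsCompletelyPositive.kadison_schwarz {φ : A →ₗ[ℂ] B} (hφ : IsCompletelyPositive φ)
    (u x : A) : star (φ (star u * x)) * φ (star u * x) ≤ ‖φ (star u * u)‖ • φ (star x * x) := by
  -- The 2 × 2 Gram matrix of the row (u, x) is sent to a Gram matrix; Cauchy–Schwarz then bounds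
  -- its off-diagonal entry by its diagonal ones.
  obtain ⟨w, hw⟩ := hφ.exists_gram (ι := Fin 2) (κ := Fin 1) fun _ => ![u, x]
  have h01 := hw 0 1
  have h00 := hw 0 0
  have h11 := hw 1 1
  simp only [Finset.univ_unique, Finset.sum_singleton, Matrix.cons_val_zero,
    Matrix.cons_val_one] at h01 h00 h11
  rw [h01, h00, h11]
  exact star_sum_mul_sum_le _ _

end CompletelyPositive

end DecRank

end

open scoped ComplexOrder TensorProduct ENNReal

noncomputable section

namespace DecRank

/-! ### Norm estimates: defect of multiplicativity, orthogonal sums, norming functionals. -/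

section Estimates

attribute [local instance 50] CStarAlgebra.spectralOrder CStarAlgebra.spectralOrderedRing

variable {A B : Type*} [NonUnitalCStarAlgebra A] [NonUnitalCStarAlgebra B]

lemma norm_le_of_nonneg_of_le {a b : A} (ha : 0 ≤ a) (h : a ≤ b) : ‖a‖ ≤ ‖b‖ :=
  CStarAlgebra.norm_le_norm_of_nonneg_of_le ha h

lemma exists_contraction_forall_norm_sub_lt (T : Finset A) {ε : ℝ} (hε : 0 < ε) :
    ∃ u : A, 0 ≤ u ∧ ‖u‖ ≤ 1 ∧ ∀ x ∈ T, ‖u * x - x‖ < ε := by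
  have hu := CStarAlgebra.increasingApproximateUnit A
  have h1 : ∀ᶠ u in CStarAlgebra.approximateUnit A, ∀ x ∈ T, ‖u * x - x‖ < ε := by
    rw [Filter.eventually_all_finset]
    intro x _
    have := (Metric.tendsto_nhds.1 (hu.tendsto_mul_right x)) ε hε
    simpa only [dist_eq_norm] using this
  obtain ⟨u, ⟨h0, h2⟩, h3⟩ := ((hu.eventually_nonneg.and hu.eventually_norm).and h1).exists
  exact ⟨u, h0, h2, h3⟩

/-- The Kadison–Schwarz inequality for contractions. -/
lemma IsCPC.star_map_mul_map_le {φ : A →ₗ[ℂ] B} (hφ : IsCPC φ) (x : A) :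
    star (φ x) * φ x ≤ φ (star x * x) := by
  have hc : Continuous φ := (φ.mkContinuous 1 (by simpa using hφ.2)).continuous
  -- `A` need not have a unit to insert for `u` in `kadison_schwarz`; an approximate unit is
  -- inserted instead, followed by a passage to the limit.
  have hle : ∀ u : A, 0 ≤ u → ‖u‖ ≤ 1 → star (φ (u * x)) * φ (u * x) ≤ φ (star x * x) := by
    intro u hu0 hu
    have hs : star u = u := (IsSelfAdjoint.of_nonneg hu0).star_eq
    have h := hφ.1.kadison_schwarz u x
    rw [hs] at h
    refine h.trans ?_
    have h0 : 0 ≤ φ (star x * x) := hφ.1.map_star_mul_self_nonneg x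
    have h1 : ‖φ (u * u)‖ ≤ 1 := (hφ.2 _).trans ((norm_mul_le _ _).trans
      (mul_le_one₀ hu (norm_nonneg _) hu))
    calc ‖φ (u * u)‖ • φ (star x * x) ≤ (1 : ℝ) • φ (star x * x) :=
          smul_le_smul_of_nonneg_right h1 h0
      _ = _ := one_smul _ _
  choose u hu0 hu1 hu2 using fun n : ℕ =>
    exists_contraction_forall_norm_sub_lt {x} (Nat.one_div_pos_of_nat (n := n) (α := ℝ))
  have ht : Filter.Tendsto (fun n => u n * x) Filter.atTop (nhds x) := by
    rw [tendsto_iff_norm_sub_tendsto_zero]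
    exact squeeze_zero (fun _ => norm_nonneg _) (fun n => (hu2 n x (Finset.mem_singleton_self x)).le)
      tendsto_one_div_add_atTop_nhds_zero_nat
  have ht2 : Filter.Tendsto (fun n => φ (star x * x) - star (φ (u n * x)) * φ (u n * x))
      Filter.atTop (nhds (φ (star x * x) - star (φ x) * φ x)) := by
    refine tendsto_const_nhds.sub (Filter.Tendsto.mul ?_ ?_)
    · exact (continuous_star.tendsto _).comp ((hc.tendsto _).comp ht)
    · exact (hc.tendsto _).comp ht
  exact sub_nonneg.1 (CStarAlgebra.isClosed_nonneg.mem_of_tendsto ht2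
    (Filter.Eventually.of_forall fun n => sub_nonneg.2 (hle _ (hu0 n) (hu1 n))))

/-- This is φ applied to x* x ≤ ‖x‖² e. The unit is an element `e` rather than a unital structure,
so that `A` stays a `NonUnitalCStarAlgebra`. -/
lemma IsCompletelyPositive.norm_map_star_mul_self_le {φ : A →ₗ[ℂ] B}
    (hφ : IsCompletelyPositive φ) {e : A} (hes : star e = e) (he : ∀ x, e * x = x) (x : A) :
    φ (star x * x) ≤ (‖x‖ ^ 2) • φ e := by
  have her : ∀ x, x * e = x := fun x => by
    rw [← star_star (x * e), star_mul, hes, he, star_star]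
  have h := CStarAlgebra.star_left_conjugate_le_norm_smul (a := e) (b := star x * x)
    (.star_mul_self x)
  rw [her, hes, he, he, CStarRing.norm_star_mul_self, ← sq] at h
  refine (hφ.mono h).trans (le_of_eq ?_)
  exact LinearMap.map_smul_of_tower φ (‖x‖ ^ 2) e

/-- A completely positive map on a unital algebra has norm `‖φ 1‖`. -/
lemma IsCompletelyPositive.norm_map_le {φ : A →ₗ[ℂ] B}
    (hφ : IsCompletelyPositive φ) {e : A} (hes : star e = e) (he : ∀ x, e * x = x) (x : A) :
    ‖φ x‖ ≤ ‖φ e‖ * ‖x‖ := by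
  have h := hφ.kadison_schwarz e x
  rw [hes, he, he] at h
  have h1 := norm_le_of_nonneg_of_le (star_mul_self_nonneg _) h
  rw [CStarRing.norm_star_mul_self, norm_smul, norm_norm] at h1
  have h2 := norm_le_of_nonneg_of_le (hφ.map_star_mul_self_nonneg x)
    (hφ.norm_map_star_mul_self_le hes he x)
  rw [norm_smul, Real.norm_of_nonneg (sq_nonneg _)] at h2
  refine (mul_self_le_mul_self_iff (by positivity) (by positivity)).2 (h1.trans ?_)
  calc ‖φ e‖ * ‖φ (star x * x)‖ ≤ ‖φ e‖ * (‖x‖ ^ 2 * ‖φ e‖) := by gcongr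
    _ = _ := by ring

/-- By the parallelogram law each D(cu + v, cu + v) with |c| = 1 is dominated by 2(D(u,u) + D(v,v)),
and polarization writes 4 D(u,v) as a combination of four such values. The constant is crude, but
only positivity on the diagonal is needed. -/
lemma norm_sesq_le {E : Type*} [AddCommGroup E] [Module ℂ E] (D : E →ₗ⋆[ℂ] E →ₗ[ℂ] B)
    (hD : ∀ w, 0 ≤ D w w) (u v : E) : ‖D u v‖ ≤ 2 * (‖D u u‖ + ‖D v v‖) := by
  have hle : ∀ c : ℂ, star c * c = 1 →
      ‖D (c • u + v) (c • u + v)‖ ≤ 2 * (‖D u u‖ + ‖D v v‖) := by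
    intro c hc
    have hc' : (starRingEnd ℂ) c * c = 1 := hc
    have h1 : D (c • u + v) (c • u + v) + D (c • u - v) (c • u - v) =
        (2 : ℝ) • (D u u + D v v) := by
      simp only [map_add, map_sub, LinearMap.add_apply, LinearMap.sub_apply, map_smulₛₗ,
        LinearMap.smul_apply, RingHom.id_apply, smul_smul, two_smul, smul_add, smul_sub]
      simp only [mul_comm c, hc', one_smul]
      abel
    have h2 := norm_le_of_nonneg_of_le (hD (c • u + v))
      (h1 ▸ le_add_of_nonneg_right (hD (c • u - v)))
    refine h2.trans ?_
    rw [norm_smul, Real.norm_two]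
    gcongr
    exact norm_add_le _ _
  have hpol : (4 : ℂ) • D u v = D ((1 : ℂ) • u + v) ((1 : ℂ) • u + v)
      - D ((-1 : ℂ) • u + v) ((-1 : ℂ) • u + v)
      + Complex.I • D (Complex.I • u + v) (Complex.I • u + v)
      - Complex.I • D ((-Complex.I) • u + v) ((-Complex.I) • u + v) := by
    simp only [map_add, LinearMap.add_apply, map_smulₛₗ,
        LinearMap.smul_apply, RingHom.id_apply, smul_smul, smul_add, map_neg, map_one,
        Complex.conj_I]
    match_scalars <;> ring_nf <;> simp <;> norm_num
  have h4 : ‖(4 : ℂ) • D u v‖ ≤ 4 * (2 * (‖D u u‖ + ‖D v v‖)) := by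
    rw [hpol]
    refine (norm_sub_le _ _).trans ?_
    refine (add_le_add_left ((norm_add_le _ _).trans
      (add_le_add_left (norm_sub_le _ _) _)) _).trans ?_
    rw [norm_smul, norm_smul, Complex.norm_I, one_mul, one_mul]
    have := hle 1 (by simp)
    have := hle (-1) (by simp)
    have := hle Complex.I (by simp)
    have := hle (-Complex.I) (by simp)
    linarith
  rw [norm_smul] at h4
  norm_num at h4
  linarith

/-- The defect of multiplicativity `φ (u* v) - φ(u)* φ(v)`, as a sesquilinear map. -/
def mulDefect (φ : A →ₗ[ℂ] B) : A →ₗ⋆[ℂ] A →ₗ[ℂ] B :=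
  LinearMap.mk₂'ₛₗ (starRingEnd ℂ) (RingHom.id ℂ)
    (fun u v => φ (star u * v) - star (φ u) * φ v)
    (fun u u' v => by simp [add_mul]; abel)
    (fun c u v => by
      rw [star_smul, smul_mul_assoc, map_smul, map_smul, star_smul, smul_mul_assoc, smul_sub]
      rfl)
    (fun u v v' => by simp [mul_add]; abel)
    (fun c u v => by
      rw [mul_smul_comm, map_smul, map_smul, mul_smul_comm, smul_sub]
      rfl)

@[simp]
lemma mulDefect_apply (φ : A →ₗ[ℂ] B) (u v : A) :
    mulDefect φ u v = φ (star u * v) - star (φ u) * φ v := rfl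

lemma IsCPC.mulDefect_nonneg {φ : A →ₗ[ℂ] B} (hφ : IsCPC φ) (u : A) : 0 ≤ mulDefect φ u u :=
  sub_nonneg.2 (hφ.star_map_mul_map_le u)

lemma IsCPC.norm_mulDefect_le {φ : A →ₗ[ℂ] B} (hφ : IsCPC φ) (u v : A) :
    ‖mulDefect φ u v‖ ≤ 2 * (‖mulDefect φ u u‖ + ‖mulDefect φ v v‖) :=
  norm_sesq_le _ hφ.mulDefect_nonneg u v

lemma IsCPC.norm_mulDefect_self_le {φ : A →ₗ[ℂ] B} (hφ : IsCPC φ) (u : A) :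
    ‖mulDefect φ u u‖ ≤ ‖u‖ ^ 2 := by
  refine (norm_le_of_nonneg_of_le (hφ.mulDefect_nonneg u)
    (sub_le_self _ (star_mul_self_nonneg _))).trans ((hφ.2 _).trans ?_)
  rw [CStarRing.norm_star_mul_self, sq]

/-- Rescaling u by ‖v‖ and v by t balances the two terms of `norm_mulDefect_le`. This is the
quantitative multiplicative domain: a small defect at u makes the defect of u against every v small.
-/
lemma IsCPC.norm_mulDefect_le_of_le {φ : A →ₗ[ℂ] B} (hφ : IsCPC φ) {u : A} {t : ℝ} (ht : 0 < t)
    (hu : ‖mulDefect φ u u‖ ≤ t ^ 2) (v : A) : ‖mulDefect φ u v‖ ≤ 4 * t * ‖v‖ := by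
  rcases (norm_nonneg v).eq_or_lt' with hv | hv
  · rw [norm_eq_zero.1 hv]
    simp
  have h := hφ.norm_mulDefect_le (((‖v‖ : ℝ) : ℂ) • u) ((t : ℂ) • v)
  simp only [map_smulₛₗ, LinearMap.smul_apply, RingHom.id_apply, norm_smul, Complex.conj_ofReal,
    Complex.norm_real, Real.norm_of_nonneg ht.le, norm_norm] at h
  have hv2 := hφ.norm_mulDefect_self_le v
  have h3 : ‖v‖ * t * ‖mulDefect φ u v‖ ≤ ‖v‖ * t * (4 * t * ‖v‖) := by
    calc ‖v‖ * t * ‖mulDefect φ u v‖ = ‖v‖ * (t * ‖mulDefect φ u v‖) := by ring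
      _ ≤ 2 * (‖v‖ * (‖v‖ * ‖mulDefect φ u u‖) + t * (t * ‖mulDefect φ v v‖)) := by
        refine le_trans (le_of_eq ?_) h
        ring
      _ ≤ 2 * (‖v‖ * (‖v‖ * t ^ 2) + t * (t * ‖v‖ ^ 2)) := by gcongr
      _ = _ := by ring
  exact le_of_mul_le_mul_left h3 (by positivity)

/-- Both φ(y y*) and φ(y) φ(y)* are close to b b*. This is how the two conditions of a model place
`star y` almost into the multiplicative domain; the adjoint appears because the first variable of
`mulDefect` is starred. -/
lemma IsCPC.norm_map_mul_star_sub_le {φ : A →ₗ[ℂ] B}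
    (hφ : IsCPC φ) {y : A} {b : B} {η C : ℝ} (hη1 : η ≤ 1) (hb : ‖b‖ ≤ C)
    (h1 : ‖φ y - b‖ ≤ η) (h2 : ‖φ (y * star y) - b * star b‖ ≤ η) :
    ‖mulDefect φ (star y) (star y)‖ ≤ η * (2 * C + 2) := by
  have hη0 : 0 ≤ η := (norm_nonneg _).trans h1
  have hC0 : 0 ≤ C := (norm_nonneg _).trans hb
  rw [mulDefect_apply, hφ.1.map_star, star_star, star_star]
  have e1 : b * star b - φ y * star (φ y) = (b - φ y) * star b + φ y * star (b - φ y) := by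
    rw [star_sub]; noncomm_ring
  have n1 := norm_mul_le (b - φ y) (star b)
  have n2 := norm_mul_le (φ y) (star (b - φ y))
  rw [norm_star, norm_sub_rev] at n1 n2
  have n0 : ‖φ y‖ ≤ C + 1 := by
    have := norm_sub_norm_le (φ y) b
    linarith
  have n3 : ‖φ y - b‖ * ‖b‖ ≤ η * C := mul_le_mul h1 hb (norm_nonneg _) hη0
  have n4 : ‖φ y‖ * ‖φ y - b‖ ≤ (C + 1) * η := mul_le_mul n0 h1 (norm_nonneg _) (by positivity)
  have n5 : ‖b * star b - φ y * star (φ y)‖ ≤ η * (2 * C + 1) := by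
    rw [e1]
    refine (norm_add_le _ _).trans ?_
    linarith
  have := norm_sub_le_norm_sub_add_norm_sub (φ (y * star y)) (b * star b) (φ y * star (φ y))
  linarith

/-- Each use of the C*-identity replaces x_i by x_i* x_i, again pairwise orthogonal, and squares the
norms. The triangle inequality, used only at the last stage, then costs a factor independent of m.
-/
lemma norm_sum_pow_le_of_orthogonal {ι : Type*} (s : Finset ι) (m : ℕ) :
    ∀ (x : ι → B) (C : ℝ), (∀ i ∈ s, ‖x i‖ ≤ C) →
      (∀ i ∈ s, ∀ j ∈ s, i ≠ j → star (x i) * x j = 0) →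
      (∀ i ∈ s, ∀ j ∈ s, i ≠ j → x i * star (x j) = 0) →
      ‖∑ i ∈ s, x i‖ ^ 2 ^ m ≤ s.card * C ^ 2 ^ m := by
  classical
  induction m with
  | zero =>
    intro x C hC _ _
    simpa using (norm_sum_le _ _).trans (Finset.sum_le_card_nsmul s _ C hC)
  | succ m ih =>
    intro x C hC h1 h2
    have hsum : star (∑ i ∈ s, x i) * ∑ i ∈ s, x i = ∑ i ∈ s, star (x i) * x i := by
      rw [star_sum, Finset.sum_mul_sum]
      refine Finset.sum_congr rfl fun i hi => ?_
      exact Finset.sum_eq_single_of_mem i hi fun j hj hij => h1 i hi j hj hij.symm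
    have h := ih (fun i => star (x i) * x i) (C ^ 2) (fun i hi => by
        rw [CStarRing.norm_star_mul_self, ← sq]
        gcongr
        exact hC i hi)
      (fun i hi j hj hij => by
        rw [star_mul, star_star, mul_assoc, ← mul_assoc (x i), h2 i hi j hj hij, zero_mul,
          mul_zero])
      (fun i hi j hj hij => by
        rw [star_mul, star_star, mul_assoc, ← mul_assoc (x i), h2 i hi j hj hij, zero_mul,
          mul_zero])
    rw [← hsum, CStarRing.norm_star_mul_self, ← sq, ← pow_mul, ← pow_mul, ← pow_succ'] at h
    exact h

/-- The norm of a finite sum of pairwise orthogonal elements is at most the maximum of the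
norms. -/
lemma norm_sum_le_of_orthogonal {ι : Type*} (s : Finset ι) {x : ι → B} {C : ℝ} (hC0 : 0 ≤ C)
    (hC : ∀ i ∈ s, ‖x i‖ ≤ C)
    (h1 : ∀ i ∈ s, ∀ j ∈ s, i ≠ j → star (x i) * x j = 0)
    (h2 : ∀ i ∈ s, ∀ j ∈ s, i ≠ j → x i * star (x j) = 0) :
    ‖∑ i ∈ s, x i‖ ≤ C := by
  refine le_of_forall_pos_le_add fun δ hδ => ?_
  -- A positive bound to divide by. If the norm exceeded `D`, the powers r^(2^m) would be unbounded,
  -- whereas they stay below the number of terms.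
  set D := C + δ with hD
  have hD0 : 0 < D := by positivity
  by_contra! hlt
  set r := ‖∑ i ∈ s, x i‖ / D with hr
  have hr1 : 1 < r := (one_lt_div hD0).2 hlt
  have hb : ∀ m : ℕ, r ^ 2 ^ m ≤ s.card := fun m => by
    rw [hr, div_pow, div_le_iff₀ (by positivity)]
    refine norm_sum_pow_le_of_orthogonal s m x D (fun i hi => (hC i hi).trans ?_) h1 h2
    linarith
  obtain ⟨m, hm⟩ := pow_unbounded_of_one_lt (s.card : ℝ) hr1
  have : r ^ m ≤ r ^ 2 ^ m := pow_le_pow_right₀ hr1.le (Nat.lt_two_pow_self).le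
  linarith [hb m]

/-- A contractive functional on a unital C*-algebra taking the value `1` at `1` is positive. -/
lemma nonneg_of_norm_le_of_map_one {U : Type*} [CStarAlgebra U] [PartialOrder U]
    [StarOrderedRing U] (g : U →ₗ[ℂ] ℂ) (hg : ∀ x, ‖g x‖ ≤ ‖x‖) (h1 : g 1 = 1) {y : U}
    (hy : 0 ≤ y) : 0 ≤ g y := by
  rcases subsingleton_or_nontrivial U with _ | _
  · rw [Subsingleton.elim y 0, map_zero]
  -- Testing on h + i t 1 gives (Im g(h) + t)² ≤ ‖h‖² + t² for all real t, which forces Im g(h) = 0.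
  have hre : ∀ h : U, IsSelfAdjoint h → (g h).im = 0 := by
    intro h hh
    have key : ∀ t : ℝ, 2 * (g h).im * t ≤ ‖h‖ ^ 2 := by
      intro t
      have e1 : ‖h + ((t : ℂ) * Complex.I) • (1 : U)‖ ^ 2 ≤ ‖h‖ ^ 2 + t ^ 2 := by
        rw [sq, ← CStarRing.norm_star_mul_self]
        have : star (h + ((t : ℂ) * Complex.I) • (1 : U)) * (h + ((t : ℂ) * Complex.I) • (1 : U))
            = h * h + ((t ^ 2 : ℝ) : ℂ) • (1 : U) := by
          rw [star_add, hh.star_eq, star_smul, star_one]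
          simp only [add_mul, mul_add, smul_mul_assoc, mul_smul_comm, one_mul, mul_one]
          simp only [star_mul', Complex.star_def, Complex.conj_ofReal, Complex.conj_I]
          match_scalars
          · ring
          · ring
          · ring_nf; simp
        rw [this]
        refine (norm_add_le _ _).trans ?_
        rw [norm_smul, norm_one, mul_one, Complex.norm_real, Real.norm_of_nonneg (sq_nonneg t)]
        gcongr
        exact (norm_mul_le _ _).trans (sq _).ge
      have e2 := hg (h + ((t : ℂ) * Complex.I) • (1 : U))
      rw [map_add, map_smul, h1] at e2
      have e3 : ((g h).im + t) ^ 2 ≤ ‖g h + ((t : ℂ) * Complex.I) • (1 : ℂ)‖ ^ 2 := by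
        rw [← Complex.normSq_eq_norm_sq, Complex.normSq_apply]
        simp
        nlinarith [sq_nonneg (g h).re]
      have e4 := pow_le_pow_left₀ (norm_nonneg _) e2 2
      nlinarith [sq_nonneg (g h).im]
    by_contra hne
    have := key ((‖h‖ ^ 2 + 1) / (2 * (g h).im))
    rw [mul_div_cancel₀ _ (by simpa using hne)] at this
    linarith
  rcases (norm_nonneg y).eq_or_lt' with h0 | h0
  · rw [norm_eq_zero.1 h0, map_zero]
  have him := hre y (.of_nonneg hy)
  -- Then |‖y‖ − g(y)| ≤ ‖y‖, so the real part of g(y) cannot be negative.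
  have h2 : ‖(‖y‖ : ℂ) • (1 : U) - y‖ ≤ ‖y‖ := by
    have hle : y ≤ (‖y‖ : ℂ) • (1 : U) := by
      have := IsSelfAdjoint.le_algebraMap_norm_self (a := y) (.of_nonneg hy)
      rwa [Algebra.algebraMap_eq_smul_one, ← Complex.coe_smul] at this
    refine (CStarAlgebra.norm_le_norm_of_nonneg_of_le (sub_nonneg.2 hle)
      (sub_le_self _ hy)).trans ?_
    rw [norm_smul, norm_one, mul_one, Complex.norm_real, norm_norm]
  have h3 := (hg _).trans h2
  rw [map_sub, map_smul, h1] at h3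
  have h4 := (Complex.abs_re_le_norm _).trans h3
  rw [abs_le] at h4
  simp at h4
  exact Complex.nonneg_iff.2 ⟨by linarith, him.symm⟩

/-- The norm of a positive element is attained at a contractive positive functional. -/
lemma exists_positiveLinearMap_apply_eq_norm {a : A} (ha : 0 ≤ a) :
    ∃ f : A →ₚ[ℂ] ℂ, (∀ x, ‖f x‖ ≤ ‖x‖) ∧ f a = ‖a‖ := by
  let U := Unitization ℂ A
  have ha' : (0 : U) ≤ (a : U) := Unitization.inr_nonneg_iff.2 ha
  have hn : ‖(a : U)‖ = ‖a‖ := Unitization.norm_inr a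
  -- ‖a‖ is in the spectrum of a, so 1 + ‖a‖ is in that of 1 + a. A Hahn–Banach functional norming 1
  -- + a in the unitization must therefore attain both g(1) = 1, which makes it positive, and g(a) =
  -- ‖a‖.
  have h1a : 1 + ‖a‖ ≤ ‖(1 : U) + (a : U)‖ := by
    have hs := CStarAlgebra.norm_mem_spectrum_of_nonneg (a := (a : U)) ha'
    have hs2 := (spectrum.add_mem_add_iff (r := ‖(a : U)‖) (s := 1) (a := (a : U))).2 hs
    have := spectrum.norm_le_norm_of_mem hs2
    rw [hn, map_one, Real.norm_of_nonneg (by positivity)] at this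
    rw [add_comm]
    exact this
  obtain ⟨g, hg1, hg⟩ := exists_dual_vector'' ℂ ((1 : U) + (a : U))
  have hgle : ∀ x, ‖g x‖ ≤ ‖x‖ := fun x => by
    simpa using g.le_of_opNorm_le hg1 x
  rw [map_add] at hg
  have hb1 : ‖g 1‖ ≤ 1 := by simpa using hgle 1
  have hba : ‖g (a : U)‖ ≤ ‖a‖ := by simpa [hn] using hgle (a : U)
  have hre : 1 + ‖a‖ ≤ (g 1).re + (g (a : U)).re := by
    rw [← Complex.add_re, hg]
    simpa using h1a
  have hr1 := Complex.re_le_norm (g 1)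
  have hra := Complex.re_le_norm (g (a : U))
  have hg1' : g 1 = 1 := by
    have e : (g 1).re = ‖g 1‖ := by linarith
    have e0 := Complex.nonneg_iff.1 (Complex.re_eq_norm.1 e)
    have e' : (g 1).re = 1 := by linarith
    apply Complex.ext
    · simpa using e'
    · simpa using e0.2.symm
  have hga : g (a : U) = ‖a‖ := by
    have e : (g (a : U)).re = ‖g (a : U)‖ := by linarith
    have e0 := Complex.nonneg_iff.1 (Complex.re_eq_norm.1 e)
    have e' : (g (a : U)).re = ‖a‖ := by linarith
    apply Complex.ext
    · simpa using e'
    · simpa using e0.2.symm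
  refine ⟨PositiveLinearMap.mk₀ ((g : U →ₗ[ℂ] ℂ) ∘ₗ (Unitization.inrNonUnitalStarAlgHom ℂ A : A →ₗ[ℂ] U)) ?_, ?_, hga⟩
  · intro x hx
    exact nonneg_of_norm_le_of_map_one (g : U →ₗ[ℂ] ℂ) hgle hg1' (Unitization.inr_nonneg_iff.2 hx)
  · intro x
    refine (hgle _).trans (le_of_eq ?_)
    exact Unitization.norm_inr x

end Estimates

end DecRank

end

open scoped ComplexOrder TensorProduct ENNReal

noncomputable section

namespace DecRank

/-! ### Matrix units, columns, and the norm of a matrix as a sesquilinear form. -/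

section MatrixUnits

open scoped Classical

variable {n : Type}

/-- The matrix units. -/
def matUnit (a b : n) : CStarMatrix n n ℂ := CStarMatrix.ofMatrix (Matrix.single a b 1)

/-- The matrix with column `a` equal to `v` and other columns zero. -/
def colMatrix (a : n) (v : n → ℂ) : CStarMatrix n n ℂ :=
  CStarMatrix.ofMatrix fun i j => if j = a then v i else 0

lemma star_matUnit (a b : n) : star (matUnit a b) = matUnit b a := by
  have := Matrix.conjTranspose_single a b (1 : ℂ)
  rw [star_one] at this
  exact this

variable [Fintype n]

lemma matUnit_mul_same (a b c : n) : matUnit a b * matUnit b c = matUnit a c := by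
  have := Matrix.single_mul_single_same (1 : ℂ) a b c 1
  rw [mul_one] at this
  exact this

lemma matUnit_mul_of_ne {a b c d : n} (h : b ≠ c) : matUnit a b * matUnit c d = 0 :=
  Matrix.single_mul_single_of_ne (1 : ℂ) a b c h 1

lemma matUnit_mul_mul_matUnit (a b c d : n) (x : CStarMatrix n n ℂ) :
    matUnit a b * x * matUnit c d = x b c • matUnit a d := by
  have := Matrix.single_mul_mul_single a b c d 1 x (1 : ℂ)
  refine this.trans ?_
  rw [one_mul, mul_one]
  have h2 := Matrix.smul_single (x b c) a d (1 : ℂ)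
  rw [smul_eq_mul, mul_one] at h2
  exact h2.symm

lemma sum_smul_matUnit (x : CStarMatrix n n ℂ) : x = ∑ a, ∑ b, x a b • matUnit a b := by
  refine (Matrix.matrix_eq_sum_single x).trans ?_
  refine Finset.sum_congr rfl fun a _ => Finset.sum_congr rfl fun b _ => ?_
  have h2 := Matrix.smul_single (x a b) a b (1 : ℂ)
  rw [smul_eq_mul, mul_one] at h2
  exact h2.symm

lemma sum_matUnit : (1 : CStarMatrix n n ℂ) = ∑ a, matUnit a a := by
  rw [sum_smul_matUnit (1 : CStarMatrix n n ℂ)]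
  refine Finset.sum_congr rfl fun a _ => ?_
  rw [Finset.sum_eq_single a]
  · simp
  · intro b _ hb
    rw [CStarMatrix.one_apply_ne hb.symm, zero_smul]
  · simp

lemma colMatrix_eq_sum (a : n) (v : n → ℂ) : colMatrix a v = ∑ b, v b • matUnit b a := by
  rw [sum_smul_matUnit (colMatrix a v)]
  refine Finset.sum_congr rfl fun b _ => ?_
  rw [Finset.sum_eq_single a]
  · change (if a = a then v b else 0) • _ = _
    rw [if_pos rfl]
  · intro c _ hc
    change (if c = a then v b else 0) • _ = _
    rw [if_neg hc, zero_smul]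
  · simp

/-- The sesquilinear form w* x v becomes a scalar in front of one matrix unit, so that norms of
matrices can be read off from products inside the algebra. -/
lemma star_colMatrix_mul_mul (a : n) (w v : n → ℂ) (x : CStarMatrix n n ℂ) :
    star (colMatrix a w) * x * colMatrix a v =
      (∑ i, ∑ j, star (w i) * x i j * v j) • matUnit a a := by
  rw [colMatrix_eq_sum, colMatrix_eq_sum]
  simp only [star_sum, star_smul, star_matUnit, Finset.sum_mul, Finset.mul_sum, Finset.sum_smul,
    smul_mul_assoc, mul_smul_comm, matUnit_mul_mul_matUnit, smul_smul, Finset.smul_sum]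
  rw [Finset.sum_comm]
  refine Finset.sum_congr rfl fun i _ => Finset.sum_congr rfl fun j _ => ?_
  congr 1
  ring

lemma norm_matUnit_self_le (a : n) : ‖matUnit a a‖ ≤ 1 := by
  have h := CStarRing.norm_star_mul_self (x := matUnit a a)
  rw [star_matUnit, matUnit_mul_same] at h
  by_contra! h1
  nlinarith

lemma star_colMatrix_mul_self (a : n) (v : n → ℂ) :
    star (colMatrix a v) * colMatrix a v = ((∑ i, ‖v i‖ ^ 2 : ℝ) : ℂ) • matUnit a a := by
  have h := star_colMatrix_mul_mul a v v 1
  rw [mul_one] at h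
  rw [h]
  congr 1
  push_cast
  refine Finset.sum_congr rfl fun i _ => ?_
  rw [Finset.sum_eq_single i]
  · rw [CStarMatrix.one_apply_eq, mul_one, Complex.star_def, Complex.conj_mul']
  · intro b _ hb
    rw [CStarMatrix.one_apply_ne hb.symm, mul_zero, zero_mul]
  · simp

lemma norm_colMatrix_le (a : n) (v : n → ℂ) : ‖colMatrix a v‖ ≤ √(∑ i, ‖v i‖ ^ 2) := by
  refine Real.le_sqrt_of_sq_le ?_
  have h := CStarRing.norm_star_mul_self (x := colMatrix a v)
  rw [sq, ← h, star_colMatrix_mul_self, norm_smul, Complex.norm_real,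
    Real.norm_of_nonneg (by positivity)]
  exact mul_le_of_le_one_right (by positivity) (norm_matUnit_self_le a)

open WithCStarModule in
-- The C*-norm of a matrix is its norm as an operator on the Hilbert module ℂⁿ.
lemma cstarMatrix_norm_le {x : CStarMatrix n n ℂ} {C : ℝ} (hC : 0 ≤ C)
    (h : ∀ w v : n → ℂ, ‖∑ i, ∑ j, star (w i) * x i j * v j‖ ≤
      C * √(∑ i, ‖w i‖ ^ 2) * √(∑ i, ‖v i‖ ^ 2)) : ‖x‖ ≤ C := by
  lift C to NNReal using hC
  refine CStarMatrix.norm_le_of_forall_inner_le fun v w => ?_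
  have hn : ∀ u : C⋆ᵐᵒᵈ(ℂ, n → ℂ), ‖u‖ = √(∑ i, ‖u i‖ ^ 2) := by
    intro u
    rw [pi_norm]
    congr 1
    simp only [inner_def]
    have : ∑ i, u i * star (u i) = ((∑ i, ‖u i‖ ^ 2 : ℝ) : ℂ) := by
      push_cast
      exact Finset.sum_congr rfl fun i _ => Complex.mul_conj' _
    rw [this, Complex.norm_real, Real.norm_of_nonneg (by positivity)]
  -- The module action is on row vectors, so both vectors are conjugated to match the form in `h`.
  have h' := h (fun i => star (v i)) (fun i => star (w i))
  simp only [norm_star, star_star, ← hn] at h'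
  convert! h' using 2
  rw [pi_inner, CStarMatrix.toCLM_apply_eq_sum]
  simp only [inner_def]
  rw [Finset.sum_comm]
  refine Finset.sum_congr rfl fun j _ => ?_
  change (∑ i, v i * x i j) * star (w j) = _
  rw [Finset.sum_mul]

end MatrixUnits

/-! ### Maps on one matrix algebra that preserve zero products. -/

section OrderZero

open scoped Classical

attribute [local instance 50] CStarAlgebra.spectralOrder CStarAlgebra.spectralOrderedRing

variable {n : Type} [Fintype n] {B : Type*} [NonUnitalCStarAlgebra B]

/-- A linear map preserves zero products. -/
def PreservesZeroProducts {F : Type*} [NonUnitalCStarAlgebra F] (φ : F →ₗ[ℂ] B) : Prop :=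
  ∀ x y, x * y = 0 → φ x * φ y = 0

variable {φ : CStarMatrix n n ℂ →ₗ[ℂ] B}

/-- For b ≠ b', (e_ab + e_ab')(e_bd − e_b'd) = 0, and the two mixed products vanish under φ as well;
what is left is the difference of the two sides. -/
lemma PreservesZeroProducts.mul_indep (h : PreservesZeroProducts φ) (a b b' d : n) :
    φ (matUnit a b) * φ (matUnit b d) = φ (matUnit a b') * φ (matUnit b' d) := by
  by_cases hb : b = b'
  · rw [hb]
  have h1 := h (matUnit a b + matUnit a b') (matUnit b d - matUnit b' d) (by
    rw [add_mul, mul_sub, mul_sub, matUnit_mul_same, matUnit_mul_same, matUnit_mul_of_ne hb,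
      matUnit_mul_of_ne (Ne.symm hb)]
    abel)
  have h2 := h _ _ (matUnit_mul_of_ne (a := a) (d := d) hb)
  have h3 := h _ _ (matUnit_mul_of_ne (a := a) (d := d) (Ne.symm hb))
  rw [map_add, map_sub, add_mul, mul_sub, mul_sub, h2, h3] at h1
  rw [← sub_eq_zero, ← h1]
  abel

/-- Products of values of a map are determined by the matrix product, given the relations on matrix
units. -/
lemma map_mul_map_of_matUnit
    (h1 : ∀ a b c d, b ≠ c → φ (matUnit a b) * φ (matUnit c d) = 0)
    (h2 : ∀ a b b' d, φ (matUnit a b) * φ (matUnit b d) = φ (matUnit a b') * φ (matUnit b' d))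
    (x y : CStarMatrix n n ℂ) :
    φ x * φ y = ∑ a, ∑ d, (x * y) a d • (φ (matUnit a a) * φ (matUnit a d)) := by
  have hx : ∀ z, φ z = ∑ a, ∑ b, z a b • φ (matUnit a b) := fun z => by
    conv_lhs => rw [sum_smul_matUnit z]
    simp only [map_sum, map_smul]
  have hb : ∀ a b : n, (x a b • φ (matUnit a b)) * φ y =
      ∑ d, (x a b * y b d) • (φ (matUnit a a) * φ (matUnit a d)) := by
    intro a b
    rw [hx y, Finset.mul_sum, Finset.sum_eq_single b]
    · rw [Finset.mul_sum]
      exact Finset.sum_congr rfl fun d _ => by rw [smul_mul_smul_comm, h2 a b a d]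
    · intro c _ hc
      rw [Finset.mul_sum]
      exact Finset.sum_eq_zero fun d _ => by
        rw [smul_mul_smul_comm, h1 a b c d hc.symm, smul_zero]
    · simp
  rw [hx x, Finset.sum_mul]
  refine Finset.sum_congr rfl fun a _ => ?_
  rw [Finset.sum_mul, Finset.sum_congr rfl fun b _ => hb a b, Finset.sum_comm]
  refine Finset.sum_congr rfl fun d _ => ?_
  rw [CStarMatrix.mul_apply, Finset.sum_smul]

lemma preservesZeroProducts_of_matUnit
    (h1 : ∀ a b c d, b ≠ c → φ (matUnit a b) * φ (matUnit c d) = 0)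
    (h2 : ∀ a b b' d, φ (matUnit a b) * φ (matUnit b d) = φ (matUnit a b') * φ (matUnit b' d)) :
    PreservesZeroProducts φ := by
  intro x y hxy
  rw [map_mul_map_of_matUnit h1 h2, hxy]
  simp

/-- φ(x) φ(y) depends only on the product x y. This does the work of the structure theorem for order
zero maps. -/
lemma PreservesZeroProducts.map_mul_map_congr (h : PreservesZeroProducts φ)
    {x y x' y' : CStarMatrix n n ℂ} (hxy : x * y = x' * y') : φ x * φ y = φ x' * φ y' := by
  have h1 : ∀ a b c d, b ≠ c → φ (matUnit a b) * φ (matUnit c d) = 0 :=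
    fun a b c d hbc => h _ _ (matUnit_mul_of_ne hbc)
  rw [map_mul_map_of_matUnit h1 h.mul_indep, hxy, ← map_mul_map_of_matUnit h1 h.mul_indep]

variable (hφ : IsCompletelyPositive φ) (h : PreservesZeroProducts φ)

include hφ h

/-- Independence of the middle index gives φ(e_aa) φ(e_aa)* = φ(e_ab) φ(e_ab)*, so ‖φ(e_aa)‖ =
‖φ(e_ab)‖; taking adjoints exchanges a and b. -/
lemma PreservesZeroProducts.norm_matUnit_eq (a b : n) :
    ‖φ (matUnit a a)‖ = ‖φ (matUnit b b)‖ := by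
  have key : ∀ a b : n, ‖φ (matUnit a a)‖ = ‖φ (matUnit a b)‖ := by
    intro a b
    have e : φ (matUnit a a) * star (φ (matUnit a a)) = φ (matUnit a b) * star (φ (matUnit a b)) := by
      rw [← hφ.map_star, ← hφ.map_star, star_matUnit, star_matUnit]
      exact h.mul_indep _ _ _ _
    have := congrArg norm e
    rw [CStarRing.norm_self_mul_star, CStarRing.norm_self_mul_star] at this
    exact (mul_self_inj (norm_nonneg _) (norm_nonneg _)).1 this
  rw [key a b, key b a, ← norm_star, ← hφ.map_star, star_matUnit]

lemma PreservesZeroProducts.norm_map_one_le (a : n) : ‖φ 1‖ ≤ ‖φ (matUnit a a)‖ := by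
  rw [sum_matUnit, map_sum]
  refine norm_sum_le_of_orthogonal _ (norm_nonneg _)
    (fun b _ => (h.norm_matUnit_eq hφ b a).le) ?_ ?_ <;>
  · intro i _ j _ hij
    rw [← hφ.map_star, star_matUnit]
    exact h _ _ (matUnit_mul_of_ne hij)

lemma PreservesZeroProducts.norm_map_le (a : n) (x : CStarMatrix n n ℂ) :
    ‖φ x‖ ≤ ‖φ (matUnit a a)‖ * ‖x‖ := by
  refine (hφ.norm_map_le (star_one _) one_mul x).trans ?_
  gcongr
  exact h.norm_map_one_le hφ a

/-- Together with `norm_map_le` this makes φ a multiple of an isometry. A row, x and a column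
multiply under φ to the scalar w* x v times φ(e_aa)³; comparing norms bounds the sesquilinear form
of x. -/
lemma PreservesZeroProducts.norm_le (a : n) (x : CStarMatrix n n ℂ) :
    ‖φ (matUnit a a)‖ * ‖x‖ ≤ ‖φ x‖ := by
  set k := ‖φ (matUnit a a)‖ with hk
  rcases (norm_nonneg (φ (matUnit a a))).eq_or_lt' with h0 | h0
  · rw [hk, h0, zero_mul]
    exact norm_nonneg _
  rw [← hk] at h0
  rw [mul_comm, ← le_div_iff₀ h0]
  refine cstarMatrix_norm_le (by positivity) fun w v => ?_
  set s := ∑ i, ∑ j, star (w i) * x i j * v j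
  have hsa : star (φ (matUnit a a)) = φ (matUnit a a) := by rw [← hφ.map_star, star_matUnit]
  have hrow : ∀ u, matUnit a a * star (colMatrix a u) = star (colMatrix a u) := fun u => by
    rw [colMatrix_eq_sum]
    simp [star_sum, star_matUnit, Finset.mul_sum, matUnit_mul_same]
  have e1 : φ (star (colMatrix a w)) * φ x * φ (colMatrix a v) =
      s • (φ (matUnit a a) * φ (matUnit a a) * φ (matUnit a a)) := by
    rw [h.map_mul_map_congr (x := star (colMatrix a w)) (x' := matUnit a a)
      (y' := star (colMatrix a w) * x) (by rw [← mul_assoc, hrow]), mul_assoc,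
      h.map_mul_map_congr (x := star (colMatrix a w) * x) (x' := matUnit a a)
      (y' := s • matUnit a a) (by
        rw [star_colMatrix_mul_mul, mul_smul_comm, matUnit_mul_same]), map_smul, mul_smul_comm,
        mul_smul_comm, mul_assoc]
  -- With e = φ(e_aa) self-adjoint, k⁴ = ‖e⁴‖ ≤ ‖e³‖ k.
  have e2 : k ^ 3 ≤ ‖φ (matUnit a a) * φ (matUnit a a) * φ (matUnit a a)‖ := by
    have e3 : ‖φ (matUnit a a) * φ (matUnit a a)‖ = k * k := by
      conv_lhs => rw [← hsa]
      nth_rw 2 [hsa]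
      exact CStarRing.norm_star_mul_self
    have e4 : ‖(φ (matUnit a a) * φ (matUnit a a)) * (φ (matUnit a a) * φ (matUnit a a))‖ =
        (k * k) * (k * k) := by
      rw [← e3, ← CStarRing.norm_star_mul_self, star_mul, hsa]
    have e5 := norm_mul_le (φ (matUnit a a) * φ (matUnit a a) * φ (matUnit a a)) (φ (matUnit a a))
    rw [mul_assoc _ _ (φ (matUnit a a)), e4, ← hk] at e5
    refine le_of_mul_le_mul_right ?_ h0
    linarith
  have e6 := congrArg norm e1
  rw [norm_smul] at e6
  have e7 : ‖s‖ * k ^ 3 ≤ (k * √(∑ i, ‖w i‖ ^ 2)) * ‖φ x‖ * (k * √(∑ i, ‖v i‖ ^ 2)) := by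
    calc ‖s‖ * k ^ 3 ≤ _ := mul_le_mul_of_nonneg_left e2 (norm_nonneg _)
      _ = _ := e6.symm
      _ ≤ ‖φ (star (colMatrix a w))‖ * ‖φ x‖ * ‖φ (colMatrix a v)‖ :=
        (norm_mul_le _ _).trans (mul_le_mul_of_nonneg_right (norm_mul_le _ _) (norm_nonneg _))
      _ ≤ _ := by
        gcongr
        · refine (h.norm_map_le hφ a _).trans ?_
          gcongr
          exact (norm_star (colMatrix a w)).trans_le (norm_colMatrix_le _ _)
        · refine (h.norm_map_le hφ a _).trans ?_
          gcongr
          exact norm_colMatrix_le _ _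
  rw [div_mul_eq_mul_div, div_mul_eq_mul_div, le_div_iff₀ h0]
  refine le_of_mul_le_mul_right ?_ (pow_pos h0 2)
  calc ‖s‖ * k * k ^ 2 = ‖s‖ * k ^ 3 := by ring
    _ ≤ _ := e7
    _ = _ := by ring

end OrderZero

end DecRank

end

open scoped ComplexOrder TensorProduct ENNReal

noncomputable section

namespace DecRank

/-! ### Sums of matrix algebras and coloured order zero maps. -/

section Blocks

open scoped Classical

attribute [local instance 50] CStarAlgebra.spectralOrder CStarAlgebra.spectralOrderedRing

/-- A finite direct sum of matrix algebras, over arbitrary index types. -/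
abbrev Blocks {ι : Type} (n : ι → Type) : Type := ∀ i, CStarMatrix (n i) (n i) ℂ

variable {ι : Type} [Fintype ι] {n : ι → Type} [∀ i, Fintype (n i)]
  {A B : Type*} [NonUnitalCStarAlgebra A] [NonUnitalCStarAlgebra B]

/-- The inclusion of a factor into a product of C*-algebras. -/
def piIncl {κ : Type} [Fintype κ] {G : κ → Type*} [∀ i, NonUnitalCStarAlgebra (G i)] (i : κ) :
    G i →⋆ₙₐ[ℂ] (∀ i, G i) where
  toFun x := Pi.single i x
  map_smul' c x := Pi.single_smul i c x
  map_zero' := Pi.single_zero i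
  map_add' x y := Pi.single_add i x y
  map_mul' x y := Pi.single_mul i x y
  map_star' x := Pi.single_star i x

/-- The inclusion of a summand. -/
def blockIncl (i : ι) : CStarMatrix (n i) (n i) ℂ →⋆ₙₐ[ℂ] Blocks n :=
  piIncl (G := fun i => CStarMatrix (n i) (n i) ℂ) i

lemma blockIncl_apply (i : ι) (x : CStarMatrix (n i) (n i) ℂ) :
    (blockIncl i x : Blocks n) = Pi.single i x := rfl

@[simp]
lemma blockIncl_same (i : ι) (x : CStarMatrix (n i) (n i) ℂ) :
    (blockIncl i x : Blocks n) i = x := by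
  rw [blockIncl_apply, Pi.single_eq_same]

lemma blockIncl_of_ne {i k : ι} (h : k ≠ i) (x : CStarMatrix (n i) (n i) ℂ) :
    (blockIncl i x : Blocks n) k = 0 := Pi.single_eq_of_ne h _

lemma blockIncl_mul_of_ne {i j : ι} (h : i ≠ j) (x : CStarMatrix (n i) (n i) ℂ)
    (y : CStarMatrix (n j) (n j) ℂ) : (blockIncl i x * blockIncl j y : Blocks n) = 0 := by
  ext1 k
  rw [Pi.mul_apply, Pi.zero_apply]
  by_cases hk : k = i
  · subst hk
    rw [blockIncl_of_ne h, mul_zero]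
  · rw [blockIncl_of_ne hk, zero_mul]

/-- The restriction of a map to a summand. -/
def blockMap (φ : Blocks n →ₗ[ℂ] B) (i : ι) : CStarMatrix (n i) (n i) ℂ →ₗ[ℂ] B :=
  φ ∘ₗ (blockIncl (n := n) i : CStarMatrix (n i) (n i) ℂ →ₗ[ℂ] Blocks n)

lemma blockMap_apply (φ : Blocks n →ₗ[ℂ] B) (i : ι) (x : CStarMatrix (n i) (n i) ℂ) :
    blockMap φ i x = φ (blockIncl i x) := rfl

lemma sum_blockIncl (x : Blocks n) : x = ∑ i, blockIncl i (x i) :=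
  (Finset.univ_sum_single x).symm

lemma map_eq_sum_blockMap (φ : Blocks n →ₗ[ℂ] B) (x : Blocks n) :
    φ x = ∑ i, blockMap φ i (x i) := by
  conv_lhs => rw [sum_blockIncl x, map_sum]
  rfl

lemma IsCompletelyPositive.blockMap {φ : Blocks n →ₗ[ℂ] B} (hφ : IsCompletelyPositive φ) (i : ι) :
    IsCompletelyPositive (DecRank.blockMap φ i) :=
  hφ.comp (isCompletelyPositive_hom (B := Blocks n) (blockIncl (n := n) i))

/-- A map on a sum of matrix algebras has order zero on the sum of the summands of each colour. -/
structure OrderZeroOn {κ : Type*} (c : ι → κ) (φ : Blocks n →ₗ[ℂ] B) : Prop where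
  block : ∀ i, PreservesZeroProducts (blockMap φ i)
  orthogonal : ∀ i j, i ≠ j → c i = c j → ∀ x y, blockMap φ i x * blockMap φ j y = 0

lemma OrderZeroOn.map_mul_map_eq_zero {κ : Type*} {c : ι → κ} {φ : Blocks n →ₗ[ℂ] B}
    (h : OrderZeroOn c φ) (k : κ) {x y : Blocks n} (hx : ∀ i, c i ≠ k → x i = 0)
    (hy : ∀ i, c i ≠ k → y i = 0) (hxy : x * y = 0) : φ x * φ y = 0 := by
  rw [map_eq_sum_blockMap φ x, map_eq_sum_blockMap φ y, Finset.sum_mul_sum]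
  refine Finset.sum_eq_zero fun i _ => Finset.sum_eq_zero fun j _ => ?_
  by_cases hi : c i = k
  · by_cases hj : c j = k
    · by_cases hij : i = j
      · subst hij
        exact h.block i _ _ (congrFun hxy i)
      · exact h.orthogonal i j hij (hi.trans hj.symm) _ _
    · rw [hy j hj, map_zero, mul_zero]
  · rw [hx i hi, map_zero, zero_mul]

/-- Blocks of one colour have orthogonal images, so their sum has the maximum of their norms, and
the triangle inequality is paid only over the N + 1 colours. The weight ‖φ_i(e_aa)‖ stays in the
hypothesis because the left inverses control z_i only up to that weight. -/
lemma OrderZeroOn.norm_map_le {N : ℕ} {c : ι → Fin (N + 1)} {φ : Blocks n →ₗ[ℂ] B}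
    (h : OrderZeroOn c φ) (hφ : IsCompletelyPositive φ) (z : Blocks n) {δ : ℝ} (hδ : 0 ≤ δ)
    (hz : ∀ i a, ‖blockMap φ i (matUnit a a)‖ * ‖z i‖ ≤ δ) : ‖φ z‖ ≤ (N + 1) * δ := by
  rw [map_eq_sum_blockMap, ← Finset.sum_fiberwise _ c]
  refine (norm_sum_le_of_le (f := fun j => ∑ i with c i = j, blockMap φ i (z i)) (n := fun _ => δ)
    _ fun j _ => ?_).trans (le_of_eq ?_)
  · refine norm_sum_le_of_orthogonal _ hδ (fun i _ => ?_) ?_ ?_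
    · rcases isEmpty_or_nonempty (n i) with hi | ⟨⟨a⟩⟩
      · have : z i = 0 := by ext a; exact (hi.false a).elim
        rw [this, map_zero, norm_zero]
        exact hδ
      · exact ((h.block i).norm_map_le (hφ.blockMap i) a _).trans (hz i a)
    · intro i hi k hk hik
      rw [← (hφ.blockMap i).map_star]
      simp only [Finset.mem_filter] at hi hk
      exact h.orthogonal i k hik (hi.2.trans hk.2.symm) _ _
    · intro i hi k hk hik
      rw [← (hφ.blockMap k).map_star]
      simp only [Finset.mem_filter] at hi hk
      exact h.orthogonal i k hik (hi.2.trans hk.2.symm) _ _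
  · simp

lemma IsCompletelyPositive.blockMap_le {φ : Blocks n →ₗ[ℂ] B} (hφ : IsCompletelyPositive φ)
    (y : Blocks n) (i : ι) : DecRank.blockMap φ i ((star y * y) i) ≤ φ (star y * y) := by
  rw [map_eq_sum_blockMap φ (star y * y)]
  exact Finset.single_le_sum (f := fun j => DecRank.blockMap φ j ((star y * y) j))
    (fun j _ => (hφ.blockMap j).map_star_mul_self_nonneg (y j)) (Finset.mem_univ i)

/-- A block of a positive element has image below the image of the whole, and φ multiplies norms on
a block by at least ‖φ_i(e_aa)‖. -/
lemma OrderZeroOn.norm_le {κ : Type*} {c : ι → κ} {φ : Blocks n →ₗ[ℂ] B}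
    (h : OrderZeroOn c φ) (hφ : IsCompletelyPositive φ) (y : Blocks n) (i : ι) (a : n i) :
    ‖blockMap φ i (matUnit a a)‖ * ‖(star y * y) i‖ ≤ ‖φ (star y * y)‖ :=
  ((h.block i).norm_le (hφ.blockMap i) a _).trans
    (norm_le_of_nonneg_of_le ((hφ.blockMap i).map_star_mul_self_nonneg (y i)) (hφ.blockMap_le y i))

lemma OrderZeroOn.hom_comp {κ : Type*} {c : ι → κ} {φ : Blocks n →ₗ[ℂ] A}
    (h : OrderZeroOn c φ) (π : A →⋆ₙₐ[ℂ] B) : OrderZeroOn c ((π : A →ₗ[ℂ] B) ∘ₗ φ) where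
  block i x y hxy := by
    change π (blockMap φ i x) * π (blockMap φ i y) = 0
    rw [← map_mul, h.block i x y hxy, map_zero]
  orthogonal i j hij hc x y := by
    change π (blockMap φ i x) * π (blockMap φ j y) = 0
    rw [← map_mul, h.orthogonal i j hij hc, map_zero]

lemma isCPC_hom (π : A →⋆ₙₐ[ℂ] B) : IsCPC (π : A →ₗ[ℂ] B) :=
  ⟨isCompletelyPositive_hom π, fun x => NonUnitalStarAlgHom.norm_apply_le π x⟩

lemma IsCPC.comp {C : Type*} [NonUnitalCStarAlgebra C] {ψ : B →ₗ[ℂ] C} {φ : A →ₗ[ℂ] B}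
    (hψ : IsCPC ψ) (hφ : IsCPC φ) : IsCPC (ψ ∘ₗ φ) :=
  ⟨hψ.1.comp hφ.1, fun x => (hψ.2 _).trans (hφ.2 x)⟩

/-- Conjugating the inequality by w gives 0 ≤ (x w)*(x w) ≤ C w* p w = 0. -/
lemma star_mul_self_eq_zero_of_le {x p : A} {C : ℝ} (h : star x * x ≤ C • p)
    {w : A} (hw : star w * p * w = 0) : x * w = 0 := by
  have h1 := star_left_conjugate_le_conjugate h w
  rw [mul_smul_comm, smul_mul_assoc, hw, smul_zero] at h1
  have h2 : star (x * w) * (x * w) = 0 := by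
    refine le_antisymm ?_ (star_mul_self_nonneg _)
    rwa [star_mul, mul_assoc, ← mul_assoc _ x, ← mul_assoc]
  exact CStarRing.star_mul_self_eq_zero_iff _ |>.1 h2

/-- If a completely positive map sends two projections to orthogonal elements, it sends the right
ideal and left ideal that they generate to orthogonal subspaces. -/
lemma IsCompletelyPositive.map_mul_map_eq_zero {φ : A →ₗ[ℂ] B} (hφ : IsCompletelyPositive φ)
    {p q : A} (hp : IsStarProjection p) (hq : IsStarProjection q) (h : φ q * φ p = 0) (u v : A) :
    φ (u * q) * φ (p * v) = 0 := by
  have hps := hp.isSelfAdjoint.star_eq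
  have hqs := hq.isSelfAdjoint.star_eq
  -- |φ(u q)|² is dominated by a multiple of φ(q), so φ(q) φ(p) = 0 gives φ(u q) φ(p) = 0. The bound
  -- on |φ(v* p)|² then replaces p by p v in the same way.
  have e1 := hφ.kadison_schwarz (star u) q
  have e2 := hφ.kadison_schwarz v p
  rw [star_star, hqs, hq.isIdempotentElem] at e1
  rw [hps, hp.isIdempotentElem] at e2
  have e3 : φ (u * q) * φ p = 0 := star_mul_self_eq_zero_of_le e1 (by rw [mul_assoc, h, mul_zero])
  have e4 : φ (star v * p) * star (φ (u * q)) = 0 := star_mul_self_eq_zero_of_le e2 (by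
    rw [star_star, e3, zero_mul])
  have e5 := congrArg star e4
  rwa [star_mul, star_star, star_zero, ← hφ.map_star, star_mul, star_star, hps] at e5

/-- A subprojection p = e p e is a multiple t e, and p² = p forces t(t − 1) = 0. -/
lemma isMinimalProjection_of_forall_smul {F : Type*} [NonUnitalCStarAlgebra F] {e : F}
    (he : IsStarProjection e) (h0 : e ≠ 0) (h : ∀ x, ∃ t : ℂ, e * x * e = t • e) :
    IsMinimalProjection e := by
  refine ⟨he, h0, fun p hp hpe => ?_⟩
  have hep : e * p = p := by
    have := congrArg star hpe
    rwa [star_mul, he.isSelfAdjoint.star_eq, hp.isSelfAdjoint.star_eq] at this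
  obtain ⟨t, ht⟩ := h p
  rw [hep, hpe] at ht
  have h2 := hp.isIdempotentElem.eq
  rw [ht, smul_mul_smul_comm, he.isIdempotentElem.eq, ← sub_eq_zero, ← sub_smul,
    smul_eq_zero_iff_left h0] at h2
  have : t * (t - 1) = 0 := by linear_combination h2
  rcases mul_eq_zero.1 this with h3 | h3
  · left
    rw [ht, h3, zero_smul]
  · right
    rw [ht, sub_eq_zero.1 h3, one_smul]

/-! ### Rank-one projections in a matrix algebra. -/

section RankOne

variable {m : Type} [Fintype m]

lemma colMatrix_zero (a : m) : colMatrix a (0 : m → ℂ) = 0 := by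
  simp [colMatrix_eq_sum]

lemma colMatrix_single (a b : m) : colMatrix a (Pi.single b 1) = matUnit b a := by
  rw [colMatrix_eq_sum, Finset.sum_eq_single b]
  · rw [Pi.single_eq_same, one_smul]
  · intro d _ hd
    rw [Pi.single_eq_of_ne hd, zero_smul]
  · simp

lemma star_colMatrix_single (a b : m) : star (colMatrix a (Pi.single b 1)) = matUnit a b := by
  rw [colMatrix_single, star_matUnit]

lemma colMatrix_add (a : m) (u v : m → ℂ) :
    colMatrix a (u + v) = colMatrix a u + colMatrix a v := by
  simp [colMatrix_eq_sum, add_smul, Finset.sum_add_distrib]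

lemma colMatrix_sub (a : m) (u v : m → ℂ) :
    colMatrix a (u - v) = colMatrix a u - colMatrix a v := by
  simp [colMatrix_eq_sum, sub_smul, Finset.sum_sub_distrib]

lemma colMatrix_mul_star (a b : m) (v : m → ℂ) :
    colMatrix a v * star (colMatrix a v) = colMatrix b v * star (colMatrix b v) := by
  simp only [colMatrix_eq_sum, star_sum, star_smul, star_matUnit, Finset.sum_mul, Finset.mul_sum,
    smul_mul_assoc, mul_smul_comm, matUnit_mul_same]

lemma sum_star_single_mul_single {b d : m} (h : b ≠ d) :
    ∑ k, star ((Pi.single b 1 : m → ℂ) k) * (Pi.single d 1 : m → ℂ) k = 0 := by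
  refine Finset.sum_eq_zero fun k _ => ?_
  by_cases hk : k = b
  · subst hk
    rw [Pi.single_eq_of_ne h, mul_zero]
  · rw [Pi.single_eq_of_ne hk, star_zero, zero_mul]

lemma sum_star_single_mul_self (b : m) :
    ∑ k, star ((Pi.single b 1 : m → ℂ) k) * (Pi.single b 1 : m → ℂ) k = 1 := by
  rw [Finset.sum_eq_single b]
  · rw [Pi.single_eq_same, star_one, mul_one]
  · intro d _ hd
    rw [Pi.single_eq_of_ne hd, mul_zero]
  · simp

lemma sum_star_add_mul_sub {b d : m} (h : b ≠ d) :
    ∑ k, star ((Pi.single b 1 + Pi.single d 1 : m → ℂ) k) *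
      (Pi.single b 1 - Pi.single d 1 : m → ℂ) k = 0 := by
  simp only [Pi.add_apply, Pi.sub_apply, star_add, add_mul, mul_sub, Finset.sum_add_distrib,
    Finset.sum_sub_distrib, sum_star_single_mul_self, sum_star_single_mul_single h,
    sum_star_single_mul_single (Ne.symm h)]
  ring

/-- The relations between matrix units follow from the vanishing of the products of rows and
orthogonal columns. -/
lemma preservesZeroProducts_of_colMatrix {φ : CStarMatrix m m ℂ →ₗ[ℂ] B}
    (h : ∀ (a b : m) (u v : m → ℂ), ∑ k, star (u k) * v k = 0 →
      φ (star (colMatrix a u)) * φ (colMatrix b v) = 0) : PreservesZeroProducts φ := by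
  have h1 : ∀ a b c d, b ≠ c → φ (matUnit a b) * φ (matUnit c d) = 0 := fun a b c d hbc => by
    rw [← star_colMatrix_single, ← colMatrix_single]
    exact h a d _ _ (sum_star_single_mul_single hbc)
  refine preservesZeroProducts_of_matUnit h1 fun a b b' d => ?_
  by_cases hbb : b = b'
  · rw [hbb]
  -- The vectors δ_b + δ_b' and δ_b − δ_b' are orthogonal; expanding the product leaves the two
  -- sides with opposite signs.
  have := h a d _ _ (sum_star_add_mul_sub hbb)
  rw [colMatrix_add, colMatrix_sub, star_add, star_colMatrix_single, star_colMatrix_single,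
    colMatrix_single, colMatrix_single, map_add, map_sub, add_mul, mul_sub, mul_sub,
    h1 a b b' d hbb, h1 a b' b d (Ne.symm hbb)] at this
  rw [← sub_eq_zero, ← this]
  abel

/-- The rank one projection onto the span of a non-zero vector. -/
def rankOne (a : m) (u : m → ℂ) : CStarMatrix m m ℂ :=
  (((∑ i, ‖u i‖ ^ 2 : ℝ) : ℂ)⁻¹) • (colMatrix a u * star (colMatrix a u))

lemma rankOne_indep (a b : m) (u : m → ℂ) : rankOne a u = rankOne b u := by
  rw [rankOne, colMatrix_mul_star a b]
  rfl

lemma colMatrix_mul_matUnit (a : m) (u : m → ℂ) : colMatrix a u * matUnit a a = colMatrix a u := by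
  rw [colMatrix_eq_sum, Finset.sum_mul]
  simp only [smul_mul_assoc, matUnit_mul_same]

lemma sum_norm_sq_ne_zero {u : m → ℂ} (hu : u ≠ 0) : ((∑ i, ‖u i‖ ^ 2 : ℝ) : ℂ) ≠ 0 := by
  obtain ⟨i, hi⟩ := Function.ne_iff.1 hu
  have : 0 < ∑ i, ‖u i‖ ^ 2 := Finset.sum_pos' (fun _ _ => by positivity)
    ⟨i, Finset.mem_univ i, by have := norm_pos_iff.2 hi; positivity⟩
  exact_mod_cast this.ne'

lemma rankOne_mul_colMatrix (a : m) {u : m → ℂ} (hu : u ≠ 0) :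
    rankOne a u * colMatrix a u = colMatrix a u := by
  rw [rankOne, smul_mul_assoc, mul_assoc, star_colMatrix_mul_self, mul_smul_comm,
    colMatrix_mul_matUnit, smul_smul, inv_mul_cancel₀ (sum_norm_sq_ne_zero hu), one_smul]

lemma star_rankOne (a : m) (u : m → ℂ) : star (rankOne a u) = rankOne a u := by
  rw [rankOne, star_smul, star_mul, star_star, Complex.star_def, map_inv₀, Complex.conj_ofReal]

lemma rankOne_mul_mul_rankOne (a : m) (u v : m → ℂ) (x : CStarMatrix m m ℂ) :
    rankOne a u * x * rankOne a v = (((∑ i, ‖u i‖ ^ 2 : ℝ) : ℂ)⁻¹ * ((∑ i, ‖v i‖ ^ 2 : ℝ) : ℂ)⁻¹ *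
      (∑ i, ∑ j, star (u i) * x i j * v j)) • (colMatrix a u * star (colMatrix a v)) := by
  have : colMatrix a u * star (colMatrix a u) * x * (colMatrix a v * star (colMatrix a v)) =
      colMatrix a u * (star (colMatrix a u) * x * colMatrix a v) * star (colMatrix a v) := by
    simp only [mul_assoc]
  rw [rankOne, rankOne, smul_mul_assoc, smul_mul_smul_comm, this, star_colMatrix_mul_mul,
    mul_smul_comm, colMatrix_mul_matUnit, smul_mul_assoc, smul_smul]

lemma isStarProjection_rankOne (a : m) {u : m → ℂ} (hu : u ≠ 0) :
    IsStarProjection (rankOne a u) where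
  isIdempotentElem := by
    change rankOne a u * rankOne a u = rankOne a u
    nth_rw 2 [rankOne]
    rw [mul_smul_comm, ← mul_assoc, rankOne_mul_colMatrix a hu, rankOne]
  isSelfAdjoint := star_rankOne a u

lemma rankOne_mul_mul_self (a : m) (u : m → ℂ) (x : CStarMatrix m m ℂ) :
    ∃ t : ℂ, rankOne a u * x * rankOne a u = t • rankOne a u := by
  refine ⟨(((∑ i, ‖u i‖ ^ 2 : ℝ) : ℂ)⁻¹ * ∑ i, ∑ j, star (u i) * x i j * u j), ?_⟩
  rw [rankOne_mul_mul_rankOne, rankOne, smul_smul]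
  congr 1
  ring

lemma rankOne_mul_rankOne (a : m) {u v : m → ℂ} (h : ∑ i, star (u i) * v i = 0) :
    rankOne a u * rankOne a v = 0 := by
  have := rankOne_mul_mul_rankOne a u v 1
  rw [mul_one] at this
  rw [this]
  have h2 : ∑ i, ∑ j, star (u i) * (1 : CStarMatrix m m ℂ) i j * v j = 0 := by
    rw [← h]
    refine Finset.sum_congr rfl fun i _ => ?_
    rw [Finset.sum_eq_single i]
    · rw [CStarMatrix.one_apply_eq, mul_one]
    · intro b _ hb
      rw [CStarMatrix.one_apply_ne hb.symm, mul_zero, zero_mul]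
    · simp
  rw [h2, mul_zero, zero_smul]

lemma rankOne_ne_zero (a : m) {u : m → ℂ} (hu : u ≠ 0) : rankOne a u ≠ 0 := by
  intro h
  have h1 := rankOne_mul_colMatrix a hu
  rw [h, zero_mul] at h1
  refine hu (funext fun i => ?_)
  have h2 : colMatrix a u i a = 0 := by rw [← h1]; rfl
  have h3 : (if a = a then u i else 0) = 0 := h2
  simpa using h3

end RankOne

lemma isMinimalProjection_blockIncl {i : ι} (a : n i) {u : n i → ℂ} (hu : u ≠ 0) :
    IsMinimalProjection (blockIncl i (rankOne a u) : Blocks n) := by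
  refine isMinimalProjection_of_forall_smul ⟨?_, ?_⟩ ?_ fun x => ?_
  · change blockIncl i _ * blockIncl i _ = _
    rw [← map_mul, (isStarProjection_rankOne a hu).isIdempotentElem]
  · change star _ = _
    rw [← StarHomClass.map_star, star_rankOne]
  · intro h
    exact rankOne_ne_zero a hu (Pi.single_eq_zero_iff.1 h)
  · obtain ⟨t, ht⟩ := rankOne_mul_mul_self a u (x i)
    refine ⟨t, ?_⟩
    rw [← map_smul, ← ht]
    ext1 j
    by_cases hj : j = i
    · subst hj
      simp [blockIncl_apply]
    · simp [blockIncl_apply, hj]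

end Blocks

end DecRank

end

open scoped ComplexOrder TensorProduct ENNReal

noncomputable section

namespace DecRank

/-! ### Strict order zero on minimal projections is order zero on everything. -/

section Decomposable

open scoped Classical

attribute [local instance 50] CStarAlgebra.spectralOrder CStarAlgebra.spectralOrderedRing

variable {A : Type*} [NonUnitalCStarAlgebra A]

lemma partialSumInclusion_apply {ι : Type*} (r : ι → ℕ) (I : Set ι) [DecidablePred (· ∈ I)]
    (x : MatrixSum (fun i : I => r i)) (i : ι) :
    partialSumInclusion r I x i = if h : i ∈ I then x ⟨i, h⟩ else 0 := by
  by_cases h : i ∈ I <;> simp [partialSumInclusion, h]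

variable {N s : ℕ} {r : Fin s → ℕ} {φ : MatrixSum r →ₗ[ℂ] A}

lemma OrderZeroOn.isDecomposable {c : Fin s → Fin (N + 1)}
    (h : OrderZeroOn (n := fun i => Fin (r i)) c φ) : IsDecomposable N φ := by
  refine ⟨c, fun j e f _ _ hef => ?_⟩
  rw [LinearMap.comp_apply, LinearMap.comp_apply]
  refine h.map_mul_map_eq_zero j (fun i hi => ?_) (fun i hi => ?_) ?_
  · exact (partialSumInclusion_apply r {i | c i = j} e i).trans (dif_neg hi)
  · exact (partialSumInclusion_apply r {i | c i = j} f i).trans (dif_neg hi)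
  · ext1 i
    rw [Pi.mul_apply]
    refine (congrArg₂ (· * ·) (partialSumInclusion_apply r {i | c i = j} e i)
      (partialSumInclusion_apply r {i | c i = j} f i)).trans ?_
    by_cases hi : i ∈ {i | c i = j}
    · simp only [dif_pos hi]
      exact congrFun hef ⟨i, hi⟩
    · simp only [dif_neg hi, zero_mul]
      rfl

lemma partialSumInclusion_blockIncl (I : Set (Fin s)) [DecidablePred (· ∈ I)] (i : I)
    (x : CStarMatrix (Fin (r i)) (Fin (r i)) ℂ) :
    partialSumInclusion r I (blockIncl (n := fun i : I => Fin (r i)) i x) =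
      blockIncl (n := fun i => Fin (r i)) i x := by
  ext1 k
  rw [partialSumInclusion_apply]
  by_cases hk : k = i
  · subst hk
    rw [dif_pos i.2]
    exact (blockIncl_same (n := fun i : I => Fin (r i)) i x).trans
      (blockIncl_same (n := fun i => Fin (r i)) (i : Fin s) x).symm
  · rw [blockIncl_of_ne (n := fun i => Fin (r i)) hk]
    split_ifs with h
    · exact blockIncl_of_ne (n := fun i : I => Fin (r i)) (k := ⟨k, h⟩)
        (fun h' => hk (congrArg Subtype.val h')) _
    · rfl

/-- Strict order zero only concerns minimal projections. Applied to the rank-one projections P_u and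
P_v, it spreads by Kadison–Schwarz to the row u* = u* P_u and the column v = P_v v. Products of rows
with orthogonal columns determine all relations between the images of matrix units. -/
lemma IsDecomposable.exists_orderZeroOn (hφ : IsCompletelyPositive φ) (h : IsDecomposable N φ) :
    ∃ c : Fin s → Fin (N + 1), OrderZeroOn (n := fun i => Fin (r i)) c φ := by
  obtain ⟨c, hc⟩ := h
  let n : Fin s → Type := fun i => Fin (r i)
  -- The hypothesis for the partial sum over the common colour, tested on rank-one projections and
  -- transported to the full sum.
  have key : ∀ (i j : Fin s) (_ : c i = c j) (a : n i) (b : n j) (u : n i → ℂ) (v : n j → ℂ),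
      u ≠ 0 → v ≠ 0 → (blockIncl (n := n) i (rankOne a u) * blockIncl (n := n) j (rankOne b v) = 0) →
      blockMap (n := n) φ i (rankOne a u) * blockMap (n := n) φ j (rankOne b v) = 0 := by
    intro i j hij a b u v hu hv h0
    let I : Set (Fin s) := {k | c k = c j}
    let n' : I → Type := fun i => Fin (r i)
    let i' : I := ⟨i, hij⟩
    let j' : I := ⟨j, rfl⟩
    have h1 := hc (c j) _ _ (isMinimalProjection_blockIncl (n := n') (i := i') a hu)
      (isMinimalProjection_blockIncl (n := n') (i := j') b hv) (by
        by_cases hij' : i = j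
        · subst hij'
          rw [← map_mul] at h0 ⊢
          have := congrFun h0 i
          rw [blockIncl_same] at this
          change (blockIncl (n := n') i' (rankOne a u * rankOne b v)) = 0
          rw [this]
          exact map_zero _
        · exact blockIncl_mul_of_ne (n := n') (i := i') (j := j')
            (fun h' => hij' (congrArg Subtype.val h')) _ _)
    rw [LinearMap.comp_apply, LinearMap.comp_apply] at h1
    exact (congrArg₂ (fun x y => φ x * φ y) (partialSumInclusion_blockIncl I i' _)
      (partialSumInclusion_blockIncl I j' _)).symm.trans h1
  have hproj : ∀ (i : Fin s) (a : n i) (u : n i → ℂ), u ≠ 0 →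
      IsStarProjection (blockIncl (n := n) i (rankOne a u)) :=
    fun i a u hu => (isMinimalProjection_blockIncl (n := n) a hu).1
  -- From the two projections to the row and the column that they fix.
  have key2 : ∀ (i j : Fin s) (_ : c i = c j) (a : n i) (b : n j) (u : n i → ℂ) (v : n j → ℂ),
      (blockIncl (n := n) i (rankOne a u) * blockIncl (n := n) j (rankOne b v) = 0) →
      blockMap (n := n) φ i (star (colMatrix a u)) * blockMap (n := n) φ j (colMatrix b v) = 0 := by
    intro i j hij a b u v h0
    by_cases hu : u = 0
    · rw [hu, colMatrix_zero, star_zero, map_zero, zero_mul]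
    by_cases hv : v = 0
    · rw [hv, colMatrix_zero, map_zero, mul_zero]
    have h1 := hφ.map_mul_map_eq_zero (hproj j b v hv) (hproj i a u hu)
      (key i j hij a b u v hu hv h0) (blockIncl (n := n) i (star (colMatrix a u)))
      (blockIncl (n := n) j (colMatrix b v))
    rw [← map_mul (blockIncl (n := n) i), ← map_mul (blockIncl (n := n) j),
      rankOne_mul_colMatrix b hv] at h1
    have h2 := congrArg star (rankOne_mul_colMatrix a hu)
    rw [star_mul, star_rankOne] at h2
    rw [h2] at h1
    exact h1
  refine ⟨c, fun i => preservesZeroProducts_of_colMatrix fun a b u v huv => key2 i i rfl a b u v ?_,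
    fun i j hij hcij x y => ?_⟩
  · rw [rankOne_indep b a, ← map_mul, rankOne_mul_rankOne a huv, map_zero]
  · have h0 : ∀ (a b : n i) (d e : n j),
        blockMap (n := n) φ i (matUnit a b) * blockMap (n := n) φ j (matUnit d e) = 0 := by
      intro a b d e
      rw [← star_colMatrix_single, ← colMatrix_single]
      exact key2 i j hcij a e _ _ (blockIncl_mul_of_ne hij _ _)
    change blockMap (n := n) φ i x * blockMap (n := n) φ j y = 0
    rw [sum_smul_matUnit x, sum_smul_matUnit y]
    simp only [map_sum, map_smul, Finset.sum_mul, Finset.mul_sum, smul_mul_assoc, mul_smul_comm]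
    simp only [h0, smul_zero, Finset.sum_const_zero]

end Decomposable

end DecRank

end

open scoped ComplexOrder TensorProduct ENNReal

noncomputable section

namespace DecRank

/-! ### Models of finite sets: no maps out of the algebra. -/

section Models

open scoped Classical

attribute [local instance 50] CStarAlgebra.spectralOrder CStarAlgebra.spectralOrderedRing

variable {A B : Type*} [NonUnitalCStarAlgebra A] [NonUnitalCStarAlgebra B]

/-- Within `ε`, the elements of `S` belong to the multiplicative domain of a completely positive
contraction from a finite-dimensional algebra which is a sum of `N + 1` maps of order zero. -/
def HasModel (N : ℕ) (S : Set B) (ε : ℝ) : Prop :=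
  ∃ (ι : Type) (_ : Fintype ι) (n : ι → Type) (_ : ∀ i, Fintype (n i)) (φ : Blocks n →ₗ[ℂ] B)
    (c : ι → Fin (N + 1)), IsCPC φ ∧ OrderZeroOn c φ ∧
      ∀ b ∈ S, ∃ y, ‖φ y - b‖ < ε ∧ ‖φ (y * star y) - b * star b‖ < ε

/-- Every finite set has models of any precision. This is equivalent to
`HasDecomposableApproximations`, but makes no mention of maps out of the algebra. -/
def HasApproximateModels (B : Type*) [NonUnitalCStarAlgebra B] (N : ℕ) : Prop :=
  ∀ (S : Finset B) (ε : ℝ), 0 < ε → HasModel N (S : Set B) ε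

/-- A model only contains maps into the algebra, so composing with π is enough; no lifting along π
is ever needed. -/
lemma HasModel.map {N : ℕ} {S : Set A} {ε : ℝ} (h : HasModel N S ε) (π : A →⋆ₙₐ[ℂ] B) :
    HasModel N (π '' S) ε := by
  obtain ⟨ι, _, n, _, φ, c, hφ, hc, hS⟩ := h
  refine ⟨ι, _, n, _, (π : A →ₗ[ℂ] B) ∘ₗ φ, c, (isCPC_hom π).comp hφ, hc.hom_comp π, ?_⟩
  rintro _ ⟨b, hb, rfl⟩
  obtain ⟨y, hy1, hy2⟩ := hS b hb
  refine ⟨y, ?_, ?_⟩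
  · change ‖π (φ y) - π b‖ < ε
    rw [← map_sub]
    exact (NonUnitalStarAlgHom.norm_apply_le π _).trans_lt hy1
  · change ‖π (φ (y * star y)) - π b * star (π b)‖ < ε
    rw [← StarHomClass.map_star, ← map_mul, ← map_sub]
    exact (NonUnitalStarAlgHom.norm_apply_le π _).trans_lt hy2

lemma HasModel.mono {N M : ℕ} {S T : Set B} {ε : ℝ} (h : HasModel N S ε) (hNM : N ≤ M)
    (hT : T ⊆ S) : HasModel M T ε := by
  obtain ⟨ι, _, n, _, φ, c, hφ, hc, hS⟩ := h
  refine ⟨ι, _, n, _, φ, fun i => Fin.castLE (by omega) (c i), hφ, ⟨hc.block, fun i j hij h => ?_⟩,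
    fun b hb => hS b (hT hb)⟩
  exact hc.orthogonal i j hij (Fin.castLE_injective _ h)

lemma HasApproximateModels.mono {N M : ℕ} (h : HasApproximateModels B N) (hNM : N ≤ M) :
    HasApproximateModels B M := fun S ε hε => (h S ε hε).mono hNM subset_rfl

/-- It suffices to find models for the finite subsets of a dense set. -/
lemma hasApproximateModels_of_dense {N : ℕ} {X : Set B} (hX : Dense X)
    (h : ∀ (S : Finset B) (ε : ℝ), (S : Set B) ⊆ X → 0 < ε → HasModel N (S : Set B) ε) :
    HasApproximateModels B N := by
  intro S ε hε
  have key : ∀ b : B, ∃ b' ∈ X, ‖b' - b‖ < ε / 2 ∧ ‖b' * star b' - b * star b‖ < ε / 2 := by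
    intro b
    have hc : Continuous fun b' : B => b' * star b' := by fun_prop
    have h1 := Metric.continuous_iff.1 hc b (ε / 2) (half_pos hε)
    obtain ⟨δ, hδ, h1⟩ := h1
    obtain ⟨b', hb', hd⟩ := hX.exists_dist_lt b (lt_min hδ (half_pos hε))
    rw [dist_comm] at hd
    refine ⟨b', hb', ?_, ?_⟩
    · rw [← dist_eq_norm]
      exact hd.trans_le (min_le_right _ _)
    · rw [← dist_eq_norm]
      exact h1 b' (hd.trans_le (min_le_left _ _))
  choose f hf h1 h2 using key
  obtain ⟨ι, _, n, _, φ, c, hφ, hc, hS⟩ := h (S.image f) (ε / 2)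
    (by rw [Finset.coe_image]; rintro _ ⟨b, _, rfl⟩; exact hf b) (half_pos hε)
  refine ⟨ι, _, n, _, φ, c, hφ, hc, fun b hb => ?_⟩
  obtain ⟨y, hy1, hy2⟩ := hS (f b) (by rw [Finset.coe_image]; exact ⟨b, hb, rfl⟩)
  refine ⟨y, ?_, ?_⟩
  · rw [← sub_add_sub_cancel _ (f b)]
    linarith [norm_add_le (φ y - f b) (f b - b), h1 b]
  · rw [← sub_add_sub_cancel _ (f b * star (f b))]
    linarith [norm_add_le (φ (y * star y) - f b * star (f b)) (f b * star (f b) - b * star b), h2 b]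

/-- In a sufficiently good approximation, the elements of `S` are almost in the multiplicative
domain. -/
lemma HasDecomposableApproximations.exists_factorization {N : ℕ}
    (h : HasDecomposableApproximations B N) (S : Finset B) {ε : ℝ} (hε : 0 < ε) :
    ∃ (ι : Type) (_ : Fintype ι) (n : ι → Type) (_ : ∀ i, Fintype (n i)) (ψ : B →ₗ[ℂ] Blocks n)
      (φ : Blocks n →ₗ[ℂ] B) (c : ι → Fin (N + 1)), IsCPC ψ ∧ IsCPC φ ∧ OrderZeroOn c φ ∧
        ∀ b ∈ S, ‖φ (ψ b) - b‖ < ε ∧ ‖φ (ψ b * star (ψ b)) - b * star b‖ < ε := by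
  have hC : ∃ C : ℝ, 0 ≤ C ∧ ∀ b ∈ S, ‖b‖ ≤ C :=
    ⟨∑ b ∈ S, ‖b‖, Finset.sum_nonneg fun _ _ => norm_nonneg _, fun b hb =>
      Finset.single_le_sum (f := fun b => ‖b‖) (fun _ _ => norm_nonneg _) hb⟩
  obtain ⟨C, hC0, hC⟩ := hC
  -- The final error is δ + 2Cδ + 2Cδ < 4δ(C + 1) = ε.
  let δ := ε / (4 * (C + 1))
  have hδ : 0 < δ := by positivity
  have hδC : 4 * (δ * (C + 1)) = ε := by simp only [δ]; field_simp
  have hδε : δ < ε := by nlinarith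
  obtain ⟨s, r, ψ, φ, hψ, hφ, hd, hS⟩ := h (S ∪ S.image fun b => b * star b) δ hδ
  obtain ⟨c, hc⟩ := hd.exists_orderZeroOn hφ.1
  refine ⟨Fin s, inferInstance, fun i => Fin (r i), inferInstance, ψ, φ, c, hψ, hφ, hc,
    fun b hb => ?_⟩
  have h1 := hS b (Finset.mem_union_left _ hb)
  have h2 := hS (b * star b) (Finset.mem_union_right _ (Finset.mem_image_of_mem _ hb))
  refine ⟨h1.trans hδε, ?_⟩
  set P := φ (ψ b) with hP
  -- φ(ψ(b) ψ(b)*) is squeezed between P P* and φ(ψ(b b*)). Both are close to b b*: the former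
  -- because P is close to b, the latter because b b* was added to the approximated set.
  have e1 : P * star P ≤ φ (ψ b * star (ψ b)) := by
    have := hφ.star_map_mul_map_le (star (ψ b))
    rwa [hφ.1.map_star, star_star, star_star] at this
  have e2 : φ (ψ b * star (ψ b)) ≤ φ (ψ (b * star b)) := by
    refine hφ.1.mono ?_
    have := hψ.star_map_mul_map_le (star b)
    rwa [hψ.1.map_star, star_star, star_star] at this
  have e3 : ‖φ (ψ b * star (ψ b)) - P * star P‖ ≤ ‖φ (ψ (b * star b)) - P * star P‖ :=
    norm_le_of_nonneg_of_le (sub_nonneg.2 e1) (sub_le_sub_right e2 _)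
  have hPn : ‖P‖ ≤ C := ((hφ.2 _).trans (hψ.2 _)).trans (hC b hb)
  have e4 : ‖P * star P - b * star b‖ ≤ δ * (2 * C) := by
    have : P * star P - b * star b = (P - b) * star P + b * star (P - b) := by
      rw [star_sub]; noncomm_ring
    rw [this]
    refine (norm_add_le _ _).trans ?_
    have n1 := norm_mul_le (P - b) (star P)
    have n2 := norm_mul_le b (star (P - b))
    rw [norm_star] at n1 n2
    have n3 : ‖P - b‖ * ‖P‖ ≤ δ * C := by gcongr
    have n4 : ‖b‖ * ‖P - b‖ ≤ C * δ := by
      gcongr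
      exact hC b hb
    linarith
  have t1 := norm_sub_le_norm_sub_add_norm_sub (φ (ψ (b * star b))) (b * star b) (P * star P)
  have t2 := norm_sub_le_norm_sub_add_norm_sub (φ (ψ b * star (ψ b))) (P * star P) (b * star b)
  rw [norm_sub_rev (b * star b)] at t1
  nlinarith

lemma HasDecomposableApproximations.hasApproximateModels {N : ℕ}
    (h : HasDecomposableApproximations B N) : HasApproximateModels B N := by
  intro S ε hε
  obtain ⟨ι, _, n, _, ψ, φ, c, -, hφ, hc, hS⟩ := h.exists_factorization S hε
  exact ⟨ι, _, n, _, φ, c, hφ, hc, fun b hb => ⟨ψ b, hS b hb⟩⟩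

section Reindex

variable {ι : Type} [Fintype ι] {n : ι → Type} [∀ i, Fintype (n i)]

/-- A sum of matrix algebras, with the index sets replaced by initial segments of `ℕ`. -/
def blocksReindex {s : ℕ} {r : Fin s → ℕ} (e : Fin s → ι) (f : ∀ j, n (e j) ≃ Fin (r j)) :
    Blocks n →⋆ₙₐ[ℂ] MatrixSum r where
  toFun x j := CStarMatrix.reindexₐ ℂ ℂ (f j) (x (e j))
  map_smul' t x := by ext1 j; exact map_smul (CStarMatrix.reindexₐ ℂ ℂ (f j)) t (x (e j))
  map_zero' := by ext1 j; exact map_zero (CStarMatrix.reindexₐ ℂ ℂ (f j))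
  map_add' x y := by ext1 j; exact map_add (CStarMatrix.reindexₐ ℂ ℂ (f j)) (x (e j)) (y (e j))
  map_mul' x y := by ext1 j; exact map_mul (CStarMatrix.reindexₐ ℂ ℂ (f j)) (x (e j)) (y (e j))
  map_star' x := by ext1 j; exact map_star (CStarMatrix.reindexₐ ℂ ℂ (f j)) (x (e j))

lemma blocksReindex_bijective {s : ℕ} {r : Fin s → ℕ} (e : Fin s ≃ ι)
    (f : ∀ j, n (e j) ≃ Fin (r j)) : Function.Bijective (blocksReindex (n := n) e f) := by
  constructor
  · intro x y h
    ext1 i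
    obtain ⟨j, rfl⟩ := e.surjective i
    exact (CStarMatrix.reindexₐ ℂ ℂ (f j)).injective (congrFun h j)
  · intro z
    -- Quantifying over j together with i = e j confines the dependent transport to this statement.
    have h : ∀ i, ∃ x : CStarMatrix (n i) (n i) ℂ, ∀ (j) (h : i = e j),
        CStarMatrix.reindexₐ ℂ ℂ (f j) (h ▸ x) = z j := by
      intro i
      obtain ⟨j, rfl⟩ := e.surjective i
      refine ⟨(CStarMatrix.reindexₐ ℂ ℂ (f j)).symm (z j), fun k hk => ?_⟩
      obtain rfl := e.injective hk
      exact StarAlgEquiv.apply_symm_apply _ _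
    choose x hx using h
    exact ⟨x, funext fun j => hx (e j) j rfl⟩

/-- Models allow arbitrary finite index types, which are stable under sums and products. Here they
are renumbered by a *-isomorphism to match the definition of the rank. -/
lemma exists_decomposable_of_model {N : ℕ} {c : ι → Fin (N + 1)} {φ : Blocks n →ₗ[ℂ] B}
    (hφ : IsCPC φ) (hc : OrderZeroOn c φ) {ψ : A →ₗ[ℂ] Blocks n} (hψ : IsCPC ψ) :
    ∃ (s : ℕ) (r : Fin s → ℕ) (ψ' : A →ₗ[ℂ] MatrixSum r) (φ' : MatrixSum r →ₗ[ℂ] B),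
      IsCPC ψ' ∧ IsCPC φ' ∧ IsDecomposable N φ' ∧ ∀ a, φ' (ψ' a) = φ (ψ a) := by
  let e := (Fintype.equivFin ι).symm
  let r : Fin (Fintype.card ι) → ℕ := fun j => Fintype.card (n (e j))
  let f : ∀ j, n (e j) ≃ Fin (r j) := fun j => Fintype.equivFin _
  let Θ := StarAlgEquiv.ofBijective (R := ℂ) (blocksReindex e f) (blocksReindex_bijective e f)
  let Θ' : MatrixSum r →⋆ₙₐ[ℂ] Blocks n := (Θ.symm : MatrixSum r ≃⋆ₐ[ℂ] Blocks n)
  have hΘ : ∀ x, Θ' (blocksReindex e f x) = x := fun x => Θ.symm_apply_apply x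
  refine ⟨_, r, (blocksReindex (n := n) e f : Blocks n →ₗ[ℂ] MatrixSum r) ∘ₗ ψ,
    φ ∘ₗ (Θ' : MatrixSum r →ₗ[ℂ] Blocks n), (isCPC_hom _).comp hψ, hφ.comp (isCPC_hom Θ'),
    OrderZeroOn.isDecomposable (c := c ∘ e) ?_, fun a => congrArg φ (hΘ _)⟩
  have hΘ2 : ∀ j (x : CStarMatrix (Fin (r j)) (Fin (r j)) ℂ),
      Θ' (blockIncl (n := fun j => Fin (r j)) j x) =
        blockIncl (e j) ((CStarMatrix.reindexₐ ℂ ℂ (f j)).symm x) := by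
    intro j x
    rw [← hΘ (blockIncl (e j) _)]
    congr 1
    ext1 k
    by_cases hk : k = j
    · subst hk
      rw [blockIncl_same (n := fun j => Fin (r j))]
      change _ = CStarMatrix.reindexₐ ℂ ℂ (f k) (blockIncl (n := n) (e k) _ (e k))
      rw [blockIncl_same, StarAlgEquiv.apply_symm_apply]
    · rw [blockIncl_of_ne (n := fun j => Fin (r j)) hk]
      change _ = CStarMatrix.reindexₐ ℂ ℂ (f k) (blockIncl (n := n) (e j) _ (e k))
      rw [blockIncl_of_ne (n := n) (e.injective.ne hk), map_zero]
  constructor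
  · intro j x y hxy
    change φ (Θ' (blockIncl (n := fun j => Fin (r j)) j x)) *
      φ (Θ' (blockIncl (n := fun j => Fin (r j)) j y)) = 0
    rw [hΘ2, hΘ2]
    exact hc.block (e j) _ _ (by rw [← map_mul, hxy, map_zero])
  · intro i j hij hcij x y
    change φ (Θ' (blockIncl (n := fun j => Fin (r j)) i x)) *
      φ (Θ' (blockIncl (n := fun j => Fin (r j)) j y)) = 0
    rw [hΘ2, hΘ2]
    exact hc.orthogonal _ _ (e.injective.ne hij) hcij _ _

end Reindex

end Models

end DecRank

end

open scoped ComplexOrder TensorProduct ENNReal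

noncomputable section

namespace DecRank

/-! ### An approximate left inverse for an order zero map. -/

section Compression

open scoped Classical

attribute [local instance 50] CStarAlgebra.spectralOrder CStarAlgebra.spectralOrderedRing

variable {B : Type*} [NonUnitalCStarAlgebra B] {m : Type} [Fintype m]

/-- The map `b ↦ (ρ (V p* b V q))` into matrices. -/
def compression (ρ : B →ₚ[ℂ] ℂ) (V : m → B) : B →ₗ[ℂ] CStarMatrix m m ℂ where
  toFun b := CStarMatrix.ofMatrix fun p q => ρ (star (V p) * b * V q)
  map_add' b b' := by
    ext p q
    change ρ (star (V p) * (b + b') * V q) = ρ (star (V p) * b * V q) + ρ (star (V p) * b' * V q)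
    rw [mul_add, add_mul, map_add]
  map_smul' t b := by
    ext p q
    change ρ (star (V p) * (t • b) * V q) = t • ρ (star (V p) * b * V q)
    rw [mul_smul_comm, smul_mul_assoc, map_smul]

lemma compression_apply (ρ : B →ₚ[ℂ] ℂ) (V : m → B) (b : B) (p q : m) :
    compression ρ V b p q = ρ (star (V p) * b * V q) := rfl

lemma sum_star_mul_compression_mul (ρ : B →ₚ[ℂ] ℂ) (V : m → B) (b : B) (w v : m → ℂ) :
    ∑ p, ∑ q, star (w p) * compression ρ V b p q * v q =
      ρ (star (∑ p, w p • V p) * b * ∑ q, v q • V q) := by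
  simp only [star_sum, star_smul, Finset.sum_mul, Finset.mul_sum, map_sum, smul_mul_assoc,
    mul_smul_comm, map_smul, compression_apply, smul_eq_mul]
  rw [Finset.sum_comm]
  refine Finset.sum_congr rfl fun p _ => Finset.sum_congr rfl fun q _ => ?_
  ring

lemma colMatrix_mul_star_apply (a : m) (v w : m → ℂ) (p q : m) :
    (colMatrix a v * star (colMatrix a w)) p q = v p * star (w q) := by
  rw [CStarMatrix.mul_apply]
  change ∑ b, (if b = a then v p else 0) * star (if b = a then w q else 0) = _
  simp

/-- For a Gram matrix in the z_c, the scalar matrix indexed by pairs (i, p) with entries ρ(∑_c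
(z_{c,i} V_p)* z_{c,j} V_q) is positive semidefinite, hence a sum of matrices v v*. Splitting the
coordinates of v exhibits the compression as a Gram matrix of columns; the index `a` only says in
which column they are stored. -/
lemma isCompletelyPositive_compression (ρ : B →ₚ[ℂ] ℂ) (V : m → B) (a : m) :
    IsCompletelyPositive (compression ρ V) := by
  refine .of_gram fun k z => ?_
  let G : Matrix (Fin k × m) (Fin k × m) ℂ := fun x y =>
    ρ (∑ c, star (z c x.1 * V x.2) * (z c y.1 * V y.2))
  have hG : G.PosSemidef := by
    refine .of_dotProduct_mulVec_nonneg ?_ fun x => ?_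
    · ext x y
      change star (ρ _) = ρ _
      rw [← map_star]
      simp only [star_sum, star_mul, star_star]
    · have : star x ⬝ᵥ Matrix.mulVec G x = ρ (∑ c, star (∑ d, x d • (z c d.1 * V d.2)) *
          ∑ d, x d • (z c d.1 * V d.2)) := by
        simp only [dotProduct, Matrix.mulVec, Finset.mul_sum, Finset.sum_mul, star_sum, star_smul,
          map_sum, smul_mul_assoc, mul_smul_comm, map_smul, smul_eq_mul, G, Pi.star_apply]
        rw [Finset.sum_comm_cycle]
        refine Finset.sum_congr rfl fun c _ => ?_
        rw [Finset.sum_comm]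
        refine Finset.sum_congr rfl fun p _ => Finset.sum_congr rfl fun q _ => ?_
        ring
      rw [this]
      exact map_nonneg ρ (Finset.sum_nonneg fun c _ => star_mul_self_nonneg _)
  obtain ⟨M, v, hv⟩ := Matrix.posSemidef_iff_eq_sum_vecMulVec.1 hG
  refine ⟨Fin M, inferInstance, fun r i => star (colMatrix a fun p => v r (i, p)),
    fun i j => ?_⟩
  ext p q
  have h1 := congrFun (congrFun hv (i, p)) (j, q)
  rw [compression_apply]
  simp only [star_star]
  have h2 : (∑ c, colMatrix a (fun p => v c (i, p)) * star (colMatrix a fun p => v c (j, p))) p q =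
      ∑ c, v c (i, p) * star (v c (j, q)) := by
    refine (Matrix.sum_apply p q Finset.univ _).trans (Finset.sum_congr rfl fun c _ => ?_)
    exact colMatrix_mul_star_apply a _ _ p q
  rw [h2]
  rw [Matrix.sum_apply] at h1
  simp only [Matrix.vecMulVec_apply, Pi.star_apply] at h1
  rw [← h1]
  change ρ _ = ρ _
  congr 1
  simp only [Finset.mul_sum, Finset.sum_mul, star_mul, mul_assoc]

/-- A completely positive order zero map on a matrix algebra has an approximate left inverse. -/
lemma PreservesZeroProducts.exists_leftInverse {φ : CStarMatrix m m ℂ →ₗ[ℂ] B}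
    (hφ : IsCompletelyPositive φ) (h : PreservesZeroProducts φ) :
    ∃ ψ : B →ₗ[ℂ] CStarMatrix m m ℂ, IsCPC ψ ∧
      ∀ (b : B) (y : CStarMatrix m m ℂ) (δ : ℝ), 0 ≤ δ → (∀ x, ‖b * φ x - φ (y * x)‖ ≤ δ * ‖x‖) →
        ∀ a, ‖φ (matUnit a a)‖ * ‖ψ b - y‖ ≤ δ := by
  -- All the weights in the conclusion are then zero.
  by_cases h0 : ∀ a, φ (matUnit a a) = 0
  · refine ⟨0, ⟨isCompletelyPositive_zero, fun x => ?_⟩, fun b y δ hδ _ a => ?_⟩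
    · rw [LinearMap.zero_apply, norm_zero]
      exact norm_nonneg x
    · rw [h0, norm_zero, zero_mul]
      exact hδ
  push Not at h0
  obtain ⟨a, ha⟩ := h0
  set e := φ (matUnit a a) with he
  set t := ‖e‖ with ht
  have ht0 : 0 < t := norm_pos_iff.2 ha
  have hes : star e = e := by rw [he, ← hφ.map_star, star_matUnit]
  -- ρ is contractive with ρ(e²) = t². If b φ(x) = φ(y x) held exactly, then t⁻² ρ(φ(e_pa)* b
  -- φ(e_qa)) = t⁻² ρ(φ(e_ap) φ(y e_qa)) = t⁻² y_pq ρ(e²) = y_pq.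
  obtain ⟨ρ, hρ, hρe⟩ := exists_positiveLinearMap_apply_eq_norm (star_mul_self_nonneg e)
  rw [CStarRing.norm_star_mul_self, hes] at hρe
  let V : m → B := fun p => φ (matUnit p a)
  have hV : ∀ v : m → ℂ, ∑ p, v p • V p = φ (colMatrix a v) := fun v => by
    simp only [colMatrix_eq_sum, map_sum, map_smul, V]
  have hn : ∀ v : m → ℂ, ‖φ (colMatrix a v)‖ ≤ t * √(∑ i, ‖v i‖ ^ 2) := fun v =>
    (h.norm_map_le hφ a _).trans (mul_le_mul_of_nonneg_left (norm_colMatrix_le a v) ht0.le)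
  have hsesq : ∀ b (w v : m → ℂ),
      ∑ p, ∑ q, star (w p) * ((((t ^ 2)⁻¹ : ℝ) : ℂ) • compression ρ V) b p q * v q =
        (((t ^ 2)⁻¹ : ℝ) : ℂ) * ρ (star (φ (colMatrix a w)) * b * φ (colMatrix a v)) := by
    intro b w v
    rw [← hV, ← hV, ← sum_star_mul_compression_mul, Finset.mul_sum]
    refine Finset.sum_congr rfl fun p _ => ?_
    rw [Finset.mul_sum]
    refine Finset.sum_congr rfl fun q _ => ?_
    change _ * ((((t ^ 2)⁻¹ : ℝ) : ℂ) * compression ρ V b p q) * _ = _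
    ring
  refine ⟨(((t ^ 2)⁻¹ : ℝ) : ℂ) • compression ρ V,
    ⟨(isCompletelyPositive_compression ρ V a).smul (by positivity), fun b => ?_⟩,
    fun b y δ hδ hb a' => ?_⟩
  · refine cstarMatrix_norm_le (norm_nonneg b) fun w v => ?_
    rw [hsesq, norm_mul, Complex.norm_real, Real.norm_of_nonneg (by positivity)]
    have h1 : ‖ρ (star (φ (colMatrix a w)) * b * φ (colMatrix a v))‖ ≤
        (t * √(∑ i, ‖w i‖ ^ 2)) * ‖b‖ * (t * √(∑ i, ‖v i‖ ^ 2)) := by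
      refine (hρ _).trans ((norm_mul_le _ _).trans ?_)
      refine mul_le_mul ((norm_mul_le _ _).trans ?_) (hn v) (norm_nonneg _) (by positivity)
      rw [norm_star]
      exact mul_le_mul_of_nonneg_right (hn w) (norm_nonneg _)
    refine (mul_le_mul_of_nonneg_left h1 (by positivity)).trans (le_of_eq ?_)
    field_simp
  · rw [h.norm_matUnit_eq hφ a' a, mul_comm, ← le_div_iff₀ ht0]
    refine cstarMatrix_norm_le (by positivity) fun w v => ?_
    -- The exact case for the form of y: w* · (y v) equals (w* y v) e_aa · e_aa, so the φ-images
    -- have the same product.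
    have h1 : ∑ p, ∑ q, star (w p) * y p q * v q = (((t ^ 2)⁻¹ : ℝ) : ℂ) *
        ρ (star (φ (colMatrix a w)) * φ (y * colMatrix a v)) := by
      rw [← hφ.map_star, h.map_mul_map_congr (x' := (∑ p, ∑ q, star (w p) * y p q * v q) •
        matUnit a a) (y' := matUnit a a), map_smul, smul_mul_assoc, map_smul, hρe, smul_eq_mul]
      · rw [mul_left_comm]
        have : (((t ^ 2)⁻¹ : ℝ) : ℂ) * ((t * t : ℝ) : ℂ) = 1 := by
          rw [← Complex.ofReal_mul, ← sq, inv_mul_cancel₀ (by positivity), Complex.ofReal_one]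
        rw [this, mul_one]
      · rw [← mul_assoc, star_colMatrix_mul_mul, smul_mul_assoc, matUnit_mul_same]
    have h2 : ∑ p, ∑ q, star (w p) *
        (((((t ^ 2)⁻¹ : ℝ) : ℂ) • compression ρ V) b - y) p q * v q = (((t ^ 2)⁻¹ : ℝ) : ℂ) *
        ρ (star (φ (colMatrix a w)) * (b * φ (colMatrix a v) - φ (y * colMatrix a v))) := by
      rw [mul_sub, map_sub, mul_sub, ← h1, ← mul_assoc, ← hsesq, ← Finset.sum_sub_distrib]
      refine Finset.sum_congr rfl fun p _ => ?_
      rw [← Finset.sum_sub_distrib]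
      refine Finset.sum_congr rfl fun q _ => ?_
      change _ * (((((t ^ 2)⁻¹ : ℝ) : ℂ) • compression ρ V) b p q - y p q) * _ = _
      rw [mul_sub, sub_mul]
    rw [h2, norm_mul, Complex.norm_real, Real.norm_of_nonneg (by positivity)]
    have h3 : ‖ρ (star (φ (colMatrix a w)) * (b * φ (colMatrix a v) - φ (y * colMatrix a v)))‖ ≤
        (t * √(∑ i, ‖w i‖ ^ 2)) * (δ * √(∑ i, ‖v i‖ ^ 2)) := by
      refine (hρ _).trans ((norm_mul_le _ _).trans ?_)
      rw [norm_star]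
      exact mul_le_mul (hn w) ((hb _).trans (mul_le_mul_of_nonneg_left (norm_colMatrix_le a v) hδ))
        (norm_nonneg _) (by positivity)
    refine (mul_le_mul_of_nonneg_left h3 (by positivity)).trans (le_of_eq ?_)
    field_simp

end Compression

/-! ### Equivalence of models and approximations. -/

section Key

open scoped Classical

attribute [local instance 50] CStarAlgebra.spectralOrder CStarAlgebra.spectralOrderedRing

variable {B : Type*} [NonUnitalCStarAlgebra B]

/-- Since y is almost in the multiplicative domain and φ(y) ≈ b, one has b φ(x) ≈ φ(y x). The
blockwise left inverses therefore recover y from b up to the weights, and φ(ψ(b)) ≈ φ(y) ≈ b because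
φ has order zero on each colour. -/
lemma HasApproximateModels.hasDecomposableApproximations {N : ℕ} (h : HasApproximateModels B N) :
    HasDecomposableApproximations B N := by
  intro S ε hε
  obtain ⟨C, hC0, hC⟩ : ∃ C : ℝ, 0 ≤ C ∧ ∀ b ∈ S, ‖b‖ ≤ C :=
    ⟨∑ b ∈ S, ‖b‖, Finset.sum_nonneg fun _ _ => norm_nonneg _, fun b hb =>
      Finset.single_le_sum (f := fun b => ‖b‖) (fun _ _ => norm_nonneg _) hb⟩
  -- 5t bounds the weighted error on a block, multiplied by N + 1 for the colours; the last t is for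
  -- ‖φ(y) − b‖.
  obtain ⟨t, ht0, ht⟩ : ∃ t : ℝ, 0 < t ∧ (N + 1) * (5 * t) + t ≤ ε := by
    refine ⟨ε / (5 * (N + 1) + 1), by positivity, le_of_eq ?_⟩
    field_simp
  obtain ⟨η, hη0, hη1, hηt, hη⟩ : ∃ η : ℝ, 0 < η ∧ η ≤ 1 ∧ η < t ∧ η * (2 * C + 2) ≤ t ^ 2 := by
    refine ⟨min (min 1 (t / 2)) (t ^ 2 / (2 * C + 2)), by positivity,
      (min_le_left _ _).trans (min_le_left _ _),
      ((min_le_left _ _).trans (min_le_right _ _)).trans_lt (half_lt_self ht0), ?_⟩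
    rw [← le_div_iff₀ (by positivity)]
    exact min_le_right _ _
  obtain ⟨ι, _, n, _, φ, c, hφ, hc, hS⟩ := h S η hη0
  choose ψ hψ hψb using fun i => (hc.block i).exists_leftInverse (hφ.1.blockMap i)
  have hψ' : IsCPC (LinearMap.pi ψ : B →ₗ[ℂ] Blocks n) :=
    ⟨isCompletelyPositive_pi fun i => (hψ i).1,
      fun b => (pi_norm_le_iff_of_nonneg (norm_nonneg b)).2 fun i => (hψ i).2 b⟩
  obtain ⟨s, r, ψ', φ', h1, h2, h3, h4⟩ := exists_decomposable_of_model hφ hc hψ'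
  refine ⟨s, r, ψ', φ', h1, h2, h3, fun b hb => ?_⟩
  rw [h4]
  obtain ⟨y, hy1, hy2⟩ := hS b hb
  have hdef : ‖mulDefect φ (star y) (star y)‖ ≤ t ^ 2 :=
    (hφ.norm_map_mul_star_sub_le hη1 (hC b hb) hy1.le hy2.le).trans hη
  -- 4t for the defect of multiplicativity and t for replacing φ(y) by b.
  have hmod : ∀ x, ‖b * φ x - φ (y * x)‖ ≤ 5 * t * ‖x‖ := by
    intro x
    have e1 := hφ.norm_mulDefect_le_of_le ht0 hdef x
    rw [mulDefect_apply, hφ.1.map_star, star_star, star_star, norm_sub_rev] at e1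
    have e2 : ‖b * φ x - φ y * φ x‖ ≤ t * ‖x‖ := by
      rw [← sub_mul]
      refine (norm_mul_le _ _).trans (mul_le_mul ?_ (hφ.2 x) (norm_nonneg _) ht0.le)
      rw [norm_sub_rev]
      linarith
    have := norm_sub_le_norm_sub_add_norm_sub (b * φ x) (φ y * φ x) (φ (y * x))
    linarith
  have hblock : ∀ i a, ‖blockMap φ i (matUnit a a)‖ * ‖ψ i b - y i‖ ≤ 5 * t := by
    intro i a
    refine hψb i b (y i) (5 * t) (by positivity) (fun x => ?_) a
    have e1 := hmod (blockIncl i x)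
    have e2 : y * blockIncl i x = blockIncl i (y i * x) := by
      ext1 k
      rw [Pi.mul_apply]
      by_cases hk : k = i
      · subst hk
        rw [blockIncl_same, blockIncl_same]
      · rw [blockIncl_of_ne hk, blockIncl_of_ne hk, mul_zero]
    rw [e2] at e1
    refine e1.trans (mul_le_mul_of_nonneg_left ?_ (by positivity))
    exact NonUnitalStarAlgHom.norm_apply_le (B := Blocks n) (blockIncl (n := n) i) x
  have e3 := hc.norm_map_le hφ.1 (LinearMap.pi ψ b - y) (δ := 5 * t) (by positivity) hblock
  rw [map_sub] at e3
  have := norm_sub_le_norm_sub_add_norm_sub (φ (LinearMap.pi ψ b)) (φ y) b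
  change ‖φ (LinearMap.pi ψ b) - b‖ < ε
  linarith

lemma hasDecomposableApproximations_iff {N : ℕ} :
    HasDecomposableApproximations B N ↔ HasApproximateModels B N :=
  ⟨fun h => h.hasApproximateModels, fun h => h.hasDecomposableApproximations⟩

lemma decompositionRank_le_iff {N : ℕ} :
    decompositionRank B ≤ N ↔ HasApproximateModels B N := by
  constructor
  · intro h
    have hne : {N : ℕ∞ | ∃ n : ℕ, N = n ∧ HasDecomposableApproximations B n}.Nonempty := by
      by_contra! h0
      -- The infimum of the empty set is ⊤, which is not below N; otherwise the infimum is attained.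
      rw [decompositionRank, h0, sInf_empty] at h
      exact absurd h (by simp)
    obtain ⟨k, hk, hkB⟩ := csInf_mem hne
    change decompositionRank B = k at hk
    rw [hk] at h
    exact hkB.hasApproximateModels.mono (by exact_mod_cast h)
  · exact fun h => sInf_le ⟨N, rfl, h.hasDecomposableApproximations⟩

lemma decompositionRank_le_of_forall {A : Type*} [NonUnitalCStarAlgebra A] {M : ℕ∞}
    (h : ∀ N : ℕ, M ≤ N → HasApproximateModels A N) : decompositionRank A ≤ M := by
  induction M using ENat.recTopCoe with
  | top => exact le_top
  | coe N => exact decompositionRank_le_iff.2 (h N le_rfl)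

end Key

end DecRank

end

open scoped ComplexOrder TensorProduct ENNReal

noncomputable section

namespace DecRank

/-! ### Quotients, inductive limits and direct sums. -/

section Permanence

open scoped Classical

attribute [local instance 50] CStarAlgebra.spectralOrder CStarAlgebra.spectralOrderedRing

variable {A B : Type*} [NonUnitalCStarAlgebra A] [NonUnitalCStarAlgebra B]

lemma HasApproximateModels.hasModel_of_subset_range {N : ℕ} (h : HasApproximateModels A N)
    (π : A →⋆ₙₐ[ℂ] B) {S : Finset B} (hS : (S : Set B) ⊆ Set.range π) {ε : ℝ} (hε : 0 < ε) :
    HasModel N (S : Set B) ε := by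
  obtain ⟨T, -, rfl⟩ := (Finset.subset_set_image_iff (s := Set.univ) (f := π)).1
    (by rwa [Set.image_univ])
  rw [Finset.coe_image]
  exact (h T ε hε).map π

lemma HasApproximateModels.of_surjective {N : ℕ} (h : HasApproximateModels A N)
    (π : A →⋆ₙₐ[ℂ] B) (hπ : Function.Surjective π) : HasApproximateModels B N :=
  fun _ _ hε => h.hasModel_of_subset_range π (fun b _ => hπ b) hε

lemma decompositionRank_le_of_surjective (π : A →⋆ₙₐ[ℂ] B) (hπ : Function.Surjective π) :
    decompositionRank B ≤ decompositionRank A :=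
  decompositionRank_le_of_forall fun _ hN => (decompositionRank_le_iff.1 hN).of_surjective π hπ

/-- The quotient map as a *-homomorphism. -/
def ClosedIdeal.quotientHom (J : ClosedIdeal A) : A →⋆ₙₐ[ℂ] J.Quotient where
  toFun := J.toQuotient
  map_smul' t x := map_smul J.toQuotient t x
  map_zero' := map_zero _
  map_add' := map_add J.toQuotient
  map_mul' _ _ := rfl
  map_star' _ := rfl

lemma decompositionRank_quotient_le (J : ClosedIdeal A) :
    decompositionRank J.Quotient ≤ decompositionRank A :=
  decompositionRank_le_of_surjective J.quotientHom J.toQuotient_surjective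

/-- The ranges of the μ n increase, so a finite subset of their union lies in all but finitely many
of them. Some later D n has rank at most N, and its models push forward. -/
lemma decompositionRank_le_liminf {D : ℕ → Type*} [∀ n, NonUnitalCStarAlgebra (D n)]
    {σ : ∀ n, D n →⋆ₙₐ[ℂ] D (n + 1)} {μ : ∀ n, D n →⋆ₙₐ[ℂ] A} (h : IsInductiveLimit σ μ) :
    decompositionRank A ≤
      Filter.liminf (fun n => decompositionRank (D n)) Filter.atTop := by
  refine decompositionRank_le_of_forall fun N hN => hasApproximateModels_of_dense h.dense
    fun S ε hS hε => ?_
  have hmono : Monotone fun n => Set.range (μ n) := monotone_nat_of_le_succ fun n => by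
    rintro _ ⟨x, rfl⟩
    exact ⟨σ n x, h.compatible n x⟩
  have h1 : ∃ n₀, (S : Set A) ⊆ Set.range (μ n₀) :=
    hmono.directed_le.exists_mem_subset_of_finset_subset_biUnion hS
  obtain ⟨n₀, hn₀⟩ := h1
  -- A strict bound is needed to extract terms from a liminf; in ℕ∞, being below N + 1 means being
  -- at most N.
  have h2 : ∃ᶠ n in Filter.atTop, decompositionRank (D n) < ((N + 1 : ℕ) : ℕ∞) :=
    Filter.frequently_lt_of_liminf_lt (by isBoundedDefault)
      (hN.trans_lt (by exact_mod_cast Nat.lt_succ_self N))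
  obtain ⟨n, hn, hnN⟩ := Filter.frequently_atTop.1 h2 n₀
  refine (decompositionRank_le_iff.1 ?_).hasModel_of_subset_range (μ n)
    (hn₀.trans (hmono hn)) hε
  rw [Nat.cast_add, Nat.cast_one] at hnN
  exact Order.le_of_lt_add_one hnN

section Sum

variable {ι κ : Type} [Fintype ι] [Fintype κ] {n : ι → Type} [∀ i, Fintype (n i)]
  {m : κ → Type} [∀ i, Fintype (m i)]

instance sumElimFintype : ∀ i, Fintype (Sum.elim n m i) :=
  Sum.rec (fun i => inferInstanceAs (Fintype (n i))) (fun i => inferInstanceAs (Fintype (m i)))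

/-- The projection of a sum of matrix algebras onto the first partial sum. -/
def blocksInl : Blocks (Sum.elim n m) →⋆ₙₐ[ℂ] Blocks n where
  toFun x i := x (Sum.inl i)
  map_smul' _ _ := rfl
  map_zero' := rfl
  map_add' _ _ := rfl
  map_mul' _ _ := rfl
  map_star' _ := rfl

/-- The projection of a sum of matrix algebras onto the second partial sum. -/
def blocksInr : Blocks (Sum.elim n m) →⋆ₙₐ[ℂ] Blocks m where
  toFun x i := x (Sum.inr i)
  map_smul' _ _ := rfl
  map_zero' := rfl
  map_add' _ _ := rfl
  map_mul' _ _ := rfl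
  map_star' _ := rfl

lemma blocksInl_blockIncl_inl (i : ι) (x : CStarMatrix (n i) (n i) ℂ) :
    blocksInl (m := m) (blockIncl (n := Sum.elim n m) (Sum.inl i) x) = blockIncl (n := n) i x := by
  ext1 k
  change blockIncl (n := Sum.elim n m) (Sum.inl i) x (Sum.inl k) = _
  by_cases hk : k = i
  · subst hk
    rw [blockIncl_same]
    exact blockIncl_same (n := Sum.elim n m) (Sum.inl k) x
  · rw [blockIncl_of_ne hk]
    exact blockIncl_of_ne (n := Sum.elim n m) (Sum.inl_injective.ne hk) x

lemma blocksInr_blockIncl_inr (i : κ) (x : CStarMatrix (m i) (m i) ℂ) :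
    blocksInr (n := n) (blockIncl (n := Sum.elim n m) (Sum.inr i) x) = blockIncl (n := m) i x := by
  ext1 k
  change blockIncl (n := Sum.elim n m) (Sum.inr i) x (Sum.inr k) = _
  by_cases hk : k = i
  · subst hk
    rw [blockIncl_same]
    exact blockIncl_same (n := Sum.elim n m) (Sum.inr k) x
  · rw [blockIncl_of_ne hk]
    exact blockIncl_of_ne (n := Sum.elim n m) (Sum.inr_injective.ne hk) x

lemma blocksInl_blockIncl_inr (i : κ) (x : CStarMatrix (m i) (m i) ℂ) :
    blocksInl (n := n) (blockIncl (n := Sum.elim n m) (Sum.inr i) x) = 0 := by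
  ext1 k
  exact blockIncl_of_ne (n := Sum.elim n m) Sum.inl_ne_inr x

lemma blocksInr_blockIncl_inl (i : ι) (x : CStarMatrix (n i) (n i) ℂ) :
    blocksInr (m := m) (blockIncl (n := Sum.elim n m) (Sum.inl i) x) = 0 := by
  ext1 k
  exact blockIncl_of_ne (n := Sum.elim n m) Sum.inr_ne_inl x

/-- The direct sum of two maps on sums of matrix algebras. -/
def blocksSum (φ : Blocks n →ₗ[ℂ] A) (χ : Blocks m →ₗ[ℂ] B) :
    Blocks (Sum.elim n m) →ₗ[ℂ] A × B :=
  (φ ∘ₗ (blocksInl (n := n) (m := m) : Blocks (Sum.elim n m) →ₗ[ℂ] Blocks n)).prod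
    (χ ∘ₗ (blocksInr (n := n) (m := m) : Blocks (Sum.elim n m) →ₗ[ℂ] Blocks m))

/-- The element of a direct sum with the given components. -/
def blocksPair (y : Blocks n) (z : Blocks m) : Blocks (Sum.elim n m) := Sum.rec y z

lemma blocksPair_mul_star (y : Blocks n) (z : Blocks m) :
    blocksPair y z * star (blocksPair y z) = blocksPair (y * star y) (z * star z) := by
  funext i
  cases i <;> rfl

variable {φ : Blocks n →ₗ[ℂ] A} {χ : Blocks m →ₗ[ℂ] B}

lemma blocksSum_blocksPair (y : Blocks n) (z : Blocks m) :
    blocksSum φ χ (blocksPair y z) = (φ y, χ z) := rfl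

lemma isCPC_blocksSum (hφ : IsCPC φ) (hχ : IsCPC χ) : IsCPC (blocksSum φ χ) := by
  have h1 := hφ.comp (isCPC_hom (blocksInl (n := n) (m := m)))
  have h2 := hχ.comp (isCPC_hom (blocksInr (n := n) (m := m)))
  refine ⟨?_, fun x => max_le (h1.2 x) (h2.2 x)⟩
  have e : blocksSum φ χ = (NonUnitalStarAlgHom.inl ℂ A B : A →ₗ[ℂ] A × B) ∘ₗ
      (φ ∘ₗ (blocksInl (n := n) (m := m) : Blocks (Sum.elim n m) →ₗ[ℂ] Blocks n)) +
      (NonUnitalStarAlgHom.inr ℂ A B : B →ₗ[ℂ] A × B) ∘ₗ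
      (χ ∘ₗ (blocksInr (n := n) (m := m) : Blocks (Sum.elim n m) →ₗ[ℂ] Blocks m)) := by
    refine LinearMap.ext fun x => ?_
    exact Prod.ext (add_zero (φ (blocksInl x))).symm (zero_add (χ (blocksInr x))).symm
  rw [e]
  exact ((isCompletelyPositive_hom _).comp h1.1).add ((isCompletelyPositive_hom _).comp h2.1)

lemma orderZeroOn_blocksSum {K : Type*} {c : ι → K} {d : κ → K} (hc : OrderZeroOn c φ)
    (hd : OrderZeroOn d χ) :
    OrderZeroOn (n := Sum.elim n m) (Sum.elim c d) (blocksSum φ χ) := by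
  have h1 : ∀ i x, blockMap (n := Sum.elim n m) (blocksSum φ χ) (Sum.inl i) x =
      (blockMap φ i x, 0) := fun i x => Prod.ext (congrArg φ (blocksInl_blockIncl_inl i x))
    ((congrArg χ (blocksInr_blockIncl_inl i x)).trans (map_zero χ))
  have h2 : ∀ i x, blockMap (n := Sum.elim n m) (blocksSum φ χ) (Sum.inr i) x =
      (0, blockMap χ i x) := fun i x => Prod.ext
    ((congrArg φ (blocksInl_blockIncl_inr i x)).trans (map_zero φ))
    (congrArg χ (blocksInr_blockIncl_inr i x))
  constructor
  · rintro (i | i) x y hxy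
    · rw [h1, h1]
      exact Prod.ext (hc.block i x y hxy) (zero_mul _)
    · rw [h2, h2]
      exact Prod.ext (zero_mul _) (hd.block i x y hxy)
  · rintro (i | i) (j | j) hij hcd x y
    · rw [h1, h1]
      exact Prod.ext (hc.orthogonal i j (fun h => hij (congrArg _ h)) hcd x y) (zero_mul _)
    · rw [h1, h2]
      exact Prod.ext (mul_zero _) (zero_mul _)
    · rw [h1, h2]
      exact Prod.ext (zero_mul _) (mul_zero _)
    · rw [h2, h2]
      exact Prod.ext (zero_mul _) (hd.orthogonal i j (fun h => hij (congrArg _ h)) hcd x y)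

end Sum

/-- Elements of A × 0 and 0 × B are orthogonal, so blocks from different sides may carry the same
colour. This gives a maximum instead of a sum. -/
lemma HasApproximateModels.prod {N : ℕ} (hA : HasApproximateModels A N)
    (hB : HasApproximateModels B N) : HasApproximateModels (A × B) N := by
  intro S ε hε
  obtain ⟨ι, _, n, _, φ, c, hφ, hc, h1⟩ := hA (S.image Prod.fst) ε hε
  obtain ⟨κ, _, m, _, χ, d, hχ, hd, h2⟩ := hB (S.image Prod.snd) ε hε
  refine ⟨ι ⊕ κ, inferInstance, Sum.elim n m, inferInstance, blocksSum φ χ, Sum.elim c d,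
    isCPC_blocksSum hφ hχ, orderZeroOn_blocksSum hc hd, fun b hb => ?_⟩
  obtain ⟨y, hy1, hy2⟩ := h1 b.1 (Finset.mem_image_of_mem _ hb)
  obtain ⟨z, hz1, hz2⟩ := h2 b.2 (Finset.mem_image_of_mem _ hb)
  refine ⟨blocksPair y z, ?_, ?_⟩
  · rw [blocksSum_blocksPair]
    exact max_lt hy1 hz1
  · rw [blocksPair_mul_star, blocksSum_blocksPair]
    exact max_lt hy2 hz2

lemma decompositionRank_prod :
    decompositionRank (A × B) = max (decompositionRank A) (decompositionRank B) := by
  refine le_antisymm (decompositionRank_le_of_forall fun N hN => ?_) (max_le ?_ ?_)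
  · rw [max_le_iff, decompositionRank_le_iff, decompositionRank_le_iff] at hN
    exact hN.1.prod hN.2
  · exact decompositionRank_le_of_surjective (NonUnitalStarAlgHom.fst ℂ A B) Prod.fst_surjective
  · exact decompositionRank_le_of_surjective (NonUnitalStarAlgHom.snd ℂ A B) Prod.snd_surjective

end Permanence

end DecRank

end

open scoped ComplexOrder TensorProduct ENNReal

noncomputable section

namespace DecRank

/-! ### Elementary tensors in the minimal tensor product. -/

section OperatorTensor

variable {H K : Type*} [NormedAddCommGroup H] [InnerProductSpace ℂ H]
    [NormedAddCommGroup K] [InnerProductSpace ℂ K]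

lemma TensorOperators.ext {S T : TensorOperators H K}
    (h : ∀ (x : H) (y : K), S.toFun (x ⊗ₜ y : H ⊗[ℂ] K) = T.toFun (x ⊗ₜ y : H ⊗[ℂ] K)) :
    S = T := by
  refine ContinuousLinearMap.ext (f := S) (g := T) fun z => ?_
  induction z using UniformSpace.Completion.induction_on with
  | hp => exact isClosed_eq S.cont T.cont
  | ih z =>
    induction z using TensorProduct.induction_on with
    | zero =>
      rw [UniformSpace.Completion.coe_zero]
      exact S.map_zero.trans T.map_zero.symm
    | tmul x y => exact h x y
    | add a b ha hb =>
      rw [UniformSpace.Completion.coe_add]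
      exact (S.map_add _ _).trans ((congrArg₂ (· + ·) ha hb).trans (T.map_add _ _).symm)

lemma operatorTensor_apply (S : H →L[ℂ] H) (T : K →L[ℂ] K) (x : H) (y : K) :
    (operatorTensor S T).toFun (x ⊗ₜ y : H ⊗[ℂ] K) = (S x ⊗ₜ T y : H ⊗[ℂ] K) :=
  (ContinuousLinearMap.completion_apply_coe (TensorProduct.mapL S T) _).trans
    (congrArg _ (TensorProduct.mapL_tmul S T x y))

lemma operatorTensor_mul (S S' : H →L[ℂ] H) (T T' : K →L[ℂ] K) :
    operatorTensor S T * operatorTensor S' T' = operatorTensor (S * S') (T * T') := by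
  refine TensorOperators.ext fun x y => ?_
  rw [operatorTensor_apply]
  change (operatorTensor S T).toFun ((operatorTensor S' T').toFun _) = _
  rw [operatorTensor_apply, operatorTensor_apply]
  rfl

lemma operatorTensor_add_left (S S' : H →L[ℂ] H) (T : K →L[ℂ] K) :
    operatorTensor (S + S') T = operatorTensor S T + operatorTensor S' T := by
  refine TensorOperators.ext fun x y => ?_
  change _ = (operatorTensor S T).toFun _ + (operatorTensor S' T).toFun _
  rw [operatorTensor_apply, operatorTensor_apply, operatorTensor_apply,
    _root_.add_apply, TensorProduct.add_tmul, UniformSpace.Completion.coe_add]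

lemma operatorTensor_add_right (S : H →L[ℂ] H) (T T' : K →L[ℂ] K) :
    operatorTensor S (T + T') = operatorTensor S T + operatorTensor S T' := by
  refine TensorOperators.ext fun x y => ?_
  change _ = (operatorTensor S T).toFun _ + (operatorTensor S T').toFun _
  rw [operatorTensor_apply, operatorTensor_apply, operatorTensor_apply,
    _root_.add_apply, TensorProduct.tmul_add, UniformSpace.Completion.coe_add]

lemma operatorTensor_smul_left (c : ℂ) (S : H →L[ℂ] H) (T : K →L[ℂ] K) :
    operatorTensor (c • S) T = c • operatorTensor S T := by
  refine TensorOperators.ext fun x y => ?_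
  change _ = c • (operatorTensor S T).toFun _
  rw [operatorTensor_apply, operatorTensor_apply, _root_.smul_apply,
    ← TensorProduct.smul_tmul', UniformSpace.Completion.coe_smul]

lemma operatorTensor_smul_right (c : ℂ) (S : H →L[ℂ] H) (T : K →L[ℂ] K) :
    operatorTensor S (c • T) = c • operatorTensor S T := by
  refine TensorOperators.ext fun x y => ?_
  change _ = c • (operatorTensor S T).toFun _
  rw [operatorTensor_apply, operatorTensor_apply, _root_.smul_apply,
    TensorProduct.tmul_smul, UniformSpace.Completion.coe_smul]

lemma inner_operatorTensor [CompleteSpace H] [CompleteSpace K] (S : H →L[ℂ] H) (T : K →L[ℂ] K)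
    (x y : H ⊗[ℂ] K) : inner ℂ (TensorProduct.mapL (star S) (star T) x) y =
      inner ℂ x (TensorProduct.mapL S T y) := by
  induction x using TensorProduct.induction_on with
  | zero => rw [map_zero, inner_zero_left, inner_zero_left]
  | add a b ha hb => rw [map_add, inner_add_left, inner_add_left, ha, hb]
  | tmul a b =>
    induction y using TensorProduct.induction_on with
    | zero => rw [map_zero, inner_zero_right, inner_zero_right]
    | add a b ha hb => rw [map_add, inner_add_right, inner_add_right, ha, hb]
    | tmul c d =>
      rw [TensorProduct.mapL_tmul, TensorProduct.mapL_tmul, TensorProduct.inner_tmul,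
        TensorProduct.inner_tmul, ContinuousLinearMap.star_eq_adjoint,
        ContinuousLinearMap.star_eq_adjoint, ContinuousLinearMap.adjoint_inner_left,
        ContinuousLinearMap.adjoint_inner_left]

lemma star_operatorTensor [CompleteSpace H] [CompleteSpace K] (S : H →L[ℂ] H) (T : K →L[ℂ] K) :
    star (operatorTensor S T) = operatorTensor (star S) (star T) := by
  refine ((ContinuousLinearMap.eq_adjoint_iff (𝕜 := ℂ)
    (TensorProduct.mapL (star S) (star T)).completion
    (TensorProduct.mapL S T).completion).2 fun x y => ?_).symm
  induction x using UniformSpace.Completion.induction_on with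
  | hp => exact isClosed_eq (by fun_prop) (by fun_prop)
  | ih x =>
    induction y using UniformSpace.Completion.induction_on with
    | hp => exact isClosed_eq (by fun_prop) (by fun_prop)
    | ih y =>
      rw [ContinuousLinearMap.completion_apply_coe, ContinuousLinearMap.completion_apply_coe,
        UniformSpace.Completion.inner_coe, UniformSpace.Completion.inner_coe, inner_operatorTensor]

end OperatorTensor

section RepTensor

variable {A B I : Type*} [NonUnitalCStarAlgebra A] [NonUnitalCStarAlgebra B]
  {H K : I → Type*} [∀ i, NormedAddCommGroup (H i)] [∀ i, InnerProductSpace ℂ (H i)]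
  [∀ i, CompleteSpace (H i)] [∀ i, NormedAddCommGroup (K i)] [∀ i, InnerProductSpace ℂ (K i)]
  [∀ i, CompleteSpace (K i)] (π : ∀ i, A →⋆ₙₐ[ℂ] (H i →L[ℂ] H i))
  (σ : ∀ i, B →⋆ₙₐ[ℂ] (K i →L[ℂ] K i))

lemma norm_repTensor_le (a : A) (b : B) : ‖repTensor π σ a b‖ ≤ ‖a‖ * ‖b‖ :=
  lp.norm_le_of_forall_le (by positivity) fun i => (norm_operatorTensor_le _ _).trans
    (mul_le_mul (NonUnitalStarAlgHom.norm_apply_le (π i) a)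
      (NonUnitalStarAlgHom.norm_apply_le (σ i) b) (norm_nonneg _) (norm_nonneg _))

lemma repTensor_mul (a a' : A) (b b' : B) :
    repTensor π σ a b * repTensor π σ a' b' = repTensor π σ (a * a') (b * b') := by
  refine Subtype.ext (funext fun i => ?_)
  change operatorTensor (π i a) (σ i b) * operatorTensor (π i a') (σ i b') =
    operatorTensor (π i (a * a')) (σ i (b * b'))
  rw [operatorTensor_mul, map_mul, map_mul]

lemma star_repTensor (a : A) (b : B) :
    star (repTensor π σ a b) = repTensor π σ (star a) (star b) := by
  refine Subtype.ext (funext fun i => ?_)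
  change star (operatorTensor (π i a) (σ i b)) = operatorTensor (π i (star a)) (σ i (star b))
  rw [star_operatorTensor, map_star, map_star]

lemma repTensor_mem (a : A) (b : B) : repTensor π σ a b ∈ repTensorAlgebra π σ :=
  NonUnitalStarSubalgebra.le_topologicalClosure _
    (NonUnitalStarAlgebra.subset_adjoin ℂ _ ⟨(a, b), rfl⟩)

/-- The elementary tensors in `repTensorAlgebra π σ`. -/
def repTmul : A →ₗ[ℂ] B →ₗ[ℂ] repTensorAlgebra π σ :=
  LinearMap.mk₂ ℂ (fun a b => ⟨repTensor π σ a b, repTensor_mem π σ a b⟩)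
    (fun a a' b => Subtype.ext (Subtype.ext (funext fun i => by
      change operatorTensor (π i (a + a')) (σ i b) =
        operatorTensor (π i a) (σ i b) + operatorTensor (π i a') (σ i b)
      rw [map_add, operatorTensor_add_left])))
    (fun c a b => Subtype.ext (Subtype.ext (funext fun i => by
      change operatorTensor (π i (c • a)) (σ i b) = c • operatorTensor (π i a) (σ i b)
      rw [map_smul, operatorTensor_smul_left])))
    (fun a b b' => Subtype.ext (Subtype.ext (funext fun i => by
      change operatorTensor (π i a) (σ i (b + b')) =
        operatorTensor (π i a) (σ i b) + operatorTensor (π i a) (σ i b')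
      rw [map_add, operatorTensor_add_right])))
    (fun c a b => Subtype.ext (Subtype.ext (funext fun i => by
      change operatorTensor (π i a) (σ i (c • b)) = c • operatorTensor (π i a) (σ i b)
      rw [map_smul, operatorTensor_smul_right])))

/-- Elementary tensors are closed under products and adjoints, so the *-algebra that they generate
is their linear span. -/
lemma dense_span_repTmul :
    Dense (Submodule.span ℂ (Set.range fun p : A × B => repTmul π σ p.1 p.2) :
      Set (repTensorAlgebra π σ)) := by
  have h1 : ((NonUnitalStarAlgebra.adjoin ℂ
      (Set.range fun p : A × B => repTensor π σ p.1 p.2)).toSubmodule) =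
      Submodule.span ℂ (Set.range fun p : A × B => repTensor π σ p.1 p.2) := by
    rw [NonUnitalStarAlgebra.adjoin_eq_span]
    congr 1
    have h2 : (Set.range fun p : A × B => repTensor π σ p.1 p.2) ∪
        star (Set.range fun p : A × B => repTensor π σ p.1 p.2) =
        Set.range fun p : A × B => repTensor π σ p.1 p.2 := by
      refine Set.union_eq_left.2 fun x hx => ?_
      obtain ⟨p, hp⟩ := hx
      refine ⟨(star p.1, star p.2), ?_⟩
      rw [← star_star x, ← hp]
      exact (star_repTensor π σ p.1 p.2).symm
    let M : Subsemigroup (lp (fun i => TensorOperators (H i) (K i)) ∞) :=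
      ⟨Set.range fun p : A × B => repTensor π σ p.1 p.2, by
        rintro _ _ ⟨p, rfl⟩ ⟨q, rfl⟩
        exact ⟨(p.1 * q.1, p.2 * q.2), (repTensor_mul π σ p.1 q.1 p.2 q.2).symm⟩⟩
    rw [h2]
    exact congrArg _ (Subsemigroup.closure_eq M)
  intro x
  rw [Metric.mem_closure_iff]
  intro ε hε
  obtain ⟨y, hy, hxy⟩ := Metric.mem_closure_iff.1 x.2 ε hε
  have hy2 : y ∈ (NonUnitalStarAlgebra.adjoin ℂ
      (Set.range fun p : A × B => repTensor π σ p.1 p.2)).toSubmodule := hy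
  rw [h1] at hy2
  let ι : repTensorAlgebra π σ →ₗ[ℂ] lp (fun i => TensorOperators (H i) (K i)) ∞ :=
    (repTensorAlgebra π σ).toSubmodule.subtype
  have hy3 : y ∈ (Submodule.span ℂ (Set.range fun p : A × B => repTmul π σ p.1 p.2)).map ι := by
    rw [Submodule.map_span, ← Set.range_comp]
    exact hy2
  obtain ⟨z, hz, rfl⟩ := hy3
  exact ⟨z, hz, hxy⟩

end RepTensor

section MinTensor

attribute [local instance 50] CStarAlgebra.spectralOrder CStarAlgebra.spectralOrderedRing

variable {A B : Type*} [NonUnitalCStarAlgebra A] [NonUnitalCStarAlgebra B]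

/-- The elementary tensors in the minimal tensor product. -/
def MinTensor.tmul : A →ₗ[ℂ] B →ₗ[ℂ] MinTensor A B :=
  repTmul (I := (A →ₚ[ℂ] ℂ) × (B →ₚ[ℂ] ℂ))
    (fun p => p.1.gnsNonUnitalStarAlgHom) (fun p => p.2.gnsNonUnitalStarAlgHom)

namespace MinTensor

lemma norm_tmul_le (a : A) (b : B) : ‖tmul a b‖ ≤ ‖a‖ * ‖b‖ :=
  norm_repTensor_le (I := (A →ₚ[ℂ] ℂ) × (B →ₚ[ℂ] ℂ)) _ _ a b

lemma tmul_mul (a a' : A) (b b' : B) : tmul a b * tmul a' b' = tmul (a * a') (b * b') :=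
  Subtype.ext (repTensor_mul (I := (A →ₚ[ℂ] ℂ) × (B →ₚ[ℂ] ℂ)) _ _ a a' b b')

lemma star_tmul (a : A) (b : B) : star (tmul a b) = tmul (star a) (star b) :=
  Subtype.ext (star_repTensor (I := (A →ₚ[ℂ] ℂ) × (B →ₚ[ℂ] ℂ)) _ _ a b)

lemma dense_span_tmul :
    Dense (Submodule.span ℂ (Set.range fun p : A × B => tmul p.1 p.2) : Set (MinTensor A B)) :=
  dense_span_repTmul (I := (A →ₚ[ℂ] ℂ) × (B →ₚ[ℂ] ℂ)) _ _

lemma norm_tmul_sub_le (a a' : A) (b b' : B) :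
    ‖tmul a b - tmul a' b'‖ ≤ ‖a - a'‖ * ‖b‖ + ‖a'‖ * ‖b - b'‖ := by
  have : tmul a b - tmul a' b' = tmul (a - a') b + tmul a' (b - b') := by
    rw [map_sub, map_sub, LinearMap.sub_apply]
    abel
  rw [this]
  exact (norm_add_le _ _).trans (add_le_add (norm_tmul_le _ _) (norm_tmul_le _ _))

end MinTensor

end MinTensor

end DecRank

end

open scoped ComplexOrder TensorProduct ENNReal

noncomputable section

namespace DecRank

/-! ### Models for a set with dense linear span suffice. -/

section Span

open scoped Classical

attribute [local instance 50] CStarAlgebra.spectralOrder CStarAlgebra.spectralOrderedRing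

variable {B : Type*} [NonUnitalCStarAlgebra B]

/-- The elements of a model almost multiply. -/
lemma IsCPC.norm_map_mul_star_sub_mul_star_le {F : Type*} [NonUnitalCStarAlgebra F]
    {φ : F →ₗ[ℂ] B} (hφ : IsCPC φ) {y z : F} {b d : B} {η C : ℝ} (hη1 : η ≤ 1) (hb : ‖b‖ ≤ C)
    (hd : ‖d‖ ≤ C) (h1 : ‖φ y - b‖ ≤ η) (h2 : ‖φ (y * star y) - b * star b‖ ≤ η)
    (h3 : ‖φ z - d‖ ≤ η) (h4 : ‖φ (z * star z) - d * star d‖ ≤ η) :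
    ‖φ (y * star z) - b * star d‖ ≤ η * (10 * C + 9) := by
  have hη0 : 0 ≤ η := (norm_nonneg _).trans h1
  have hC0 : 0 ≤ C := (norm_nonneg _).trans hb
  have e1 := hφ.norm_mulDefect_le (star y) (star z)
  have e2 := hφ.norm_map_mul_star_sub_le hη1 hb h1 h2
  have e3 := hφ.norm_map_mul_star_sub_le hη1 hd h3 h4
  rw [mulDefect_apply, hφ.1.map_star, hφ.1.map_star, star_star, star_star] at e1
  have e4 : φ y * star (φ z) - b * star d = (φ y - b) * star (φ z) + b * star (φ z - d) := by
    rw [star_sub]; noncomm_ring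
  have n1 := norm_mul_le (φ y - b) (star (φ z))
  have n2 := norm_mul_le b (star (φ z - d))
  rw [norm_star] at n1 n2
  have n0 : ‖φ z‖ ≤ C + 1 := by
    have := norm_sub_norm_le (φ z) d
    linarith
  have n3 : ‖φ y - b‖ * ‖φ z‖ ≤ η * (C + 1) := mul_le_mul h1 n0 (norm_nonneg _) hη0
  have n4 : ‖b‖ * ‖φ z - d‖ ≤ C * η := mul_le_mul hb h3 (norm_nonneg _) hC0
  have n5 : ‖φ y * star (φ z) - b * star d‖ ≤ η * (2 * C + 1) := by
    rw [e4]
    refine (norm_add_le _ _).trans ?_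
    linarith
  -- 2 · 2(2C + 2) comes from polarizing the two diagonal defects, and 2C + 1 from comparing φ(y)
  -- φ(z)* with b d*.
  have := norm_sub_le_norm_sub_add_norm_sub (φ (y * star z)) (φ y * star (φ z)) (b * star d)
  linarith

/-- It suffices to find models for the finite subsets of a set with dense linear span. -/
lemma hasApproximateModels_of_span {N : ℕ} {X : Set B}
    (hX : Dense (Submodule.span ℂ X : Set B))
    (h : ∀ (S : Finset B) (ε : ℝ), (S : Set B) ⊆ X → 0 < ε → HasModel N (S : Set B) ε) :
    HasApproximateModels B N := by
  refine hasApproximateModels_of_dense hX fun S ε hS hε => ?_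
  have h0 : ∀ b : S, ∃ (T : Finset B) (f : B → ℂ), (T : Set B) ⊆ X ∧ ∑ x ∈ T, f x • x = b := by
    intro b
    obtain ⟨f, T, hT, -, hf⟩ := Submodule.mem_span_iff_exists_finset_subset.1 (hS b.2)
    exact ⟨T, f, hT, hf⟩
  choose T f hT hf using h0
  let U : Finset B := Finset.univ.biUnion T
  have hU : (U : Set B) ⊆ X := by
    intro x hx
    obtain ⟨b, -, hb⟩ := Finset.mem_biUnion.1 hx
    exact hT b hb
  obtain ⟨C, hC0, hC⟩ : ∃ C : ℝ, 0 ≤ C ∧ ∀ b ∈ U, ‖b‖ ≤ C :=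
    ⟨∑ b ∈ U, ‖b‖, Finset.sum_nonneg fun _ _ => norm_nonneg _, fun b hb =>
      Finset.single_le_sum (f := fun b => ‖b‖) (fun _ _ => norm_nonneg _) hb⟩
  let L : S → ℝ := fun b => ∑ x ∈ T b, ‖f b x‖
  have hL0 : ∀ b, 0 ≤ L b := fun b => Finset.sum_nonneg fun _ _ => norm_nonneg _
  let M : ℝ := ∑ b : S, L b
  have hM0 : 0 ≤ M := Finset.sum_nonneg fun b _ => hL0 b
  have hLM : ∀ b, L b ≤ M := fun b =>
    Finset.single_le_sum (f := L) (fun b _ => hL0 b) (Finset.mem_univ b)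
  -- 10C + 9 is the cost of a mixed product; (M + 1)² dominates the double sum of the coefficients.
  obtain ⟨η, hη0, hη1, hη⟩ : ∃ η : ℝ, 0 < η ∧ η ≤ 1 ∧ η * ((10 * C + 9) * (M + 1) ^ 2) < ε := by
    refine ⟨min 1 (ε / 2 / ((10 * C + 9) * (M + 1) ^ 2)), by positivity, min_le_left _ _, ?_⟩
    refine lt_of_le_of_lt ?_ (half_lt_self hε)
    rw [← le_div_iff₀ (by positivity)]
    exact min_le_right _ _
  obtain ⟨ι, _, n, _, φ, c, hφ, hc, hY⟩ := h U η hU hη0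
  have hY2 : ∀ x : B, ∃ y, x ∈ U → ‖φ y - x‖ < η ∧ ‖φ (y * star y) - x * star x‖ < η := by
    intro x
    by_cases hx : x ∈ U
    · obtain ⟨y, hy⟩ := hY x hx
      exact ⟨y, fun _ => hy⟩
    · exact ⟨0, fun h => absurd h hx⟩
  choose Y hY using hY2
  refine ⟨ι, _, n, _, φ, c, hφ, hc, fun b' hb' => ?_⟩
  let b : S := ⟨b', hb'⟩
  have hTU : ∀ x ∈ T b, x ∈ U := fun x hx => Finset.mem_biUnion.2 ⟨b, Finset.mem_univ _, hx⟩
  have hbf : b' = ∑ x ∈ T b, f b x • x := (hf b).symm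
  have hLb := hLM b
  have hLb0 := hL0 b
  refine ⟨∑ x ∈ T b, f b x • Y x, ?_, ?_⟩
  · rw [hbf, map_sum, ← Finset.sum_sub_distrib]
    have : ‖∑ x ∈ T b, (φ (f b x • Y x) - f b x • x)‖ ≤ ∑ x ∈ T b, ‖f b x‖ * η := by
      refine norm_sum_le_of_le _ fun x hx => ?_
      rw [map_smul, ← smul_sub, norm_smul]
      exact mul_le_mul_of_nonneg_left (hY x (hTU x hx)).1.le (norm_nonneg _)
    rw [← Finset.sum_mul] at this
    change _ ≤ L b * η at this
    refine (this.trans ?_).trans_lt hη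
    rw [mul_comm]
    refine mul_le_mul_of_nonneg_left ?_ hη0.le
    nlinarith [mul_nonneg hC0 (sq_nonneg (M + 1))]
  -- Squaring a linear combination produces mixed products y z*. The models only mention y y*, but
  -- almost multiplicativity covers the mixed ones.
  · have e1 : φ ((∑ x ∈ T b, f b x • Y x) * star (∑ x ∈ T b, f b x • Y x)) - b' * star b' =
        ∑ x ∈ T b, ∑ x' ∈ T b, (f b x * star (f b x')) •
          (φ (Y x * star (Y x')) - x * star x') := by
      rw [hbf]
      simp only [star_sum, star_smul, Finset.sum_mul_sum, map_sum, smul_mul_smul_comm, map_smul,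
        smul_sub, Finset.sum_sub_distrib]
    rw [e1]
    have : ‖∑ x ∈ T b, ∑ x' ∈ T b, (f b x * star (f b x')) •
          (φ (Y x * star (Y x')) - x * star x')‖ ≤
        ∑ x ∈ T b, ∑ x' ∈ T b, ‖f b x‖ * ‖f b x'‖ * (η * (10 * C + 9)) := by
      refine norm_sum_le_of_le _ fun x hx => norm_sum_le_of_le _ fun x' hx' => ?_
      rw [norm_smul, norm_mul, norm_star]
      refine mul_le_mul_of_nonneg_left ?_ (by positivity)
      have i1 := hY x (hTU x hx)
      have i2 := hY x' (hTU x' hx')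
      exact hφ.norm_map_mul_star_sub_mul_star_le hη1 (hC x (hTU x hx)) (hC x' (hTU x' hx'))
        i1.1.le i1.2.le i2.1.le i2.2.le
    simp only [← Finset.sum_mul, ← Finset.mul_sum] at this
    change _ ≤ L b * L b * _ at this
    refine (this.trans ?_).trans_lt hη
    have : L b * L b ≤ (M + 1) ^ 2 := by nlinarith
    have h9 : 0 ≤ η * (10 * C + 9) := by positivity
    nlinarith [mul_le_mul_of_nonneg_right this h9]

end Span

/-! ### Tensor products of models. -/

section TensorMap

open scoped Classical

attribute [local instance 50] CStarAlgebra.spectralOrder CStarAlgebra.spectralOrderedRing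

variable {A B : Type*} [NonUnitalCStarAlgebra A] [NonUnitalCStarAlgebra B]
  {n m : Type} [Fintype n] [Fintype m]

/-- The Choi matrix: e_ab = e_oa* e_ob, so the matrix units form the Gram matrix of one row. -/
lemma IsCompletelyPositive.exists_choi {φ : CStarMatrix n n ℂ →ₗ[ℂ] A}
    (hφ : IsCompletelyPositive φ) :
    ∃ w : n → n → A, ∀ a b, φ (matUnit a b) = ∑ l, star (w l a) * w l b := by
  rcases isEmpty_or_nonempty n with hn | ⟨⟨o⟩⟩
  · exact ⟨fun _ _ => 0, fun a => hn.elim a⟩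
  · obtain ⟨w, hw⟩ := hφ.exists_gram (ι := n) (κ := Fin 1) fun _ a => matUnit o a
    refine ⟨w, fun a b => ?_⟩
    rw [← hw]
    simp [star_matUnit, matUnit_mul_same]

/-- Expanding x* y in matrix units gives φ(x* y) = ∑ T(x)* T(y), where T_{l,r}(x) = ∑_a x_{ra}
w_{la}. -/
lemma isCompletelyPositive_of_choi {φ : CStarMatrix n n ℂ →ₗ[ℂ] A} {L : Type} [Fintype L]
    (w : L → n → A) (h : ∀ a b, φ (matUnit a b) = ∑ l, star (w l a) * w l b) :
    IsCompletelyPositive φ := by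
  refine .of_forall_star_mul (κ := L × n) (fun c x => ∑ a, x c.2 a • w c.1 a) fun x y => ?_
  conv_lhs => rw [sum_smul_matUnit (star x * y)]
  simp only [map_sum, map_smul, h, CStarMatrix.mul_apply, CStarMatrix.star_apply,
    Fintype.sum_prod_type, star_sum, star_smul, Finset.sum_mul_sum, smul_mul_smul_comm,
    Finset.sum_smul, Finset.smul_sum]
  rw [Finset.sum_comm_cycle]
  conv_lhs => enter [2, r]; rw [Finset.sum_comm_cycle]
  exact Finset.sum_comm

/-- The tensor product of two maps on matrix algebras. -/
def tensorMap (φ : CStarMatrix n n ℂ →ₗ[ℂ] A) (χ : CStarMatrix m m ℂ →ₗ[ℂ] B) :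
    CStarMatrix (n × m) (n × m) ℂ →ₗ[ℂ] MinTensor A B where
  toFun x := ∑ p, ∑ q, x p q • MinTensor.tmul (φ (matUnit p.1 q.1)) (χ (matUnit p.2 q.2))
  map_add' x y := by simp only [CStarMatrix.add_apply, add_smul, Finset.sum_add_distrib]
  map_smul' t x := by
    simp only [CStarMatrix.smul_apply, smul_assoc, Finset.smul_sum, RingHom.id_apply]

variable {φ : CStarMatrix n n ℂ →ₗ[ℂ] A} {χ : CStarMatrix m m ℂ →ₗ[ℂ] B}

lemma tensorMap_apply (x : CStarMatrix (n × m) (n × m) ℂ) : tensorMap φ χ x =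
    ∑ p, ∑ q, x p q • MinTensor.tmul (φ (matUnit p.1 q.1)) (χ (matUnit p.2 q.2)) := rfl

lemma matUnit_apply (a b c d : n) : matUnit a b c d = if a = c ∧ b = d then 1 else 0 :=
  Matrix.single_apply ..

lemma tensorMap_matUnit (p q : n × m) : tensorMap φ χ (matUnit p q) =
    MinTensor.tmul (φ (matUnit p.1 q.1)) (χ (matUnit p.2 q.2)) := by
  rw [tensorMap_apply, Finset.sum_eq_single p, Finset.sum_eq_single q]
  · rw [matUnit_apply, if_pos ⟨rfl, rfl⟩, one_smul]
  · intro q' _ h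
    rw [matUnit_apply, if_neg (fun h' => h h'.2.symm), zero_smul]
  · simp
  · intro p' _ h
    refine Finset.sum_eq_zero fun q' _ => ?_
    rw [matUnit_apply, if_neg (fun h' => h h'.1.symm), zero_smul]
  · simp

/-- The Choi matrix of the tensor product is the tensor product of two Gram matrices, which is the
Gram matrix of the elementary tensors. Only matrix algebras occur on the left, so no general theorem
on tensor products of completely positive maps is required. -/
lemma isCompletelyPositive_tensorMap (hφ : IsCompletelyPositive φ) (hχ : IsCompletelyPositive χ) :
    IsCompletelyPositive (tensorMap φ χ) := by
  obtain ⟨w, hw⟩ := hφ.exists_choi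
  obtain ⟨v, hv⟩ := hχ.exists_choi
  refine isCompletelyPositive_of_choi (L := n × m)
    (fun l p => MinTensor.tmul (w l.1 p.1) (v l.2 p.2)) fun p q => ?_
  rw [tensorMap_matUnit, hw, hv, Fintype.sum_prod_type]
  simp only [map_sum, LinearMap.sum_apply, MinTensor.star_tmul, MinTensor.tmul_mul]
  rw [Finset.sum_comm]

lemma preservesZeroProducts_tensorMap (hφ : PreservesZeroProducts φ)
    (hχ : PreservesZeroProducts χ) : PreservesZeroProducts (tensorMap φ χ) := by
  refine preservesZeroProducts_of_matUnit (fun a b c d h => ?_) fun a b b' d => ?_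
  · rw [tensorMap_matUnit, tensorMap_matUnit, MinTensor.tmul_mul]
    by_cases h1 : b.1 = c.1
    · have h2 : b.2 ≠ c.2 := fun h2 => h (Prod.ext h1 h2)
      rw [hχ _ _ (matUnit_mul_of_ne h2), map_zero]
    · rw [hφ _ _ (matUnit_mul_of_ne h1), map_zero, LinearMap.zero_apply]
  · simp only [tensorMap_matUnit, MinTensor.tmul_mul]
    rw [hφ.mul_indep a.1 b.1 b'.1 d.1, hχ.mul_indep a.2 b.2 b'.2 d.2]

/-- The Kronecker product. -/
def kron (x : CStarMatrix n n ℂ) (y : CStarMatrix m m ℂ) : CStarMatrix (n × m) (n × m) ℂ :=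
  CStarMatrix.ofMatrix fun p q => x p.1 q.1 * y p.2 q.2

lemma kron_apply (x : CStarMatrix n n ℂ) (y : CStarMatrix m m ℂ) (p q : n × m) :
    kron x y p q = x p.1 q.1 * y p.2 q.2 := rfl

lemma tensorMap_kron (x : CStarMatrix n n ℂ) (y : CStarMatrix m m ℂ) :
    tensorMap φ χ (kron x y) = MinTensor.tmul (φ x) (χ y) := by
  conv_rhs => rw [sum_smul_matUnit x, sum_smul_matUnit y]
  simp only [tensorMap_apply, Fintype.sum_prod_type, map_sum, map_smul, LinearMap.sum_apply,
    LinearMap.smul_apply, kron_apply, smul_smul, Finset.smul_sum]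
  rw [Finset.sum_comm]
  refine Finset.sum_congr rfl fun c _ => ?_
  rw [Finset.sum_comm_cycle]
  simp only [mul_comm]

lemma kron_mul_star (x : CStarMatrix n n ℂ) (y : CStarMatrix m m ℂ) :
    kron x y * star (kron x y) = kron (x * star x) (y * star y) := by
  ext p q
  simp only [CStarMatrix.mul_apply, CStarMatrix.star_apply, kron_apply, star_mul',
    Fintype.sum_prod_type, Finset.sum_mul_sum]
  refine Finset.sum_congr rfl fun a _ => Finset.sum_congr rfl fun b _ => ?_
  ring

lemma kron_one : kron (1 : CStarMatrix n n ℂ) (1 : CStarMatrix m m ℂ) = 1 := by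
  ext p q
  rw [kron_apply]
  simp only [CStarMatrix.one_apply, Prod.ext_iff]
  split_ifs <;> simp_all

section BlockTensor

variable {ι κ : Type} [Fintype ι] [Fintype κ] {p : ι → Type} [∀ i, Fintype (p i)]
  {q : κ → Type} [∀ i, Fintype (q i)]

/-- The tensor product of two maps on sums of matrix algebras. -/
def blocksTensor (φ : Blocks p →ₗ[ℂ] A) (χ : Blocks q →ₗ[ℂ] B) :
    Blocks (fun s : ι × κ => p s.1 × q s.2) →ₗ[ℂ] MinTensor A B :=
  ∑ s : ι × κ, tensorMap (blockMap φ s.1) (blockMap χ s.2) ∘ₗ LinearMap.proj s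

variable {φ : Blocks p →ₗ[ℂ] A} {χ : Blocks q →ₗ[ℂ] B}

lemma blocksTensor_apply (x : Blocks (fun s : ι × κ => p s.1 × q s.2)) :
    blocksTensor φ χ x = ∑ s : ι × κ, tensorMap (blockMap φ s.1) (blockMap χ s.2) (x s) := by
  rw [blocksTensor, LinearMap.sum_apply]
  rfl

lemma blockMap_blocksTensor (s : ι × κ) :
    blockMap (n := fun s : ι × κ => p s.1 × q s.2) (blocksTensor φ χ) s =
      tensorMap (blockMap φ s.1) (blockMap χ s.2) := by
  refine LinearMap.ext fun x => ?_
  rw [blockMap_apply, blocksTensor_apply, Finset.sum_eq_single s]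
  · exact congrArg _ (blockIncl_same (n := fun s : ι × κ => p s.1 × q s.2) s x)
  · intro t _ ht
    exact (congrArg _ (blockIncl_of_ne (n := fun s : ι × κ => p s.1 × q s.2) ht x)).trans
      (map_zero _)
  · simp

/-- The projection onto a summand. -/
def blockProj (i : ι) : Blocks p →⋆ₙₐ[ℂ] CStarMatrix (p i) (p i) ℂ where
  toFun x := x i
  map_smul' _ _ := rfl
  map_zero' := rfl
  map_add' _ _ := rfl
  map_mul' _ _ := rfl
  map_star' _ := rfl

lemma isCompletelyPositive_blocksTensor (hφ : IsCompletelyPositive φ)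
    (hχ : IsCompletelyPositive χ) : IsCompletelyPositive (blocksTensor φ χ) :=
  .sum _ fun s => (isCompletelyPositive_tensorMap (hφ.blockMap s.1) (hχ.blockMap s.2)).comp
    (isCompletelyPositive_hom (A := Blocks (fun s : ι × κ => p s.1 × q s.2))
      (blockProj (p := fun s : ι × κ => p s.1 × q s.2) s))

lemma blocksTensor_kron (x : Blocks p) (y : Blocks q) :
    blocksTensor φ χ (fun s => kron (x s.1) (y s.2)) = MinTensor.tmul (φ x) (χ y) := by
  rw [blocksTensor_apply, map_eq_sum_blockMap φ x, map_eq_sum_blockMap χ y, Fintype.sum_prod_type]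
  simp only [tensorMap_kron, map_sum, LinearMap.sum_apply]
  rw [Finset.sum_comm]

lemma norm_blocks_one_le : ‖(1 : Blocks p)‖ ≤ 1 := by
  have h := CStarRing.norm_star_mul_self (x := (1 : Blocks p))
  rw [star_one, one_mul] at h
  by_contra! h1
  nlinarith

/-- The norm of a completely positive map is attained at the unit, and the unit is the elementary
tensor 1 ⊗ 1. -/
lemma isCPC_blocksTensor (hφ : IsCPC φ) (hχ : IsCPC χ) : IsCPC (blocksTensor φ χ) := by
  have h := isCompletelyPositive_blocksTensor hφ.1 hχ.1
  refine ⟨h, fun x => ?_⟩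
  refine (h.norm_map_le (star_one _) one_mul x).trans (mul_le_of_le_one_left (norm_nonneg x) ?_)
  have h1 : (1 : Blocks (fun s : ι × κ => p s.1 × q s.2)) =
      fun s : ι × κ => kron ((1 : Blocks p) s.1) ((1 : Blocks q) s.2) := by
    ext1 s
    exact kron_one.symm
  rw [h1, blocksTensor_kron]
  exact (MinTensor.norm_tmul_le _ _).trans (mul_le_one₀ ((hφ.2 _).trans norm_blocks_one_le)
    (norm_nonneg _) ((hχ.2 _).trans norm_blocks_one_le))

lemma tensorMap_mul_tensorMap {n m n' m' : Type} [Fintype n] [Fintype m] [Fintype n'] [Fintype m']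
    {φ : CStarMatrix n n ℂ →ₗ[ℂ] A} {χ : CStarMatrix m m ℂ →ₗ[ℂ] B}
    {φ' : CStarMatrix n' n' ℂ →ₗ[ℂ] A} {χ' : CStarMatrix m' m' ℂ →ₗ[ℂ] B}
    (h : (∀ x y, φ x * φ' y = 0) ∨ (∀ x y, χ x * χ' y = 0))
    (x : CStarMatrix (n × m) (n × m) ℂ) (y : CStarMatrix (n' × m') (n' × m') ℂ) :
    tensorMap φ χ x * tensorMap φ' χ' y = 0 := by
  rw [tensorMap_apply, tensorMap_apply]
  simp only [Finset.sum_mul_sum, smul_mul_smul_comm, MinTensor.tmul_mul]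
  refine Finset.sum_eq_zero fun _ _ => Finset.sum_eq_zero fun _ _ => Finset.sum_eq_zero fun _ _ =>
    Finset.sum_eq_zero fun _ _ => ?_
  rcases h with h | h
  · rw [h, map_zero, LinearMap.zero_apply, smul_zero]
  · rw [h, map_zero, smul_zero]

/-- Two distinct blocks with the same pair of colours differ in one coordinate, where they have the
same colour; the images under that factor are orthogonal. -/
lemma OrderZeroOn.blocksTensor {K L : Type*} {c : ι → K} {d : κ → L} (hc : OrderZeroOn c φ)
    (hd : OrderZeroOn d χ) : OrderZeroOn (n := fun s : ι × κ => p s.1 × q s.2)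
      (fun s : ι × κ => (c s.1, d s.2)) (DecRank.blocksTensor φ χ) := by
  constructor
  · intro s
    rw [blockMap_blocksTensor]
    exact preservesZeroProducts_tensorMap (hc.block _) (hd.block _)
  · intro s t hst h x y
    rw [blockMap_blocksTensor, blockMap_blocksTensor]
    refine tensorMap_mul_tensorMap ?_ x y
    by_cases h1 : s.1 = t.1
    · exact .inr (hd.orthogonal _ _ (fun h2 => hst (Prod.ext h1 h2)) (congrArg Prod.snd h))
    · exact .inl (hc.orthogonal _ _ h1 (congrArg Prod.fst h))

end BlockTensor

lemma OrderZeroOn.recolour {ι : Type} [Fintype ι] {p : ι → Type} [∀ i, Fintype (p i)]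
    {φ : Blocks p →ₗ[ℂ] A} {K L : Type*} {c : ι → K} (hc : OrderZeroOn c φ) {f : K → L}
    (hf : Function.Injective f) : OrderZeroOn (f ∘ c) φ :=
  ⟨hc.block, fun i j hij h => hc.orthogonal i j hij (hf h)⟩

/-- For an elementary tensor the Kronecker product of the two approximants works, because (y ⊗ z)(y
⊗ z)* = y y* ⊗ z z* is again elementary. -/
lemma HasApproximateModels.minTensor {M N : ℕ} (hA : HasApproximateModels A M)
    (hB : HasApproximateModels B N) :
    HasApproximateModels (MinTensor A B) ((M + 1) * (N + 1) - 1) := by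
  refine hasApproximateModels_of_span MinTensor.dense_span_tmul fun S ε hS hε => ?_
  obtain ⟨T, -, rfl⟩ := (Finset.subset_set_image_iff (s := Set.univ)
    (f := fun p : A × B => MinTensor.tmul p.1 p.2)).1 (by rwa [Set.image_univ])
  obtain ⟨C, hC0, hC⟩ : ∃ C : ℝ, 0 ≤ C ∧ ∀ b ∈ T, ‖b‖ ≤ C :=
    ⟨∑ b ∈ T, ‖b‖, Finset.sum_nonneg fun _ _ => norm_nonneg _, fun b hb =>
      Finset.single_le_sum (f := fun b => ‖b‖) (fun _ _ => norm_nonneg _) hb⟩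
  have hC1 : ∀ b ∈ T, ‖b.1‖ ≤ C := fun b hb => (norm_fst_le b).trans (hC b hb)
  have hC2 : ∀ b ∈ T, ‖b.2‖ ≤ C := fun b hb => (norm_snd_le b).trans (hC b hb)
  obtain ⟨η, hη0, hη1, hη⟩ : ∃ η : ℝ, 0 < η ∧ η ≤ 1 ∧ η * (2 * (C + 1) ^ 2) < ε := by
    refine ⟨min 1 (ε / 2 / (2 * (C + 1) ^ 2)), by positivity, min_le_left _ _, ?_⟩
    refine lt_of_le_of_lt ?_ (half_lt_self hε)
    rw [← le_div_iff₀ (by positivity)]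
    exact min_le_right _ _
  obtain ⟨ι, _, p, _, φ, c, hφ, hc, h1⟩ := hA (T.image Prod.fst) η hη0
  obtain ⟨κ, _, q, _, χ, d, hχ, hd, h2⟩ := hB (T.image Prod.snd) η hη0
  -- N-decomposability uses N + 1 colours, hence the − 1 in the rank and the + 1 in the number of
  -- colours.
  let e : Fin (M + 1) × Fin (N + 1) → Fin ((M + 1) * (N + 1) - 1 + 1) := fun s =>
    Fin.cast (by rw [Nat.sub_add_cancel (Nat.mul_pos M.succ_pos N.succ_pos)])
      (finProdFinEquiv s)
  have he : Function.Injective e :=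
    (Fin.cast_injective _).comp finProdFinEquiv.injective
  refine ⟨ι × κ, inferInstance, fun s => p s.1 × q s.2, inferInstance, blocksTensor φ χ,
    e ∘ fun s => (c s.1, d s.2), isCPC_blocksTensor hφ hχ, (hc.blocksTensor hd).recolour he, ?_⟩
  intro t ht
  obtain ⟨b, hb, rfl⟩ := Finset.mem_image.1 ht
  obtain ⟨y, hy1, hy2⟩ := h1 b.1 (Finset.mem_image_of_mem _ hb)
  obtain ⟨z, hz1, hz2⟩ := h2 b.2 (Finset.mem_image_of_mem _ hb)
  -- (C + 1)² − 1 dominates both C and C², so that this serves for the elements and for their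
  -- squares.
  have key : ∀ (a a' : A) (b b' : B), ‖a - a'‖ < η → ‖b - b'‖ < η → ‖a'‖ ≤ (C + 1) ^ 2 - 1 →
      ‖b'‖ ≤ (C + 1) ^ 2 - 1 → ‖MinTensor.tmul a b - MinTensor.tmul a' b'‖ < ε := by
    intro a a' b b' h1 h2 h3 h4
    refine ((MinTensor.norm_tmul_sub_le a a' b b').trans ?_).trans_lt hη
    have h5 : ‖b‖ ≤ (C + 1) ^ 2 := by
      have := norm_sub_norm_le b b'
      linarith
    have h6 := mul_le_mul h1.le h5 (norm_nonneg _) hη0.le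
    have h7 := mul_le_mul h3 h2.le (norm_nonneg _) ((norm_nonneg _).trans h3)
    linarith
  refine ⟨fun s : ι × κ => kron (y s.1) (z s.2), ?_, ?_⟩
  · rw [blocksTensor_kron]
    exact key _ _ _ _ hy1 hz1 (by nlinarith [hC1 b hb]) (by nlinarith [hC2 b hb])
  · have e1 : (fun s : ι × κ => kron (y s.1) (z s.2) : Blocks (fun s : ι × κ => p s.1 × q s.2)) *
        star (fun s : ι × κ => kron (y s.1) (z s.2)) =
        fun s : ι × κ => kron ((y * star y) s.1) ((z * star z) s.2) := by
      ext1 s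
      exact kron_mul_star _ _
    rw [e1, blocksTensor_kron, MinTensor.star_tmul, MinTensor.tmul_mul]
    refine key _ _ _ _ hy2 hz2 ?_ ?_
    · rw [CStarRing.norm_self_mul_star]
      nlinarith [norm_nonneg b.1, hC1 b hb]
    · rw [CStarRing.norm_self_mul_star]
      nlinarith [norm_nonneg b.2, hC2 b hb]

lemma decompositionRank_minTensor_le : decompositionRank (MinTensor A B) ≤
    (decompositionRank A + 1) * (decompositionRank B + 1) - 1 := by
  generalize hM : decompositionRank A = M
  generalize hN : decompositionRank B = N
  induction M using ENat.recTopCoe with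
  | top =>
    have : (⊤ + 1 : ℕ∞) * (N + 1) - 1 = ⊤ := by
      rw [top_add, ENat.top_mul (by simp), ENat.top_sub_one]
    rw [this]
    exact le_top
  | coe M =>
    induction N using ENat.recTopCoe with
    | top =>
      have : ((M : ℕ∞) + 1) * (⊤ + 1) - 1 = ⊤ := by
        rw [top_add, ENat.mul_top (by simp), ENat.top_sub_one]
      rw [this]
      exact le_top
    | coe N =>
      have := decompositionRank_le_iff.2 ((decompositionRank_le_iff.1 hM.le).minTensor
        (decompositionRank_le_iff.1 hN.le))
      push_cast at this
      exact this

end TensorMap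

end DecRank

end

open scoped ComplexOrder TensorProduct ENNReal

noncomputable section

namespace DecRank

/-! ### Finite-dimensional *-subalgebras as images of sums of matrix algebras; AF algebras. -/

section FiniteDimensional

open scoped Classical

attribute [local instance 50] CStarAlgebra.spectralOrder CStarAlgebra.spectralOrderedRing

variable {B : Type*} [NonUnitalCStarAlgebra B] {S : NonUnitalStarSubalgebra ℂ B}

lemma eq_zero_of_star_mul_self {x : B} (h : star x * x = 0) : x = 0 :=
  (CStarRing.star_mul_self_eq_zero_iff x).1 h

/-- The right ideal `a S`. -/
def rightIdeal (S : NonUnitalStarSubalgebra ℂ B) (a : B) : Submodule ℂ B :=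
  S.toSubmodule.map (LinearMap.mulLeft ℂ a)

instance [FiniteDimensional ℂ S] (a : B) : FiniteDimensional ℂ (rightIdeal S a) :=
  have : FiniteDimensional ℂ S.toSubmodule := inferInstanceAs (FiniteDimensional ℂ S)
  inferInstanceAs (FiniteDimensional ℂ (S.toSubmodule.map (LinearMap.mulLeft ℂ a)))

/-- If `a S` is minimal among the right ideals generated by self-adjoint elements, then elements
commuting with `a` act on it by scalars. -/
lemma exists_mul_eq_smul_of_minimal [FiniteDimensional ℂ S] {a : B} (ha : a ∈ S) (ha0 : a ≠ 0)
    (has : star a = a)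
    (hmin : ∀ b ∈ S, b ≠ 0 → star b = b →
      Module.finrank ℂ (rightIdeal S a) ≤ Module.finrank ℂ (rightIdeal S b))
    {c : B} (hc : c ∈ S) (hcs : star c = c) (hca : c * a = a * c) :
    ∃ t : ℂ, star t = t ∧ c * a = t • a := by
  let V := rightIdeal S a
  have hV : ∀ v ∈ V, LinearMap.mulLeft ℂ c v ∈ V := by
    rintro _ ⟨s, hs, rfl⟩
    refine ⟨c * s, S.mul_mem hc hs, ?_⟩
    simp only [LinearMap.mulLeft_apply]
    rw [← mul_assoc, ← hca, mul_assoc]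
  let T : Module.End ℂ V := (LinearMap.mulLeft ℂ c).restrict hV
  have haV : a * a ∈ V := ⟨a, ha, rfl⟩
  have : Nontrivial V := ⟨⟨⟨a * a, haV⟩, 0, fun h => ha0 (eq_zero_of_star_mul_self
    (by rw [has]; exact congrArg Subtype.val h))⟩⟩
  obtain ⟨t, ht⟩ := Module.End.exists_eigenvalue T
  obtain ⟨v, hv⟩ := ht.exists_hasEigenvector
  have hv1 : c * (v : B) = t • (v : B) := congrArg Subtype.val hv.apply_eq_smul
  have hv0 : (v : B) ≠ 0 := fun h => hv.2 (Subtype.ext h)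
  have ht : star t = t := by
    have e1 : star (v : B) * (c * v) = t • (star (v : B) * v) := by rw [hv1, mul_smul_comm]
    have e2 := congrArg star e1
    rw [star_mul, star_mul, star_star, hcs, star_smul, star_mul, star_star, mul_assoc, e1] at e2
    rw [← sub_eq_zero, ← sub_smul, smul_eq_zero] at e2
    rcases e2 with e2 | e2
    · exact (sub_eq_zero.1 e2).symm
    · exact absurd (eq_zero_of_star_mul_self e2) hv0
  refine ⟨t, ht, ?_⟩
  by_contra hne
  let b := c * a - t • a
  have hb : b ∈ S := sub_mem (mul_mem hc ha) (SMulMemClass.smul_mem t ha)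
  have hbV : rightIdeal S b ≤ V := by
    rintro _ ⟨s, hs, rfl⟩
    refine ⟨c * s - t • s, sub_mem (S.mul_mem hc hs) (SMulMemClass.smul_mem t hs), ?_⟩
    simp only [LinearMap.mulLeft_apply, b]
    rw [sub_mul, hca, mul_sub, mul_assoc, smul_mul_assoc, mul_smul_comm]
  have hbs : star b = b := by
    simp only [b]
    rw [star_sub, star_mul, star_smul, has, hcs, ht, hca]
  -- If b = c a − t a were nonzero, minimality would give b S = a S, so that c − t would be
  -- surjective on a S, contradicting the eigenvector v.
  have heq : rightIdeal S b = V :=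
    Submodule.eq_of_le_of_finrank_le hbV (hmin b hb (sub_ne_zero.2 hne) hbs)
  have hsurj : Function.Surjective (T - t • LinearMap.id : V →ₗ[ℂ] V) := by
    rintro ⟨w, hw⟩
    rw [← heq] at hw
    obtain ⟨s, hs, rfl⟩ := hw
    refine ⟨⟨a * s, s, hs, rfl⟩, Subtype.ext ?_⟩
    change c * (a * s) - t • (a * s) = (c * a - t • a) * s
    rw [sub_mul, mul_assoc, smul_mul_assoc]
  have hinj := LinearMap.injective_iff_surjective.2 hsurj
  refine hv.2 (hinj ?_)
  rw [map_zero]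
  refine Subtype.ext ?_
  change c * (v : B) - t • (v : B) = 0
  rw [hv1, sub_self]

/-- A non-zero finite-dimensional *-subalgebra contains a minimal projection. -/
lemma exists_projection_of_finiteDimensional [FiniteDimensional ℂ S] (h0 : ∃ s ∈ S, s ≠ 0) :
    ∃ e ∈ S, e ≠ 0 ∧ star e = e ∧ e * e = e ∧ ∀ s ∈ S, ∃ t : ℂ, e * s * e = t • e := by
  let P : Set B := {a | a ∈ S ∧ a ≠ 0 ∧ star a = a}
  have hP : P.Nonempty := by
    obtain ⟨s, hs, hs0⟩ := h0
    exact ⟨star s * s, mul_mem (star_mem hs) hs, fun h => hs0 (eq_zero_of_star_mul_self h),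
      by rw [star_mul, star_star]⟩
  let f : B → ℕ := fun a => Module.finrank ℂ (rightIdeal S a)
  -- A self-adjoint element generating a right ideal of least dimension; a multiple of it will be
  -- the minimal projection.
  let a := Function.argminOn f P hP
  obtain ⟨ha, ha0, has⟩ : a ∈ P := Function.argminOn_mem f P hP
  have hmin : ∀ b ∈ S, b ≠ 0 → star b = b → f a ≤ f b := fun b h1 h2 h3 =>
    Function.argminOn_le f P (a := b) ⟨h1, h2, h3⟩
  -- With c = a this reads a² = t a, so t⁻¹ a is a projection.
  obtain ⟨t, hts, ht⟩ := exists_mul_eq_smul_of_minimal ha ha0 has hmin ha has rfl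
  have ht0 : t ≠ 0 := by
    rintro rfl
    rw [zero_smul] at ht
    exact ha0 (eq_zero_of_star_mul_self (by rw [has, ht]))
  obtain ⟨e, he⟩ : ∃ e, e = t⁻¹ • a := ⟨_, rfl⟩
  have hae : a = t • e := by rw [he, smul_smul, mul_inv_cancel₀ ht0, one_smul]
  have heS : e ∈ S := he ▸ SMulMemClass.smul_mem _ ha
  have hes : star e = e := by rw [he, star_smul, star_inv₀, hts, has]
  have hee : e * e = e := by
    rw [he, smul_mul_smul_comm, ht, smul_smul, mul_assoc, inv_mul_cancel₀ ht0, mul_one]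
  have he0 : e ≠ 0 := he ▸ smul_ne_zero (inv_ne_zero ht0) ha0
  refine ⟨e, heS, he0, hes, hee, ?_⟩
  -- For self-adjoint s the element e s e commutes with a, so it acts on a by a scalar; the general
  -- case follows from real and imaginary parts.
  have hsa : ∀ s ∈ S, star s = s → ∃ r : ℂ, e * s * e = r • e := by
    intro s hs hss
    have hcS : e * s * e ∈ S := mul_mem (mul_mem heS hs) heS
    have h1 : e * s * e * a = a * (e * s * e) := by
      rw [hae, mul_smul_comm, smul_mul_assoc, mul_assoc (e * s), hee, ← mul_assoc, ← mul_assoc, hee]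
    obtain ⟨r, -, hr⟩ := exists_mul_eq_smul_of_minimal ha ha0 has hmin hcS
      (by rw [star_mul, star_mul, hes, hss, mul_assoc]) h1
    rw [hae, mul_smul_comm, mul_assoc, hee, smul_comm] at hr
    exact ⟨r, smul_right_injective B ht0 hr⟩
  intro s hs
  obtain ⟨r1, h1⟩ := hsa (s + star s) (add_mem hs (star_mem hs)) (by
    rw [star_add, star_star, add_comm])
  obtain ⟨r2, h2⟩ := hsa (Complex.I • (s - star s))
    (SMulMemClass.smul_mem _ (sub_mem hs (star_mem hs))) (by
    rw [star_smul, star_sub, star_star, Complex.star_def, Complex.conj_I, neg_smul, ← smul_neg,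
      neg_sub])
  refine ⟨(1 / 2) * (r1 - Complex.I * r2), ?_⟩
  have h3 : ((1 / 2 : ℂ) * (r1 - Complex.I * r2)) • e =
      (1 / 2 : ℂ) • (r1 • e - Complex.I • r2 • e) := by
    rw [mul_smul, sub_smul, mul_smul]
  have h4 : e * (s + star s) * e - Complex.I • (e * (Complex.I • (s - star s)) * e) =
      (2 : ℂ) • (e * s * e) := by
    rw [mul_smul_comm, smul_mul_assoc, smul_smul, Complex.I_mul_I, neg_one_smul, sub_neg_eq_add,
      two_smul]
    noncomm_ring
  rw [h3, ← h1, ← h2, h4, smul_smul]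
  norm_num

/-- A family of partial isometries with source `e` and orthogonal ranges. -/
def IsOrthonormalFamily {m : Type} (e : B) (x : m → B) : Prop :=
  ∀ i j, star (x i) * x j = if i = j then e else 0

variable {m : Type} [Fintype m] {e : B} {x : m → B}

lemma IsOrthonormalFamily.mul_eq (hes : star e = e) (hee : e * e = e)
    (hx : IsOrthonormalFamily e x) (i : m) : x i * e = x i := by
  have h := hx i i
  rw [if_pos rfl] at h
  rw [← sub_eq_zero]
  refine eq_zero_of_star_mul_self ?_
  have h1 : star (x i * e - x i) * (x i * e - x i) = e * (star (x i) * x i) * e -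
      e * (star (x i) * x i) - star (x i) * x i * e + star (x i) * x i := by
    rw [star_sub, star_mul, hes]
    noncomm_ring
  rw [h1, h, hee, hee]
  abel

/-- The representation of a matrix algebra given by an orthonormal family. -/
def matrixHom (hes : star e = e) (hee : e * e = e) (hx : IsOrthonormalFamily e x) :
    CStarMatrix m m ℂ →⋆ₙₐ[ℂ] B where
  toFun X := ∑ i, ∑ j, X i j • (x i * star (x j))
  map_smul' t X := by
    simp only [CStarMatrix.smul_apply, smul_assoc, Finset.smul_sum, MonoidHom.id_apply]
  map_zero' := by simp
  map_add' X Y := by simp only [CStarMatrix.add_apply, add_smul, Finset.sum_add_distrib]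
  map_mul' X Y := by
    have h : ∀ i j k l, x i * star (x j) * (x k * star (x l)) =
        if j = k then x i * star (x l) else 0 := by
      intro i j k l
      rw [mul_assoc, ← mul_assoc (star (x j)), hx j k]
      split_ifs with hjk
      · rw [← mul_assoc, hx.mul_eq hes hee]
      · rw [zero_mul, mul_zero]
    simp only [CStarMatrix.mul_apply, Finset.sum_smul, Finset.sum_mul]
    simp only [Finset.mul_sum, smul_mul_smul_comm, h, smul_ite, smul_zero]
    refine Finset.sum_congr rfl fun i _ => ?_
    rw [Finset.sum_comm]
    refine Finset.sum_congr rfl fun j _ => ?_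
    symm
    rw [Finset.sum_eq_single j]
    · exact Finset.sum_congr rfl fun l _ => if_pos rfl
    · exact fun k _ hk => Finset.sum_eq_zero fun l _ => if_neg (Ne.symm hk)
    · simp
  map_star' X := by
    simp only [CStarMatrix.star_apply, star_sum, star_smul, star_mul, star_star]
    rw [Finset.sum_comm]

lemma matrixHom_apply (hes : star e = e) (hee : e * e = e) (hx : IsOrthonormalFamily e x)
    (X : CStarMatrix m m ℂ) :
    matrixHom hes hee hx X = ∑ i, ∑ j, X i j • (x i * star (x j)) := rfl

lemma IsOrthonormalFamily.linearIndependent (he0 : e ≠ 0) (hx : IsOrthonormalFamily e x) :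
    LinearIndependent ℂ x := by
  rw [Fintype.linearIndependent_iff]
  intro g hg i
  have h := congrArg (star (x i) * ·) hg
  simp only [Finset.mul_sum, mul_smul_comm, hx i _, smul_ite, smul_zero, Finset.sum_ite_eq,
    Finset.mem_univ, if_true, mul_zero] at h
  exact (smul_eq_zero.1 h).resolve_right he0

/-- In a finite-dimensional *-subalgebra, every minimal projection belongs to a summand which is a
matrix algebra. -/
lemma exists_maximal_orthonormalFamily [FiniteDimensional ℂ S] (heS : e ∈ S) (he0 : e ≠ 0)
    (hes : star e = e) (hee : e * e = e) (hmin : ∀ s ∈ S, ∃ t : ℂ, e * s * e = t • e) :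
    ∃ (k : ℕ) (x : Fin k → B), IsOrthonormalFamily e x ∧ (∀ i, x i ∈ S) ∧
      ∀ s ∈ S, s * e = (∑ i, x i * star (x i)) * (s * e) := by
  let P : ℕ → Prop := fun k => ∃ x : Fin k → B, IsOrthonormalFamily e x ∧ ∀ i, x i ∈ S
  have hb : ∀ k, P k → k ≤ Module.finrank ℂ S := by
    rintro k ⟨x, hx, hxS⟩
    have h1 : LinearIndependent ℂ fun i => (⟨x i, hxS i⟩ : S) :=
      .of_comp S.toSubmodule.subtype (hx.linearIndependent he0)
    simpa using h1.fintype_card_le_finrank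
  have hP0 : P 0 := ⟨Fin.elim0, fun i => i.elim0, fun i => i.elim0⟩
  obtain ⟨x, hx, hxS⟩ : P (Nat.findGreatest P (Module.finrank ℂ S)) :=
    Nat.findGreatest_spec (Nat.zero_le _) hP0
  refine ⟨_, x, hx, hxS, fun s hs => ?_⟩
  set p := ∑ i, x i * star (x i) with hp
  have hpS : p ∈ S := sum_mem fun i _ => mul_mem (hxS i) (star_mem (hxS i))
  have hxp : ∀ i, star (x i) * p = star (x i) := by
    intro i
    have h1 := congrArg star (hx.mul_eq hes hee i)
    rw [star_mul, hes] at h1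
    simp only [hp, Finset.mul_sum, ← mul_assoc, hx i _, ite_mul, zero_mul, Finset.sum_ite_eq,
      Finset.mem_univ, if_true, h1]
  -- The component of s e orthogonal to the family. By minimality of e, y* y is a multiple of e, and
  -- the multiple is positive if y ≠ 0. Rescaling y would then extend a family of maximal length.
  set y := s * e - p * (s * e) with hy
  have hyS : y ∈ S := sub_mem (mul_mem hs heS) (mul_mem hpS (mul_mem hs heS))
  have hye : y * e = y := by rw [hy, sub_mul, mul_assoc p, mul_assoc s, hee]
  have hxy : ∀ i, star (x i) * y = 0 := fun i => by
    rw [hy, mul_sub, ← mul_assoc _ p, hxp, sub_self]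
  by_contra hne
  have hy0 : y ≠ 0 := fun h => hne (sub_eq_zero.1 h)
  obtain ⟨t, ht⟩ := hmin (star y * y) (mul_mem (star_mem hyS) hyS)
  have hyy : star y * y = t • e := by
    have h1 := congrArg star hye
    rw [star_mul, hes] at h1
    rw [← ht, ← mul_assoc, h1, mul_assoc, hye]
  have htpos : ∃ r : ℝ, 0 < r ∧ t = ((r ^ 2 : ℝ) : ℂ) := by
    have ht1 : ((t.re : ℝ) : ℂ) = t := by
      rw [← Complex.conj_eq_iff_re]
      have h1 := congrArg star hyy
      rw [star_mul, star_star, star_smul, hes, hyy] at h1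
      exact (smul_left_injective ℂ he0 h1).symm
    have ht2 : 0 < t.re := by
      by_contra! hle
      have h1 : 0 ≤ star y * y := star_mul_self_nonneg y
      have h2 : 0 ≤ (-t.re) • e := by
        have : 0 ≤ e := by
          have := star_mul_self_nonneg e
          rwa [hes, hee] at this
        exact smul_nonneg (neg_nonneg.2 hle) this
      rw [neg_smul, ← Complex.coe_smul, ht1, ← hyy, neg_nonneg] at h2
      exact hy0 (eq_zero_of_star_mul_self (le_antisymm h2 h1))
    exact ⟨√t.re, Real.sqrt_pos.2 ht2, by rw [Real.sq_sqrt ht2.le, ht1]⟩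
  obtain ⟨r, hr0, rfl⟩ := htpos
  have hmax : ¬ P (Nat.findGreatest P (Module.finrank ℂ S) + 1) := fun h =>
    Nat.findGreatest_is_greatest (Nat.lt_succ_self _) (hb _ h) h
  have hry : ∀ z : B, star z * y = 0 → star z * (((r⁻¹ : ℝ) : ℂ) • y) = 0 := fun z hz => by
    rw [mul_smul_comm, hz, smul_zero]
  refine hmax ⟨Fin.cons (((r⁻¹ : ℝ) : ℂ) • y) x, fun i j => ?_, fun i => ?_⟩
  · refine Fin.cases ?_ (fun i => ?_) i <;> refine Fin.cases ?_ (fun j => ?_) j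
    · simp only [Fin.cons_zero, if_true]
      rw [star_smul, Complex.star_def, Complex.conj_ofReal, smul_mul_smul_comm, hyy, smul_smul,
        ← Complex.ofReal_mul, ← Complex.ofReal_mul]
      have : r⁻¹ * r⁻¹ * r ^ 2 = 1 := by field_simp
      rw [this, Complex.ofReal_one, one_smul]
    · simp only [Fin.cons_zero, Fin.cons_succ]
      rw [if_neg (Fin.succ_ne_zero j).symm, ← star_star (x j), ← star_mul, hry _ (hxy j), star_zero]
    · simp only [Fin.cons_zero, Fin.cons_succ]
      rw [if_neg (Fin.succ_ne_zero i), hry _ (hxy i)]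
    · simp only [Fin.cons_succ, Fin.succ_inj]
      convert hx i j
  · refine Fin.cases ?_ (fun i => ?_) i
    · exact SMulMemClass.smul_mem _ hyS
    · exact hxS i

/-- The sum of two *-homomorphisms with orthogonal ranges. -/
def addHom {F : Type*} [NonUnitalCStarAlgebra F] (f g : F →⋆ₙₐ[ℂ] B)
    (h : ∀ x y, f x * g y = 0) : F →⋆ₙₐ[ℂ] B where
  toFun x := f x + g x
  map_smul' t x := by rw [map_smul, map_smul, smul_add, MonoidHom.id_apply]
  map_zero' := by rw [map_zero, map_zero, add_zero]
  map_add' x y := by rw [map_add, map_add]; abel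
  map_mul' x y := by
    have h' : g x * f y = 0 := by
      rw [← star_star (g x), ← star_star (f y), ← star_mul, ← map_star, ← map_star, h, star_zero]
    rw [map_mul, map_mul, add_mul, mul_add, mul_add, h, h', zero_add, add_zero]
  map_star' x := by rw [map_star, map_star, star_add]

/-- Finite-dimensional *-subalgebras are images of sums of matrix algebras. -/
lemma exists_hom_range_eq (d : ℕ) : ∀ (S : NonUnitalStarSubalgebra ℂ B) [FiniteDimensional ℂ S],
    Module.finrank ℂ S ≤ d → ∃ (ι : Type) (_ : Fintype ι) (n : ι → Type)
      (_ : ∀ i, Fintype (n i)) (θ : Blocks n →⋆ₙₐ[ℂ] B), Set.range θ = S := by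
  induction d with
  | zero =>
    intro S _ hS
    have h0 : ∀ s ∈ S, s = 0 := by
      intro s hs
      have := Module.finrank_zero_iff.1 (Nat.le_zero.1 hS)
      exact congrArg Subtype.val (Subsingleton.elim (⟨s, hs⟩ : S) 0)
    refine ⟨Empty, inferInstance, fun _ => Empty, inferInstance, 0, ?_⟩
    ext s
    refine ⟨?_, fun hs => ⟨0, (h0 s hs).symm⟩⟩
    rintro ⟨x, rfl⟩
    exact zero_mem S
  | succ d ih =>
    intro S _ hS
    by_cases h0 : ∃ s ∈ S, s ≠ 0
    swap
    · refine ih S ?_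
      have : Subsingleton S := ⟨fun x y => Subtype.ext (by
        push Not at h0
        rw [h0 x x.2, h0 y y.2])⟩
      rw [Module.finrank_zero_of_subsingleton]
      exact Nat.zero_le d
    obtain ⟨e, heS, he0, hes, hee, hmin⟩ := exists_projection_of_finiteDimensional h0
    obtain ⟨k, x, hx, hxS, hmax⟩ := exists_maximal_orthonormalFamily heS he0 hes hee hmin
    set p := ∑ i, x i * star (x i) with hp
    have hpS : p ∈ S := sum_mem fun i _ => mul_mem (hxS i) (star_mem (hxS i))
    have hps : star p = p := by
      rw [hp, star_sum]
      simp only [star_mul, star_star]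
    have hsx : ∀ s ∈ S, ∀ i, p * (s * x i) = s * x i := fun s hs i => by
      have := hmax (s * x i) (mul_mem hs (hxS i))
      rw [mul_assoc, hx.mul_eq hes hee] at this
      exact this.symm
    have hsp : ∀ s ∈ S, p * (s * p) = s * p := fun s hs => by
      conv_lhs => rw [hp, Finset.mul_sum]
      conv_rhs => rw [hp, Finset.mul_sum]
      rw [← hp, Finset.mul_sum]
      refine Finset.sum_congr rfl fun i _ => ?_
      rw [← mul_assoc s, ← mul_assoc p, hsx s hs]
    -- p s p = s p for all s ∈ S; comparing with the adjoint relation shows that p is central in S.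
    have hcomm : ∀ s ∈ S, p * s = s * p := fun s hs => by
      have h1 := congrArg star (hsp (star s) (star_mem hs))
      simp only [star_mul, star_star, hps] at h1
      rw [← h1, mul_assoc, hsp s hs]
    have hpx : ∀ i, p * x i = x i := fun i => by
      simp only [hp, Finset.sum_mul, mul_assoc, hx _ i, mul_ite, mul_zero, Finset.sum_ite_eq',
        Finset.mem_univ, if_true, hx.mul_eq hes hee]
    have hxp : ∀ i, star (x i) * p = star (x i) := fun i => by
      rw [← hps, ← star_mul, hpx]
    have hpp : p * p = p := by
      conv_lhs => enter [2]; rw [hp]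
      simp only [Finset.mul_sum, ← mul_assoc, hpx]
      exact hp.symm
    have hp0 : p ≠ 0 := fun h => he0 (by
      have := hmax e heS
      rwa [h, zero_mul, hee] at this)
    -- The complementary summand S(1 − p), of smaller dimension because p ≠ 0 does not belong to it.
    let S' : NonUnitalStarSubalgebra ℂ B :=
      { carrier := {s | s ∈ S ∧ s * p = 0}
        add_mem' := fun ha hb => ⟨add_mem ha.1 hb.1, by rw [add_mul, ha.2, hb.2, add_zero]⟩
        zero_mem' := ⟨zero_mem S, zero_mul p⟩
        mul_mem' := fun ha hb => ⟨mul_mem ha.1 hb.1, by rw [mul_assoc, hb.2, mul_zero]⟩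
        smul_mem' := fun c x hx => ⟨SMulMemClass.smul_mem c hx.1, by
          rw [smul_mul_assoc, hx.2, smul_zero]⟩
        star_mem' := fun {a} ha => ⟨star_mem ha.1, by
          rw [← hcomm _ (star_mem ha.1), ← hps, ← star_mul, ha.2, star_zero]⟩ }
    have hle : S'.toSubmodule ≤ S.toSubmodule := fun s hs => hs.1
    have hfS : FiniteDimensional ℂ S.toSubmodule := inferInstanceAs (FiniteDimensional ℂ S)
    have hf : FiniteDimensional ℂ S'.toSubmodule := Submodule.finiteDimensional_of_le hle
    have : FiniteDimensional ℂ S' := hf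
    have hlt : Module.finrank ℂ S'.toSubmodule < Module.finrank ℂ S.toSubmodule := by
      refine Submodule.finrank_lt_finrank_of_lt (lt_of_le_not_ge hle fun h => ?_)
      have h1 : p * p = 0 := (h hpS).2
      exact hp0 (hpp.symm.trans h1)
    obtain ⟨ι, _, n, _, θ', hθ'⟩ := ih S' (Nat.le_of_lt_succ (lt_of_lt_of_le hlt hS))
    let n₀ : Unit → Type := fun _ => Fin k
    let θ : Blocks n₀ →⋆ₙₐ[ℂ] B := (matrixHom hes hee hx).comp (blockProj (p := n₀) ())
    have hθ : ∀ X, θ X = matrixHom hes hee hx (X ()) := fun X => rfl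
    have hθp : ∀ X, θ X * p = θ X := by
      intro X
      rw [hθ, matrixHom_apply]
      simp only [Finset.sum_mul, smul_mul_assoc, mul_assoc, hxp]
    have hθS : ∀ X, θ X ∈ S := fun X => by
      rw [hθ, matrixHom_apply]
      exact sum_mem fun i _ => sum_mem fun j _ =>
      SMulMemClass.smul_mem _ (mul_mem (hxS i) (star_mem (hxS j)))
    have hθ'S : ∀ y, θ' y ∈ S' := fun y => hθ'.subset (Set.mem_range_self y)
    have horth : ∀ X y, θ X * θ' y = 0 := fun X y => by
      rw [← hθp, mul_assoc, hcomm _ (hθ'S y).1, (hθ'S y).2, mul_zero]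
    refine ⟨Unit ⊕ ι, inferInstance, Sum.elim n₀ n, inferInstance,
      addHom (F := Blocks (Sum.elim n₀ n)) (θ.comp (blocksInl (n := n₀) (m := n)))
        (θ'.comp (blocksInr (n := n₀) (m := n))) (fun _ _ => horth _ _), ?_⟩
    ext s
    constructor
    · rintro ⟨z, rfl⟩
      exact add_mem (hθS _) (hθ'S _).1
    · intro hs
      have h1 : s - p * s ∈ S' := ⟨sub_mem hs (mul_mem hpS hs), by
        rw [sub_mul, hcomm s hs, mul_assoc, hpp, sub_self]⟩
      obtain ⟨y, hy⟩ : s - p * s ∈ Set.range θ' := hθ'.symm.subset h1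
      -- The matrix coefficients of p s: minimality of e makes x_i* s x_j a multiple of e.
      choose T hT using fun i j => hmin (star (x i) * s * x j)
        (mul_mem (mul_mem (star_mem (hxS i)) hs) (hxS j))
      have h2 : θ (fun _ => CStarMatrix.ofMatrix T) = p * s := by
        rw [hθ, matrixHom_apply]
        change ∑ i, ∑ j, T i j • (x i * star (x j)) = _
        have h3 : p * s = p * s * p := by rw [mul_assoc, hsp s hs, hcomm s hs]
        have h4 : ∀ i, e * star (x i) = star (x i) := fun i => by
          rw [← hes, ← star_mul, hx.mul_eq hes hee]
        have h5 : ∀ i j, T i j • (x i * star (x j)) = x i * star (x i) * s * (x j * star (x j)) := by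
          intro i j
          have h6 := hT i j
          rw [mul_assoc, mul_assoc _ (x j), hx.mul_eq hes hee, ← mul_assoc, ← mul_assoc, h4] at h6
          rw [← hx.mul_eq hes hee i, mul_assoc (x i), ← mul_smul_comm, ← smul_mul_assoc, ← h6,
            hx.mul_eq hes hee i]
          simp only [mul_assoc]
        rw [h3, hp, Finset.sum_mul, Finset.sum_mul]
        simp only [Finset.mul_sum, h5]
      refine ⟨blocksPair (n := n₀) (fun _ => CStarMatrix.ofMatrix T) y, ?_⟩
      change θ _ + θ' y = s
      refine (congrArg₂ (· + ·) h2 hy).trans ?_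
      abel

/-- A finite subset of the dense union lies in one finite-dimensional subalgebra, the range of a
*-homomorphism θ from a sum of matrix algebras. θ is multiplicative and so an exact model, and it
sends different blocks to orthogonal elements, so one colour suffices. -/
lemma IsAF.hasApproximateModels (h : IsAF B) (N : ℕ) : HasApproximateModels B N := by
  obtain ⟨S, hmono, hS, hd⟩ := h
  refine hasApproximateModels_of_dense hd fun T ε hT hε => ?_
  have h1 : ∃ k, (T : Set B) ⊆ S k :=
    Monotone.directed_le (f := fun k => (S k : Set B)) (fun i j hij => hmono hij)
      |>.exists_mem_subset_of_finset_subset_biUnion hT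
  obtain ⟨k, hk⟩ := h1
  have := hS k
  obtain ⟨ι, _, n, _, θ, hθ⟩ := exists_hom_range_eq _ (S k) le_rfl
  refine ⟨ι, _, n, _, (θ : Blocks n →ₗ[ℂ] B), fun _ => 0, isCPC_hom θ,
    ⟨fun i x y hxy => ?_, fun i j hij _ x y => ?_⟩, fun b hb => ?_⟩
  · change θ (blockIncl i x) * θ (blockIncl i y) = 0
    rw [← map_mul, ← map_mul, hxy, map_zero, map_zero]
  · change θ (blockIncl i x) * θ (blockIncl j y) = 0
    rw [← map_mul, blockIncl_mul_of_ne hij, map_zero]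
  · obtain ⟨y, rfl⟩ : b ∈ Set.range θ := hθ.symm.subset (hk hb)
    refine ⟨y, ?_, ?_⟩
    · change ‖θ y - θ y‖ < ε
      rwa [sub_self, norm_zero]
    · change ‖θ (y * star y) - θ y * star (θ y)‖ < ε
      rwa [map_mul, map_star, sub_self, norm_zero]

lemma decompositionRank_minTensor_le_of_isAF {A : Type*} [NonUnitalCStarAlgebra A] (h : IsAF B) :
    decompositionRank (MinTensor A B) ≤ decompositionRank A := by
  refine decompositionRank_le_of_forall fun N hN => ?_
  have := (decompositionRank_le_iff.1 hN).minTensor (h.hasApproximateModels 0)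
  simpa using this

end FiniteDimensional

end DecRank

end

open scoped ComplexOrder TensorProduct ENNReal

noncomputable section

namespace DecRank

/-! ### Spectral corners of a positive matrix. -/

section Corner

open scoped Classical Matrix

variable {n k : Type} [Fintype n] [Fintype k]

/-- Conjugation by an isometry. -/
def isometryHom (W : Matrix n k ℂ) (hW : Wᴴ * W = 1) :
    CStarMatrix k k ℂ →⋆ₙₐ[ℂ] CStarMatrix n n ℂ where
  toFun x := CStarMatrix.ofMatrix (W * CStarMatrix.ofMatrix.symm x * Wᴴ)
  map_smul' t x := by
    change W * (t • CStarMatrix.ofMatrix.symm x) * Wᴴ = t • (W * CStarMatrix.ofMatrix.symm x * Wᴴ)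
    rw [Matrix.mul_smul, Matrix.smul_mul]
  map_zero' := by
    change W * (0 : Matrix k k ℂ) * Wᴴ = 0
    rw [Matrix.mul_zero, Matrix.zero_mul]
  map_add' x y := by
    change W * (CStarMatrix.ofMatrix.symm x + CStarMatrix.ofMatrix.symm y) * Wᴴ = _ + _
    rw [Matrix.mul_add, Matrix.add_mul]
    rfl
  map_mul' x y := by
    change W * (CStarMatrix.ofMatrix.symm x * CStarMatrix.ofMatrix.symm y) * Wᴴ =
      (W * CStarMatrix.ofMatrix.symm x * Wᴴ) * (W * CStarMatrix.ofMatrix.symm y * Wᴴ)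
    have h : ∀ X Y : Matrix k k ℂ, W * (X * Y) * Wᴴ = (W * X * Wᴴ) * (W * Y * Wᴴ) := by
      intro X Y
      calc W * (X * Y) * Wᴴ = W * X * (1 : Matrix k k ℂ) * Y * Wᴴ := by
            simp only [Matrix.mul_assoc, Matrix.one_mul]
        _ = _ := by
            rw [← hW]
            simp only [Matrix.mul_assoc]
    exact h _ _
  map_star' x := by
    change W * (CStarMatrix.ofMatrix.symm x)ᴴ * Wᴴ = (W * CStarMatrix.ofMatrix.symm x * Wᴴ)ᴴ
    rw [Matrix.conjTranspose_mul, Matrix.conjTranspose_mul, Matrix.conjTranspose_conjTranspose,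
      Matrix.mul_assoc]

lemma isometryHom_injective (W : Matrix n k ℂ) (hW : Wᴴ * W = 1) :
    Function.Injective (isometryHom W hW) := by
  have h : ∀ X : Matrix k k ℂ, Wᴴ * (W * X * Wᴴ) * W = X := fun X => by
    calc _ = (Wᴴ * W) * X * (Wᴴ * W) := by simp only [Matrix.mul_assoc]
      _ = X := by rw [hW, Matrix.one_mul, Matrix.mul_one]
  intro x y hxy
  have h1 : W * CStarMatrix.ofMatrix.symm x * Wᴴ = W * CStarMatrix.ofMatrix.symm y * Wᴴ := hxy
  have h2 := h (CStarMatrix.ofMatrix.symm x)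
  rw [h1, h] at h2
  exact h2.symm

/-- The matrix with given eigenvalues in the basis of columns of `U`. -/
def diagConj (U : Matrix n n ℂ) (f : n → ℝ) : CStarMatrix n n ℂ :=
  CStarMatrix.ofMatrix (U * Matrix.diagonal (fun i => (f i : ℂ)) * Uᴴ)

lemma diagConj_mul {U : Matrix n n ℂ} (hU : Uᴴ * U = 1) (f g : n → ℝ) :
    diagConj U f * diagConj U g = diagConj U (f * g) := by
  change (U * Matrix.diagonal (fun i => (f i : ℂ)) * Uᴴ) *
    (U * Matrix.diagonal (fun i => (g i : ℂ)) * Uᴴ) =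
    U * Matrix.diagonal (fun i => ((f i * g i : ℝ) : ℂ)) * Uᴴ
  calc _ = U * Matrix.diagonal (fun i => (f i : ℂ)) * (Uᴴ * U) *
        Matrix.diagonal (fun i => (g i : ℂ)) * Uᴴ := by simp only [Matrix.mul_assoc]
    _ = _ := by
      rw [hU, Matrix.mul_one, Matrix.mul_assoc U, Matrix.diagonal_mul_diagonal]
      simp only [Complex.ofReal_mul]

lemma diagConj_sub (U : Matrix n n ℂ) (f g : n → ℝ) :
    diagConj U (f - g) = diagConj U f - diagConj U g := by
  change U * Matrix.diagonal (fun i => ((f i - g i : ℝ) : ℂ)) * Uᴴ =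
    U * Matrix.diagonal (fun i => (f i : ℂ)) * Uᴴ - U * Matrix.diagonal (fun i => (g i : ℂ)) * Uᴴ
  rw [← Matrix.sub_mul, ← Matrix.mul_sub, Matrix.diagonal_sub]
  simp only [Complex.ofReal_sub]

lemma diagConj_smul (U : Matrix n n ℂ) (t : ℝ) (f : n → ℝ) :
    diagConj U (t • f) = (t : ℂ) • diagConj U f := by
  change U * Matrix.diagonal (fun i => ((t * f i : ℝ) : ℂ)) * Uᴴ =
    (t : ℂ) • (U * Matrix.diagonal (fun i => (f i : ℂ)) * Uᴴ)
  rw [← Matrix.smul_mul, ← Matrix.mul_smul, ← Matrix.diagonal_smul]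
  congr 3
  ext i
  simp

lemma diagConj_one {U : Matrix n n ℂ} (hU : U * Uᴴ = 1) : diagConj U 1 = 1 := by
  change U * Matrix.diagonal (fun _ => ((1 : ℝ) : ℂ)) * Uᴴ = 1
  rw [Complex.ofReal_one, Matrix.diagonal_one, Matrix.mul_one, hU]

lemma star_diagConj (U : Matrix n n ℂ) (f : n → ℝ) : star (diagConj U f) = diagConj U f := by
  change (U * Matrix.diagonal (fun i => (f i : ℂ)) * Uᴴ)ᴴ =
    U * Matrix.diagonal (fun i => (f i : ℂ)) * Uᴴ
  rw [Matrix.conjTranspose_mul, Matrix.conjTranspose_mul, Matrix.conjTranspose_conjTranspose,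
    Matrix.diagonal_conjTranspose, Matrix.mul_assoc]
  congr 3
  ext i
  exact Complex.conj_ofReal _

lemma exists_diagConj_eq_star_mul_self {U : Matrix n n ℂ} (hU : Uᴴ * U = 1) {f : n → ℝ}
    (hf : ∀ i, 0 ≤ f i) : ∃ r, diagConj U f = star r * r := by
  refine ⟨diagConj U fun i => √(f i), ?_⟩
  rw [star_diagConj, diagConj_mul hU]
  congr 1
  ext i
  exact (Real.mul_self_sqrt (hf i)).symm

lemma submatrix_conjTranspose_mul {U : Matrix n n ℂ} (hU : Uᴴ * U = 1) {e : k → n}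
    (he : Function.Injective e) : (U.submatrix id e)ᴴ * U.submatrix id e = 1 := by
  ext i j
  have h := congrFun (congrFun hU (e i)) (e j)
  rw [Matrix.one_apply, he.eq_iff] at h
  rw [Matrix.one_apply]
  exact h

lemma isometryHom_submatrix_one {U : Matrix n n ℂ} {e : k → n} (he : Function.Injective e)
    (hW : (U.submatrix id e)ᴴ * U.submatrix id e = 1) {p : n → Prop}
    (hp : ∀ i, (∃ j, e j = i) ↔ p i) :
    isometryHom (U.submatrix id e) hW 1 = diagConj U fun i => if p i then 1 else 0 := by
  ext i j
  change (U.submatrix id e * (1 : Matrix k k ℂ) * (U.submatrix id e)ᴴ) i j =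
    (U * Matrix.diagonal (fun i => ((if p i then 1 else 0 : ℝ) : ℂ)) * Uᴴ) i j
  rw [Matrix.mul_one, Matrix.mul_apply, Matrix.mul_apply]
  simp only [Matrix.mul_diagonal, Matrix.submatrix_apply, Matrix.conjTranspose_apply, id]
  rw [← Finset.sum_subset (Finset.subset_univ (Finset.univ.image e)),
    Finset.sum_image he.injOn]
  · refine Finset.sum_congr rfl fun l _ => ?_
    rw [if_pos ((hp _).1 ⟨l, rfl⟩), Complex.ofReal_one, mul_one]
  · intro l _ hl
    have : ¬ p l := fun h => by
      obtain ⟨j, hj⟩ := (hp l).2 h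
      exact hl (Finset.mem_image.2 ⟨j, Finset.mem_univ _, hj⟩)
    rw [if_neg this, Complex.ofReal_zero, mul_zero, zero_mul]

/-- The spectral projection of a positive matrix for the interval `[1/2, ∞)`. -/
lemma exists_spectral_corner {a c : CStarMatrix n n ℂ} (h : a = star c * c) :
    ∃ (k : Type) (_ : Fintype k) (ι : CStarMatrix k k ℂ →⋆ₙₐ[ℂ] CStarMatrix n n ℂ),
      Function.Injective ι ∧ (∃ r, (2 : ℂ) • a - ι 1 = star r * r) ∧
      (∃ r, (4 : ℂ) • ((1 - a) * (1 - a)) - (1 - ι 1) = star r * r) ∧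
      ∀ x, ∃ z, ι z = ι 1 * x * ι 1 := by
  have hpos : Matrix.PosSemidef (CStarMatrix.ofMatrix.symm a) := by
    rw [h]
    exact Matrix.posSemidef_conjTranspose_mul_self (CStarMatrix.ofMatrix.symm c)
  let lam := hpos.1.eigenvalues
  let U : Matrix n n ℂ := hpos.1.eigenvectorUnitary
  have hU1 : Uᴴ * U = 1 := Unitary.coe_star_mul_self hpos.1.eigenvectorUnitary
  have hU2 : U * Uᴴ = 1 := Unitary.coe_mul_star_self hpos.1.eigenvectorUnitary
  have ha : a = diagConj U lam := by
    refine hpos.1.spectral_theorem.trans ?_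
    rw [Unitary.conjStarAlgAut_apply]
    rfl
  obtain ⟨k, _, e, he, hek⟩ : ∃ (k : Type) (_ : Fintype k) (e : k → n), Function.Injective e ∧
      ∀ i, (∃ j, e j = i) ↔ 1 / 2 ≤ lam i :=
    ⟨{i // 1 / 2 ≤ lam i}, inferInstance, Subtype.val, Subtype.val_injective, fun i =>
      ⟨fun ⟨j, hj⟩ => hj ▸ j.2, fun h => ⟨⟨i, h⟩, rfl⟩⟩⟩
  -- Cutting at 1/2 gives χ ≤ 2λ on the eigenvalues kept, and 1 − χ ≤ 4(1 − λ)² on those removed,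
  -- where 1 − λ > 1/2.
  let χ : n → ℝ := fun i => if 1 / 2 ≤ lam i then 1 else 0
  let W : Matrix n k ℂ := U.submatrix id e
  have hW : Wᴴ * W = 1 := submatrix_conjTranspose_mul hU1 he
  have hp : isometryHom W hW 1 = diagConj U χ := isometryHom_submatrix_one he hW hek
  refine ⟨k, _, isometryHom W hW, isometryHom_injective W hW, ?_, ?_, fun x => ?_⟩
  · have h1 : (2 : ℂ) • a - isometryHom W hW 1 = diagConj U ((2 : ℝ) • lam - χ) := by
      rw [hp, ha, diagConj_sub, diagConj_smul]
      norm_num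
    rw [h1]
    refine exists_diagConj_eq_star_mul_self hU1 fun i => ?_
    have := hpos.eigenvalues_nonneg i
    simp only [Pi.sub_apply, Pi.smul_apply, smul_eq_mul, χ]
    split_ifs with hi <;> linarith
  · have h1 : (4 : ℂ) • ((1 - a) * (1 - a)) - (1 - isometryHom W hW 1) =
        diagConj U ((4 : ℝ) • ((1 - lam) * (1 - lam)) - (1 - χ)) := by
      rw [hp, ha, diagConj_sub, diagConj_smul, ← diagConj_mul hU1, diagConj_sub, diagConj_sub,
        diagConj_one hU2]
      norm_num
    rw [h1]
    refine exists_diagConj_eq_star_mul_self hU1 fun i => ?_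
    simp only [Pi.sub_apply, Pi.smul_apply, smul_eq_mul, χ, Pi.mul_apply, Pi.one_apply]
    split_ifs with hi
    · nlinarith [mul_self_nonneg (1 - lam i)]
    · nlinarith
  · refine ⟨CStarMatrix.ofMatrix (Wᴴ * CStarMatrix.ofMatrix.symm x * W), ?_⟩
    have h1 : ∀ X : Matrix n n ℂ, W * (Wᴴ * X * W) * Wᴴ =
        (W * (1 : Matrix k k ℂ) * Wᴴ) * X * (W * (1 : Matrix k k ℂ) * Wᴴ) := fun X => by
      simp only [Matrix.mul_assoc, Matrix.mul_one]
    exact h1 _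

end Corner

end DecRank

end

open scoped ComplexOrder TensorProduct ENNReal

noncomputable section

namespace DecRank

/-! ### Approximate polar decomposition and the multipliers. -/

section Polar

attribute [local instance 50] CStarAlgebra.spectralOrder CStarAlgebra.spectralOrderedRing

variable {U : Type*} [CStarAlgebra U]

/-- A regularized inverse: for a = r (r² + s)⁻¹ c the error is −q c with q = s (r² + s)⁻¹, and ‖q
c‖² ≤ C ‖q r² q‖ ≤ C s. -/
lemma exists_norm_mul_sub_lt {r c : U} (hr : 0 ≤ r) {C : ℝ} (hC : 0 ≤ C)
    (h : c * star c ≤ C • (r * r)) {ε : ℝ} (hε : 0 < ε) : ∃ a, ‖r * a - c‖ < ε := by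
  obtain ⟨s, hs, hsε⟩ : ∃ s : ℝ, 0 < s ∧ C * s < ε ^ 2 := by
    refine ⟨ε ^ 2 / (C + 1), by positivity, ?_⟩
    rw [mul_div_assoc', div_lt_iff₀ (by positivity)]
    nlinarith [sq_pos_of_pos hε]
  have hrs : IsSelfAdjoint r := .of_nonneg hr
  have hd' : ∀ t : ℝ, 0 < t * t + s := fun t => add_pos_of_nonneg_of_pos (mul_self_nonneg t) hs
  have hd : ∀ t : ℝ, t * t + s ≠ 0 := fun t => (hd' t).ne'
  let q : U := cfc (fun t : ℝ => s / (t * t + s)) r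
  have hcq : Continuous fun t : ℝ => s / (t * t + s) := by fun_prop (disch := exact hd _)
  have hcg : Continuous fun t : ℝ => t / (t * t + s) := by fun_prop (disch := exact hd _)
  have hq : star q = q := (cfc_predicate (p := IsSelfAdjoint) (fun t : ℝ => s / (t * t + s)) r).star_eq
  have hr1 : r * cfc (fun t : ℝ => t / (t * t + s)) r = 1 - q := by
    conv_lhs => rw [← cfc_id' ℝ r]
    rw [cfc_id' ℝ r, ← cfc_one ℝ r, ← cfc_sub _ _ r (by fun_prop) hcq.continuousOn]
    conv_lhs => enter [1]; rw [← cfc_id' ℝ r]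
    rw [← cfc_mul _ _ r (by fun_prop) hcg.continuousOn]
    congr 1
    ext t
    have := hd t
    simp only [Pi.one_apply]
    field_simp
    ring
  have hqr : q * (r * r) * q = cfc (fun t : ℝ => s / (t * t + s) * (t * t) * (s / (t * t + s))) r := by
    rw [cfc_mul _ _ r (by fun_prop) hcq.continuousOn, cfc_mul _ _ r hcq.continuousOn,
      cfc_mul _ _ r, cfc_id' ℝ r]
  have hn : ‖q * (r * r) * q‖ ≤ s := by
    rw [hqr]
    refine norm_cfc_le hs.le fun t _ => ?_
    have hst : 0 ≤ s / (t * t + s) := div_nonneg hs.le (hd' t).le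
    rw [Real.norm_of_nonneg (mul_nonneg (mul_nonneg hst (mul_self_nonneg t)) hst)]
    have : s / (t * t + s) * (t * t) * (s / (t * t + s)) = s * (s * (t * t)) / (t * t + s) ^ 2 := by
      have := hd t
      field_simp
    rw [this, div_le_iff₀ (pow_pos (hd' t) 2)]
    nlinarith [mul_nonneg hs.le (mul_self_nonneg t), sq_nonneg (t * t), sq_nonneg s,
      mul_nonneg hs.le (mul_nonneg hs.le (mul_self_nonneg t)), mul_nonneg hs.le (sq_nonneg (t * t)),
      pow_pos hs 3]
  refine ⟨cfc (fun t : ℝ => t / (t * t + s)) r * c, ?_⟩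
  have e1 : r * (cfc (fun t : ℝ => t / (t * t + s)) r * c) - c = -(q * c) := by
    rw [← mul_assoc, hr1]
    noncomm_ring
  rw [e1, norm_neg]
  refine lt_of_pow_lt_pow_left₀ 2 hε.le (lt_of_le_of_lt ?_ hsε)
  rw [sq, ← CStarRing.norm_self_mul_star]
  have e2 : q * c * star (q * c) ≤ C • (q * (r * r) * q) := by
    have := star_right_conjugate_le_conjugate h q
    rw [hq, mul_smul_comm, smul_mul_assoc] at this
    rw [star_mul, hq]
    simpa only [mul_assoc] using this
  refine (norm_le_of_nonneg_of_le (mul_star_self_nonneg _) e2).trans ?_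
  rw [norm_smul, Real.norm_of_nonneg hC]
  exact mul_le_mul_of_nonneg_left hn hC

/-- If `z* z` is comparable with `c²`, then `z` is close to an element `y` of the closed right ideal
generated by `z` which satisfies `y* y = c²`. -/
lemma exists_star_mul_self_eq {z c : U} (hc : 0 ≤ c) (hc1 : ‖c‖ ≤ 1) {μ : ℝ} (hμ0 : 0 ≤ μ)
    (hμ : μ < 1) (h1 : star z * z ≤ c * c) (h2 : (1 - μ) • (c * c) ≤ star z * z) :
    ∃ y ∈ closure (Set.range fun a => z * a), star y * y = c * c ∧ ‖y - z‖ ≤ μ := by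
  -- r = |z|. As the square root is operator monotone, (1 − μ) c ≤ r ≤ c. The element y plays the
  -- role of u c in the polar decomposition z = u r, which need not exist in `U`.
  obtain ⟨r, hr⟩ : ∃ r, r = CFC.sqrt (star z * z) := ⟨_, rfl⟩
  have hr0 : 0 ≤ r := hr ▸ CFC.sqrt_nonneg _
  have hrs : star r = r := (IsSelfAdjoint.of_nonneg hr0).star_eq
  have hcs : star c = c := (IsSelfAdjoint.of_nonneg hc).star_eq
  have hrr : r * r = star z * z := hr ▸ CFC.sqrt_mul_sqrt_self _ (star_mul_self_nonneg z)
  have hμ1 : 0 < 1 - μ := by linarith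
  have hcc : 0 ≤ c * c := by
    have := star_mul_self_nonneg c
    rwa [hcs] at this
  have hrc : r ≤ c := by
    rw [hr, ← CFC.sqrt_mul_self c hc]
    exact CFC.sqrt_le_sqrt _ _ h1
  have hcr : (1 - μ) • c ≤ r := by
    rw [hr, ← CFC.sqrt_mul_self ((1 - μ) • c) (smul_nonneg hμ1.le hc)]
    refine CFC.sqrt_le_sqrt _ _ (le_trans ?_ h2)
    rw [smul_mul_smul_comm]
    exact smul_le_smul_of_nonneg_right (by nlinarith) hcc
  have hdiff : ‖c - r‖ ≤ μ := by
    refine (norm_le_of_nonneg_of_le (sub_nonneg.2 hrc) (b := μ • c) ?_).trans ?_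
    · rw [sub_smul, one_smul] at hcr
      rw [sub_le_comm]
      exact hcr
    · rw [norm_smul, Real.norm_of_nonneg hμ0]
      exact mul_le_of_le_one_right hμ0 hc1
  -- r a ↦ z a is isometric, so r a_n → c makes z a_n Cauchy; its limit is y.
  have hnorm : ∀ a, ‖z * a‖ = ‖r * a‖ := by
    intro a
    have : star (z * a) * (z * a) = star (r * a) * (r * a) := by
      rw [star_mul, star_mul, mul_assoc, ← mul_assoc (star z), ← hrr, hrs]
      simp only [mul_assoc]
    rw [← mul_self_inj (norm_nonneg _) (norm_nonneg _), ← CStarRing.norm_star_mul_self, this,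
      CStarRing.norm_star_mul_self]
  have hex : ∀ n : ℕ, ∃ a, ‖r * a - c‖ < 1 / (n + 1) := fun n => by
    refine exists_norm_mul_sub_lt hr0 (C := (1 - μ)⁻¹) (by positivity) ?_ (by positivity)
    rw [hcs, hrr, le_inv_smul_iff_of_pos hμ1]
    exact h2
  choose a ha using hex
  have hlim : Filter.Tendsto (fun n => r * a n) Filter.atTop (nhds c) := by
    rw [tendsto_iff_norm_sub_tendsto_zero]
    exact squeeze_zero (fun _ => norm_nonneg _) (fun n => (ha n).le)
      tendsto_one_div_add_atTop_nhds_zero_nat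
  have hcau : CauchySeq fun n => z * a n := by
    have := hlim.cauchySeq
    rw [Metric.cauchySeq_iff] at this ⊢
    intro ε hε
    obtain ⟨N, hN⟩ := this ε hε
    refine ⟨N, fun m hm n hn => ?_⟩
    rw [dist_eq_norm, ← mul_sub, hnorm, mul_sub, ← dist_eq_norm]
    exact hN m hm n hn
  obtain ⟨y, hy⟩ := cauchySeq_tendsto_of_complete hcau
  refine ⟨y, mem_closure_of_tendsto hy (.of_forall fun n => ⟨a n, rfl⟩), ?_, ?_⟩
  · have l1 : Filter.Tendsto (fun n => star (z * a n) * (z * a n)) Filter.atTop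
        (nhds (star y * y)) := hy.star.mul hy
    have l2 : Filter.Tendsto (fun n => star (r * a n) * (r * a n)) Filter.atTop
        (nhds (star c * c)) := hlim.star.mul hlim
    rw [hcs] at l2
    refine tendsto_nhds_unique l1 (l2.congr fun n => ?_)
    rw [star_mul, star_mul, mul_assoc (star (a n)) (star z), ← mul_assoc (star z), ← hrr, hrs]
    simp only [mul_assoc]
  · refine le_trans ?_ hdiff
    have l1 : Filter.Tendsto (fun n => ‖z * a n - z‖) Filter.atTop (nhds ‖y - z‖) :=
      (hy.sub_const z).norm
    have l2 : Filter.Tendsto (fun n => ‖r * a n - r‖) Filter.atTop (nhds ‖c - r‖) :=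
      (hlim.sub_const r).norm
    refine (tendsto_nhds_unique l1 (l2.congr fun n => ?_)).le
    have := hnorm (a n - 1)
    rw [mul_sub, mul_sub, mul_one, mul_one] at this
    exact this.symm

lemma mul_self_le_of_le_one {e : U} (he0 : 0 ≤ e) (he1 : e ≤ 1) : e * e ≤ e := by
  have hr : star (CFC.sqrt e) = CFC.sqrt e := (IsSelfAdjoint.of_nonneg (CFC.sqrt_nonneg e)).star_eq
  have hrr := CFC.sqrt_mul_sqrt_self e he0
  have h := star_left_conjugate_le_conjugate he1 (CFC.sqrt e)
  rw [hr, mul_one, hrr] at h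
  calc e * e = CFC.sqrt e * e * CFC.sqrt e := by
        conv_lhs => rw [← hrr]
        conv_rhs => enter [1, 2]; rw [← hrr]
        simp only [mul_assoc]
    _ ≤ e := h

/-- If `1 - e²` is small on a positive contraction `h`, then `e` can be multiplied by an element
which almost acts as a unit on `h` to give an element `y` with `y* y` a function of `h`. -/
lemma exists_multiplier (U : Type*) [CStarAlgebra U] {γ : ℝ} (hγ : 0 < γ) : ∃ κ : ℝ, 0 < κ ∧ ∀ h e : U, 0 ≤ h → h ≤ 1 → 0 ≤ e →
    e ≤ 1 → ‖CFC.sqrt h * (1 - e * e) * CFC.sqrt h‖ ≤ κ →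
    ∃ c y : U, y ∈ closure (Set.range fun a => e * a) ∧ star y * y = c * c ∧
      (∀ v, Commute h v → Commute c v) ∧ ‖y‖ ≤ 1 ∧ ‖(1 - y) * CFC.sqrt h‖ ≤ γ := by
  -- Three errors share γ: √(2δ) for cutting h off near 0, √κ for (1 − e)√h, and κ/δ for passing
  -- from e c to y.
  obtain ⟨δ, hδ, hδγ⟩ : ∃ δ : ℝ, 0 < δ ∧ √(2 * δ) ≤ γ / 3 := by
    refine ⟨(γ / 3) ^ 2 / 2, by positivity, ?_⟩
    rw [mul_div_cancel₀ _ two_ne_zero, Real.sqrt_sq (by positivity)]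
  obtain ⟨κ, hκ, hκ1, hκ2, hκ3⟩ : ∃ κ : ℝ, 0 < κ ∧ √κ ≤ γ / 3 ∧ κ / δ ≤ γ / 3 ∧ κ / δ < 1 := by
    refine ⟨min ((γ / 3) ^ 2) (min (γ / 3) (1 / 2) * δ), by positivity, ?_, ?_, ?_⟩
    · exact Real.sqrt_le_iff.2 ⟨by positivity, min_le_left _ _⟩
    · rw [div_le_iff₀ hδ]
      exact (min_le_right _ _).trans (mul_le_mul_of_nonneg_right (min_le_left _ _) hδ.le)
    · rw [div_lt_iff₀ hδ]
      refine ((min_le_right _ _).trans (mul_le_mul_of_nonneg_right (min_le_right _ _) hδ.le)).trans_lt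
        ?_
      linarith
  refine ⟨κ, hκ, fun h e hh0 hh1 he0 he1 hE => ?_⟩
  have hes : star e = e := (IsSelfAdjoint.of_nonneg he0).star_eq
  have hhs : IsSelfAdjoint h := .of_nonneg hh0
  -- f vanishes up to δ and equals 1 from 2δ on. As f vanishes near 0 it can be divided by √t, which
  -- gives g.
  let f : ℝ → ℝ := fun t => min 1 (max 0 ((t - δ) / δ))
  let g : ℝ → ℝ := fun t => f t / √(max t δ)
  have hf : Continuous f := by fun_prop
  have hd : ∀ t : ℝ, √(max t δ) ≠ 0 := fun t =>
    (Real.sqrt_pos.2 (lt_max_of_lt_right hδ)).ne'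
  have hg : Continuous g := by
    refine hf.div (by fun_prop) hd
  have hf0 : ∀ t, 0 ≤ f t := fun t => le_min zero_le_one (le_max_left _ _)
  have hf1 : ∀ t, f t ≤ 1 := fun t => min_le_left _ _
  have hfg : ∀ t, g t * √t = f t := by
    intro t
    rcases le_total t δ with ht | ht
    · have : f t = 0 := by
        have h1 : (t - δ) / δ ≤ 0 := div_nonpos_of_nonpos_of_nonneg (by linarith) hδ.le
        simp [f, max_eq_left h1]
      simp [g, this]
    · have := hd t
      simp only [g]
      rw [max_eq_left ht] at this ⊢
      field_simp
  obtain ⟨s, hs⟩ : ∃ s, s = CFC.sqrt h := ⟨_, rfl⟩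
  rw [← hs] at hE ⊢
  have hs0 : 0 ≤ s := hs ▸ CFC.sqrt_nonneg h
  have hss : star s = s := (IsSelfAdjoint.of_nonneg hs0).star_eq
  have hsh : s * s = h := hs ▸ CFC.sqrt_mul_sqrt_self h
  have hs1 : ‖s‖ ≤ 1 := by
    have := CStarRing.norm_star_mul_self (x := s)
    rw [hss, hsh] at this
    have h2 := (CStarAlgebra.norm_le_one_iff_of_nonneg h hh0).2 hh1
    nlinarith [norm_nonneg s]
  have hsc : s = cfc Real.sqrt h := by
    rw [hs, CFC.sqrt_eq_real_sqrt h, cfcₙ_eq_cfc]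
  obtain ⟨c, hc⟩ : ∃ c, c = cfc f h := ⟨_, rfl⟩
  obtain ⟨m, hm⟩ : ∃ m, m = cfc g h := ⟨_, rfl⟩
  have hms : star m = m := hm ▸ (cfc_predicate (p := IsSelfAdjoint) g h).star_eq
  have hc0 : 0 ≤ c := hc ▸ cfc_nonneg fun t _ => hf0 t
  have hcs : star c = c := (IsSelfAdjoint.of_nonneg hc0).star_eq
  have hc1 : ‖c‖ ≤ 1 := hc ▸ norm_cfc_le zero_le_one fun t _ => by
    rw [Real.norm_of_nonneg (hf0 t)]
    exact hf1 t
  have hcms : c = m * s := by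
    rw [hc, hm, hsc, ← cfc_mul g _ h hg.continuousOn (by fun_prop)]
    simp only [hfg]
  have hcsm : c = s * m := by
    rw [← hcs, hcms, star_mul, hms, hss]
  have hmm : m * m ≤ δ⁻¹ • (c * c) := by
    rw [hc, hm, ← cfc_mul g g h hg.continuousOn hg.continuousOn,
      ← cfc_mul f f h hf.continuousOn hf.continuousOn, ← cfc_smul δ⁻¹ _ h (by fun_prop)]
    refine cfc_mono (fun t _ => ?_) (by fun_prop) (by fun_prop)
    simp only [g, smul_eq_mul]
    rw [div_mul_div_comm, Real.mul_self_sqrt (le_max_of_le_right hδ.le), inv_mul_eq_div]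
    exact div_le_div_of_nonneg_left (mul_nonneg (hf0 t) (hf0 t)) hδ (le_max_right _ _)
  have hE0 : 0 ≤ 1 - e * e := sub_nonneg.2 ((mul_self_le_of_le_one he0 he1).trans he1)
  have hcc : c * c - star (e * c) * (e * c) = c * (1 - e * e) * c := by
    rw [star_mul, hes, hcs]
    noncomm_ring
  have hcE0 : 0 ≤ c * (1 - e * e) * c := by
    have := star_left_conjugate_nonneg hE0 c
    rwa [hcs] at this
  -- Writing c = m s = s m with m = g(h), the left side is m (s(1 − e²)s) m ≤ κ m², and m² ≤ δ⁻¹ c².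
  -- Hence e c satisfies the hypotheses of `exists_star_mul_self_eq`.
  have hcE : c * (1 - e * e) * c ≤ (κ / δ) • (c * c) := by
    have h0 : 0 ≤ s * (1 - e * e) * s := by
      have := star_left_conjugate_nonneg hE0 s
      rwa [hss] at this
    have h1 : star m * (s * (1 - e * e) * s) * m ≤ ‖s * (1 - e * e) * s‖ • (star m * m) :=
      CStarAlgebra.star_left_conjugate_le_norm_smul (.of_nonneg h0)
    have h2 : c * (1 - e * e) * c = star m * (s * (1 - e * e) * s) * m := by
      conv_lhs => enter [1, 1]; rw [hcms]
      conv_lhs => enter [2]; rw [hcsm]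
      rw [hms]
      noncomm_ring
    rw [h2]
    refine h1.trans ?_
    rw [hms]
    have hmm0 : 0 ≤ m * m := by
      have := star_mul_self_nonneg m
      rwa [hms] at this
    refine (smul_le_smul_of_nonneg_right hE hmm0).trans ?_
    rw [div_eq_mul_inv, mul_smul]
    exact smul_le_smul_of_nonneg_left hmm hκ.le
  obtain ⟨y, hy1, hy2, hy3⟩ := exists_star_mul_self_eq (z := e * c) hc0 hc1 (μ := κ / δ)
    (by positivity) hκ3 (by rw [← sub_nonneg, hcc]; exact hcE0)
    (by rw [sub_smul, one_smul, sub_le_comm, hcc]; exact hcE)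
  refine ⟨c, y, closure_mono ?_ hy1, hy2, fun v hv => ?_, ?_, ?_⟩
  · rintro _ ⟨a, rfl⟩
    exact ⟨c * a, (mul_assoc _ _ _).symm⟩
  · rw [hc]
    exact hhs.commute_cfc hv f
  · have h1 := CStarRing.norm_star_mul_self (x := y)
    have h2 := norm_mul_le c c
    rw [← hy2, h1] at h2
    nlinarith [norm_nonneg y, norm_nonneg c]
  · have e1 : (1 - y) * s = (1 - c) * s + (1 - e) * s * c - (y - e * c) * s := by
      have : s * c = c * s := by
        conv_lhs => rw [hcms]
        conv_rhs => rw [hcsm]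
        rw [mul_assoc]
      rw [mul_assoc, this]
      noncomm_ring
    have n1 : ‖(1 - c) * s‖ ≤ γ / 3 := by
      refine le_trans ?_ hδγ
      have : (1 - c) * s = cfc (fun t => (1 - f t) * √t) h := by
        rw [hc, hsc, cfc_mul (fun t => 1 - f t) _ h
          (by exact (continuous_const.sub hf).continuousOn) Real.continuous_sqrt.continuousOn, cfc_sub _ _ h continuousOn_const hf.continuousOn,
          cfc_const_one ℝ h]
      rw [this]
      refine norm_cfc_le (Real.sqrt_nonneg _) fun t _ => ?_
      rw [Real.norm_of_nonneg (mul_nonneg (sub_nonneg.2 (hf1 t)) (Real.sqrt_nonneg t))]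
      rcases le_total t (2 * δ) with ht | ht
      · exact (mul_le_of_le_one_left (Real.sqrt_nonneg t) (sub_le_self _ (hf0 t))).trans
          (Real.sqrt_le_sqrt ht)
      · have : f t = 1 := by
          have h1 : 1 ≤ (t - δ) / δ := by
            rw [le_div_iff₀ hδ]
            linarith
          simp only [f]
          rw [max_eq_right (zero_le_one.trans h1), min_eq_left h1]
        rw [this, sub_self, zero_mul]
        exact Real.sqrt_nonneg _
    have n2 : ‖(1 - e) * s * c‖ ≤ γ / 3 := by
      refine (norm_mul_le _ _).trans ((mul_le_of_le_one_right (norm_nonneg _) hc1).trans ?_)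
      refine le_trans (Real.le_sqrt_of_sq_le ?_) hκ1
      refine le_trans ?_ hE
      rw [sq, ← CStarRing.norm_star_mul_self]
      refine norm_le_of_nonneg_of_le (star_mul_self_nonneg _) ?_
      have h1 : (1 - e) * (1 - e) ≤ 1 - e * e := by
        have h2 : 1 - e * e - (1 - e) * (1 - e) = (e - e * e) + (e - e * e) := by noncomm_ring
        rw [← sub_nonneg, h2]
        have := sub_nonneg.2 (mul_self_le_of_le_one he0 he1)
        exact add_nonneg this this
      have h2 := star_left_conjugate_le_conjugate h1 s
      rw [hss] at h2
      rw [star_mul, star_sub, star_one, hes, hss]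
      simpa only [mul_assoc] using h2
    have n3 : ‖(y - e * c) * s‖ ≤ γ / 3 :=
      (norm_mul_le _ _).trans ((mul_le_of_le_one_right (norm_nonneg _) hs1).trans (hy3.trans hκ2))
    rw [e1]
    linarith [norm_sub_le ((1 - c) * s + (1 - e) * s * c) ((y - e * c) * s),
      norm_add_le ((1 - c) * s) ((1 - e) * s * c)]

end Polar

end DecRank

end

open scoped ComplexOrder TensorProduct ENNReal

noncomputable section

namespace DecRank

/-! ### Descending maps through injective *-homomorphisms. -/

section Injective

open scoped Classical

attribute [local instance 50] CStarAlgebra.spectralOrder CStarAlgebra.spectralOrderedRing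

/-- An injective *-homomorphism reflects positivity. -/
lemma nonneg_of_map_nonneg {S U : Type*} [NonUnitalCStarAlgebra S] [PartialOrder S]
    [StarOrderedRing S] [NonUnitalCStarAlgebra U] [PartialOrder U] [StarOrderedRing U]
    {j : S →⋆ₙₐ[ℂ] U} (hj : Function.Injective j) {a : S} (h : 0 ≤ j a) : 0 ≤ a := by
  have has : IsSelfAdjoint a := hj (by rw [map_star, (IsSelfAdjoint.of_nonneg h).star_eq])
  obtain ⟨b, hb⟩ := exists_eq_star_mul_self (CFC.negPart_nonneg a)
  have hn : star a⁻ = a⁻ := (IsSelfAdjoint.of_nonneg (CFC.negPart_nonneg a)).star_eq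
  have h1 : a⁻ * a * a⁻ = -(star (b * a⁻) * (b * a⁻)) := by
    conv_lhs => enter [1, 2]; rw [← CFC.posPart_sub_negPart a has]
    rw [mul_sub, CFC.negPart_mul_posPart, zero_sub, neg_mul, star_mul, hn]
    conv_lhs => enter [1, 1, 2]; rw [hb]
    simp only [mul_assoc]
  have h2 : 0 ≤ j (a⁻ * a * a⁻) := by
    have := star_left_conjugate_nonneg h (j a⁻)
    rwa [← map_star, hn, ← map_mul, ← map_mul] at this
  rw [h1, map_neg, map_mul, map_star, neg_nonneg] at h2
  have h3 : star (j (b * a⁻)) * j (b * a⁻) = 0 := le_antisymm h2 (star_mul_self_nonneg _)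
  rw [CStarRing.star_mul_self_eq_zero_iff, map_eq_zero_iff j hj] at h3
  have h4 : star a⁻ * a⁻ = 0 := by
    rw [hn]
    conv_lhs => enter [1]; rw [hb]
    rw [mul_assoc, h3, mul_zero]
  rw [CStarRing.star_mul_self_eq_zero_iff] at h4
  rw [← CFC.posPart_sub_negPart a has, h4, sub_zero]
  exact CFC.posPart_nonneg a

variable {F S U : Type*} [NonUnitalCStarAlgebra F] [NonUnitalCStarAlgebra S]
  [NonUnitalCStarAlgebra U]

/-- The amplification of j to matrices is again an injective *-homomorphism, so it reflects
positivity. -/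
lemma IsCompletelyPositive.of_hom_comp {j : S →⋆ₙₐ[ℂ] U} (hj : Function.Injective j)
    {φ : F →ₗ[ℂ] S} (h : IsCompletelyPositive ((j : S →ₗ[ℂ] U) ∘ₗ φ)) :
    IsCompletelyPositive φ := by
  obtain ⟨Ψ, hΨ⟩ := h
  refine ⟨⟨φ, fun k M hM => ?_⟩, rfl⟩
  refine nonneg_of_map_nonneg (j := CStarMatrix.mapₙₐ j) (fun x y hxy => ?_) ?_
  · ext a b
    exact hj (congrFun (congrFun hxy a) b)
  · have h1 := Ψ.map_cstarMatrix_nonneg' k M hM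
    rw [hΨ] at h1
    exact h1

/-- A completely positive map with values in the range of an injective *-homomorphism. -/
lemma IsCompletelyPositive.exists_hom_comp_eq {j : S →⋆ₙₐ[ℂ] U} (hj : Function.Injective j)
    {φ : F →ₗ[ℂ] U} (h : IsCompletelyPositive φ) (hφ : ∀ x, φ x ∈ Set.range j) :
    ∃ φ' : F →ₗ[ℂ] S, IsCompletelyPositive φ' ∧ ∀ x, j (φ' x) = φ x := by
  choose f hf using hφ
  let φ' : F →ₗ[ℂ] S :=
    { toFun := f
      map_add' := fun x y => hj (by rw [map_add, hf, hf, hf, map_add])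
      map_smul' := fun t x => hj (by rw [RingHom.id_apply, map_smul, hf, hf, map_smul]) }
  refine ⟨φ', .of_hom_comp hj ?_, hf⟩
  have : (j : S →ₗ[ℂ] U) ∘ₗ φ' = φ := LinearMap.ext hf
  rwa [this]

lemma OrderZeroOn.of_hom_comp {ι : Type} [Fintype ι] {n : ι → Type} [∀ i, Fintype (n i)]
    {κ : Type*} {c : ι → κ} {j : S →⋆ₙₐ[ℂ] U} (hj : Function.Injective j)
    {φ : Blocks n →ₗ[ℂ] U} {φ' : Blocks n →ₗ[ℂ] S} (h : OrderZeroOn c φ)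
    (hφ : ∀ x, j (φ' x) = φ x) : OrderZeroOn c φ' where
  block i x y hxy := hj (by
    rw [map_mul, map_zero, blockMap_apply, blockMap_apply, hφ, hφ]
    exact h.block i x y hxy)
  orthogonal i k hik hc x y := hj (by
    rw [map_mul, map_zero, blockMap_apply, blockMap_apply, hφ, hφ]
    exact h.orthogonal i k hik hc x y)

end Injective

/-! ### Conjugating the colours of an order zero map by multipliers. -/

section Multiplier

open scoped Classical

attribute [local instance 50] CStarAlgebra.spectralOrder CStarAlgebra.spectralOrderedRing

/-- Since ψ(x) ψ(x)* ≤ ‖x‖² ψ(e), multiplication by w on the whole range is controlled by its effect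
on ψ(e)^{1/2}, with no dependence on the dimension of the domain. -/
lemma IsCPC.norm_mul_map_le {F U : Type*} [NonUnitalCStarAlgebra F] [NonUnitalCStarAlgebra U]
    {ψ : F →ₗ[ℂ] U} (hψ : IsCPC ψ) {e : F} (hes : star e = e) (he : ∀ x, e * x = x) (w : U)
    (x : F) : ‖w * ψ x‖ ≤ ‖x‖ * ‖w * CFC.sqrt (ψ e)‖ := by
  have h0 : 0 ≤ ψ e := by
    have := hψ.1.map_star_mul_self_nonneg e
    rwa [hes, he] at this
  have hs : star (CFC.sqrt (ψ e)) = CFC.sqrt (ψ e) :=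
    (IsSelfAdjoint.of_nonneg (CFC.sqrt_nonneg (ψ e))).star_eq
  have h1 : ψ x * star (ψ x) ≤ (‖x‖ ^ 2) • ψ e := by
    have := hψ.star_map_mul_map_le (star x)
    rw [hψ.1.map_star, star_star, star_star] at this
    refine this.trans ?_
    have := hψ.1.norm_map_star_mul_self_le hes he (star x)
    rwa [star_star, norm_star] at this
  have h2 : w * ψ x * star (w * ψ x) ≤
      (‖x‖ ^ 2) • (w * CFC.sqrt (ψ e) * star (w * CFC.sqrt (ψ e))) := by
    have := star_right_conjugate_le_conjugate h1 w
    rw [mul_smul_comm, smul_mul_assoc] at this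
    rw [star_mul, star_mul, hs, mul_assoc w (CFC.sqrt (ψ e)), ← mul_assoc (CFC.sqrt (ψ e)),
      CFC.sqrt_mul_sqrt_self (ψ e) h0]
    simpa only [mul_assoc] using this
  have h3 := norm_le_of_nonneg_of_le (mul_star_self_nonneg _) h2
  rw [norm_smul, CStarRing.norm_self_mul_star, CStarRing.norm_self_mul_star,
    Real.norm_of_nonneg (by positivity)] at h3
  refine (mul_self_le_mul_self_iff (by positivity) (by positivity)).2 (h3.trans (le_of_eq ?_))
  ring

variable {ι : Type} [Fintype ι] {n : ι → Type} [∀ i, Fintype (n i)] {κ : Type}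

/-- The projection onto the sum of the summands of one colour. -/
def colourProj (c : ι → κ) (j : κ) : Blocks n →⋆ₙₐ[ℂ] Blocks n where
  toFun x i := if c i = j then x i else 0
  map_smul' t x := by ext1 i; simp only [Pi.smul_apply]; split_ifs <;> simp
  map_zero' := by ext1 i; simp
  map_add' x y := by ext1 i; simp only [Pi.add_apply]; split_ifs <;> simp
  map_mul' x y := by ext1 i; simp only [Pi.mul_apply]; split_ifs <;> simp
  map_star' x := by ext1 i; simp only [Pi.star_apply]; split_ifs <;> simp

lemma colourProj_apply (c : ι → κ) (j : κ) (x : Blocks n) (i : ι) :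
    colourProj c j x i = if c i = j then x i else 0 := rfl

lemma colourProj_blockIncl (c : ι → κ) (j : κ) (i : ι) (x : CStarMatrix (n i) (n i) ℂ) :
    colourProj c j (blockIncl i x : Blocks n) = if c i = j then blockIncl i x else 0 := by
  ext1 k
  rw [colourProj_apply]
  by_cases hk : k = i
  · subst hk
    split_ifs <;> rfl
  · rw [blockIncl_of_ne hk, ite_self]
    split_ifs
    · rw [blockIncl_of_ne hk]
    · rfl

lemma sum_colourProj [Fintype κ] (c : ι → κ) (x : Blocks n) : ∑ j, colourProj c j x = x := by
  ext1 i
  rw [Finset.sum_apply]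
  simp only [colourProj_apply]
  rw [Finset.sum_ite_eq, if_pos (Finset.mem_univ _)]

variable {U : Type*} [CStarAlgebra U]

/-- The other blocks of the colour are orthogonal to block i, so only the unit of block i
contributes; there the two products agree because 1 x = x 1. -/
lemma OrderZeroOn.map_colourProj_one_mul {c : ι → κ} {φ : Blocks n →ₗ[ℂ] U}
    (h : OrderZeroOn c φ) (i : ι) (x : CStarMatrix (n i) (n i) ℂ) :
    Commute (φ (colourProj c (c i) 1)) (blockMap φ i x) := by
  have h1 : φ (colourProj c (c i) 1) * blockMap φ i x = blockMap φ i 1 * blockMap φ i x := by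
    rw [map_eq_sum_blockMap φ, Finset.sum_mul, Finset.sum_eq_single i]
    · rw [colourProj_apply, if_pos rfl]
      rfl
    · intro k _ hk
      rw [colourProj_apply]
      split_ifs with hc
      · exact h.orthogonal k i hk hc _ _
      · rw [map_zero, zero_mul]
    · exact fun hi => absurd (Finset.mem_univ i) hi
  have h2 : blockMap φ i x * φ (colourProj c (c i) 1) = blockMap φ i x * blockMap φ i 1 := by
    rw [map_eq_sum_blockMap φ, Finset.mul_sum, Finset.sum_eq_single i]
    · rw [colourProj_apply, if_pos rfl]
      rfl
    · intro k _ hk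
      rw [colourProj_apply]
      split_ifs with hc
      · exact h.orthogonal i k (Ne.symm hk) hc.symm _ _
      · rw [map_zero, mul_zero]
    · exact fun hi => absurd (Finset.mem_univ i) hi
  rw [Commute, SemiconjBy, h1, h2]
  exact (h.block i).map_mul_map_congr (by rw [one_mul, mul_one])

/-- Conjugation of the parts of the different colours by different elements. -/
def twist [Fintype κ] (c : ι → κ) (y : κ → U) (φ : Blocks n →ₗ[ℂ] U) : Blocks n →ₗ[ℂ] U :=
  ∑ j, conjMap (y j) ∘ₗ φ ∘ₗ (colourProj (n := n) c j : Blocks n →ₗ[ℂ] Blocks n)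

lemma twist_apply [Fintype κ] (c : ι → κ) (y : κ → U) (φ : Blocks n →ₗ[ℂ] U) (x : Blocks n) :
    twist c y φ x = ∑ j, y j * φ (colourProj c j x) * star (y j) := by
  rw [twist, LinearMap.sum_apply]
  exact Finset.sum_congr rfl fun j _ => conjMap_apply _ _

lemma blockMap_twist [Fintype κ] (c : ι → κ) (y : κ → U) (φ : Blocks n →ₗ[ℂ] U) (i : ι)
    (x : CStarMatrix (n i) (n i) ℂ) :
    blockMap (twist c y φ) i x = y (c i) * blockMap φ i x * star (y (c i)) := by
  rw [blockMap_apply, twist_apply, Finset.sum_eq_single (c i)]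
  · rw [colourProj_blockIncl, if_pos rfl]
    rfl
  · intro j _ hj
    rw [colourProj_blockIncl, if_neg (Ne.symm hj), map_zero, mul_zero, zero_mul]
  · exact fun hi => absurd (Finset.mem_univ _) hi

lemma isCompletelyPositive_twist [Fintype κ] (c : ι → κ) (y : κ → U) {φ : Blocks n →ₗ[ℂ] U}
    (hφ : IsCompletelyPositive φ) : IsCompletelyPositive (twist c y φ) :=
  .sum _ fun j => (isCompletelyPositive_conjMap (y j)).comp
    (hφ.comp (isCompletelyPositive_hom (A := Blocks n) (B := Blocks n) (colourProj (n := n) c j)))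

/-- Between two conjugated images stands y* y = d², and d commutes with the images of its colour. It
can be moved aside, leaving a product that already vanishes. -/
lemma OrderZeroOn.twist [Fintype κ] {c : ι → κ} {y : κ → U} {φ : Blocks n →ₗ[ℂ] U}
    (h : OrderZeroOn c φ) {d : κ → U} (hy : ∀ j, star (y j) * y j = d j * d j)
    (hd : ∀ j v, Commute (φ (colourProj c j 1)) v → Commute (d j) v) :
    OrderZeroOn c (DecRank.twist c y φ) := by
  have key : ∀ i k (x : CStarMatrix (n i) (n i) ℂ) (x' : CStarMatrix (n k) (n k) ℂ), c i = c k →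
      blockMap φ i x * blockMap φ k x' = 0 →
      blockMap (DecRank.twist c y φ) i x * blockMap (DecRank.twist c y φ) k x' = 0 := by
    intro i k x x' hc h0
    have hcomm : Commute (d (c i)) (blockMap φ i x) := hd _ _ (h.map_colourProj_one_mul i x)
    have h1 : blockMap φ i x * (star (y (c i)) * y (c i)) * blockMap φ k x' = 0 := by
      rw [hy, ← (hcomm.mul_left hcomm).eq, mul_assoc, h0, mul_zero]
    rw [blockMap_twist, blockMap_twist, ← hc]
    calc _ = y (c i) * (blockMap φ i x * (star (y (c i)) * y (c i)) * blockMap φ k x') *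
          star (y (c i)) := by simp only [mul_assoc]
      _ = 0 := by rw [h1, mul_zero, zero_mul]
  exact ⟨fun i x x' hx => key i i x x' rfl (h.block i x x' hx),
    fun i k hik hc x x' => key i k x x' hc (h.orthogonal i k hik hc x x')⟩

/-- y v y* − v = −(1 − y) v y* − v (1 − y)*, where v is the image of one colour. Each term is at
most γ‖x‖, the second one after taking adjoints. -/
lemma norm_twist_sub_le {N : ℕ} {c : ι → Fin (N + 1)} {y : Fin (N + 1) → U} {φ : Blocks n →ₗ[ℂ] U}
    (hφ : IsCPC φ) {γ : ℝ} (hy1 : ∀ j, ‖y j‖ ≤ 1)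
    (hy : ∀ j, ‖(1 - y j) * CFC.sqrt (φ (colourProj c j 1))‖ ≤ γ) (x : Blocks n) :
    ‖twist c y φ x - φ x‖ ≤ (N + 1) * (2 * γ) * ‖x‖ := by
  have hψ : ∀ j, IsCPC (φ ∘ₗ (colourProj (n := n) c j : Blocks n →ₗ[ℂ] Blocks n)) := fun j =>
    hφ.comp (isCPC_hom (A := Blocks n) (B := Blocks n) (colourProj (n := n) c j))
  have h1 : ∀ j x, ‖(1 - y j) * φ (colourProj c j x)‖ ≤ γ * ‖x‖ := fun j x => by
    have := (hψ j).norm_mul_map_le (star_one _) one_mul (1 - y j) x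
    rw [mul_comm γ]
    exact this.trans (mul_le_mul_of_nonneg_left (hy j) (norm_nonneg x))
  have h2 : ∀ j, ‖y j * φ (colourProj c j x) * star (y j) - φ (colourProj c j x)‖ ≤
      2 * γ * ‖x‖ := by
    intro j
    have e : y j * φ (colourProj c j x) * star (y j) - φ (colourProj c j x) =
        -((1 - y j) * φ (colourProj c j x) * star (y j) +
          star ((1 - y j) * φ (colourProj c j (star x)))) := by
      rw [star_mul, ← hφ.1.map_star, ← map_star (colourProj c j), star_star, star_sub, star_one]
      noncomm_ring
    rw [e, norm_neg]
    have n1 : ‖(1 - y j) * φ (colourProj c j x) * star (y j)‖ ≤ γ * ‖x‖ := by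
      refine (norm_mul_le _ _).trans (le_trans ?_ (h1 j x))
      rw [norm_star]
      exact mul_le_of_le_one_right (norm_nonneg _) (hy1 j)
    have n2 := h1 j (star x)
    rw [← norm_star ((1 - y j) * _)] at n2
    have n3 : ‖star x‖ = ‖x‖ := norm_star x
    rw [n3] at n2
    linarith [norm_add_le ((1 - y j) * φ (colourProj c j x) * star (y j))
      (star ((1 - y j) * φ (colourProj c j (star x))))]
  have h3 : φ x = ∑ j, φ (colourProj c j x) := by rw [← map_sum, sum_colourProj]
  rw [h3, twist_apply, ← Finset.sum_sub_distrib]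
  refine (norm_sum_le_of_le _ fun j _ => h2 j).trans (le_of_eq ?_)
  rw [Finset.sum_const, Finset.card_univ, Fintype.card_fin, nsmul_eq_mul]
  push_cast
  ring

end Multiplier

end DecRank

end

open scoped ComplexOrder TensorProduct ENNReal

noncomputable section

namespace DecRank

/-! ### Moving an order zero map into a hereditary subalgebra. -/

section Hereditary

open scoped Classical

attribute [local instance 50] CStarAlgebra.spectralOrder CStarAlgebra.spectralOrderedRing

variable {A : Type*} [NonUnitalCStarAlgebra A]

/-- For w ≥ 0, 0 ≤ e w e ≤ ‖w‖ e² ∈ S; positive elements span A. -/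
lemma IsHereditary.mul_mul_mem {S : NonUnitalStarSubalgebra ℂ A} (hS : IsHereditary S) {e : A}
    (he : e ∈ S) (hes : star e = e) (w : A) : e * w * e ∈ S := by
  have hw : w ∈ Submodule.span ℂ {a : A | 0 ≤ a} := by
    rw [CStarAlgebra.span_nonneg]
    trivial
  induction hw using Submodule.span_induction with
  | mem w hw =>
    have hw0 : (0 : A) ≤ w := hw
    have h1 := star_left_conjugate_nonneg hw0 e
    have h2 := CStarAlgebra.star_left_conjugate_le_norm_smul (a := e) (b := w) (.of_nonneg hw0)
    rw [hes] at h1 h2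
    refine hS _ _ h1 h2 ?_
    have h3 : ‖w‖ • (e * e) = (‖w‖ : ℂ) • (e * e) := (Complex.coe_smul ‖w‖ (e * e)).symm
    rw [h3]
    exact S.smul_mem _ (S.mul_mem he he)
  | zero =>
    rw [mul_zero, zero_mul]
    exact S.zero_mem
  | add x y _ _ hx hy =>
    rw [mul_add, add_mul]
    exact S.add_mem hx hy
  | smul t x _ hx =>
    rw [mul_smul_comm, smul_mul_assoc]
    exact S.smul_mem t hx

lemma exists_inr_eq_conj (a : Unitization ℂ A) (v : A) :
    ∃ w : A, a * (v : Unitization ℂ A) * star a = w := by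
  refine ⟨(a * (v : Unitization ℂ A) * star a).snd, Unitization.ext ?_ ?_⟩
  · simp
  · simp

/-- The inclusion of a subalgebra into the unitization. -/
def inclUnitization (S : NonUnitalStarSubalgebra ℂ A) : S →⋆ₙₐ[ℂ] Unitization ℂ A :=
  (Unitization.inrNonUnitalStarAlgHom ℂ A).comp (NonUnitalStarSubalgebraClass.subtype S)

lemma inclUnitization_apply (S : NonUnitalStarSubalgebra ℂ A) (x : S) :
    inclUnitization S x = ((x : A) : Unitization ℂ A) := rfl

lemma inclUnitization_injective (S : NonUnitalStarSubalgebra ℂ A) :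
    Function.Injective (inclUnitization S) := fun _ _ h =>
  Subtype.ext (Unitization.inr_injective h)

/-- For y = e a the element is e (a v a*) e with a v a* ∈ A, as A is an ideal of its unitization.
The limit stays in the range, which is closed because an injective *-homomorphism is isometric. -/
lemma IsHereditary.conj_mem_range {S : NonUnitalStarSubalgebra ℂ A} [hcl : IsClosed (S : Set A)]
    (hS : IsHereditary S) {e : A} (he : e ∈ S) (hes : star e = e) {y : Unitization ℂ A}
    (hy : y ∈ closure (Set.range fun a => (e : Unitization ℂ A) * a)) (v : A) :
    y * (v : Unitization ℂ A) * star y ∈ Set.range (inclUnitization S) := by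
  have hc : IsClosed (Set.range (inclUnitization S)) :=
    (NonUnitalStarAlgHom.isometry (inclUnitization S)
      (inclUnitization_injective S)).isClosedEmbedding.isClosed_range
  rw [← hc.closure_eq]
  refine map_mem_closure (f := fun y : Unitization ℂ A => y * (v : Unitization ℂ A) * star y)
    (by fun_prop) hy ?_
  rintro _ ⟨a, rfl⟩
  obtain ⟨w, hw⟩ := exists_inr_eq_conj a v
  refine ⟨⟨e * w * e, hS.mul_mul_mem he hes w⟩, ?_⟩
  rw [inclUnitization_apply]
  change ((e * w * e : A) : Unitization ℂ A) = e * a * v * star (e * a)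
  rw [Unitization.inr_mul, Unitization.inr_mul, ← hw, star_mul, ← Unitization.inr_star, hes]
  simp only [mul_assoc]

/-- An estimate for `1 - e²` on a positive element which is approximately dominated by `d²`. -/
lemma norm_sqrt_mul_mul_sqrt_le {U : Type*} [CStarAlgebra U] {h p d e : U} {η : ℝ}
    (hh0 : 0 ≤ h) (hhp : h ≤ p + p) (hpd : ‖p - d * d‖ ≤ η) (hds : star d = d)
    (hd1 : ‖d‖ ≤ 1) (he0 : 0 ≤ e) (he1 : e ≤ 1) (hed : ‖e * d - d‖ ≤ η) :
    ‖CFC.sqrt h * (1 - e * e) * CFC.sqrt h‖ ≤ 6 * η := by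
  have hE0 : 0 ≤ 1 - e * e := sub_nonneg.2 ((mul_self_le_of_le_one he0 he1).trans he1)
  have hes : star e = e := (IsSelfAdjoint.of_nonneg he0).star_eq
  have hen : ‖e‖ ≤ 1 := (CStarAlgebra.norm_le_one_iff_of_nonneg e he0).2 he1
  -- The C*-identity turns the norm into that of R h R. Here h ≤ 2p and p ≈ d², while R d is small
  -- because e d ≈ d; the total is 2(η + 2η).
  obtain ⟨R, hR⟩ : ∃ R, R = CFC.sqrt (1 - e * e) := ⟨_, rfl⟩
  have hR0 : 0 ≤ R := hR ▸ CFC.sqrt_nonneg _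
  have hRs : star R = R := (IsSelfAdjoint.of_nonneg hR0).star_eq
  have hRR : R * R = 1 - e * e := hR ▸ CFC.sqrt_mul_sqrt_self _ hE0
  have hR1 : ‖R‖ ≤ 1 := by
    have h1 := CStarRing.norm_star_mul_self (x := R)
    have h2 := (CStarAlgebra.norm_le_one_iff_of_nonneg _ hE0).2 (sub_le_self 1 (by
      have := star_mul_self_nonneg e
      rwa [hes] at this))
    rw [hRs, hRR] at h1
    nlinarith [norm_nonneg R]
  have hs : star (CFC.sqrt h) = CFC.sqrt h :=
    (IsSelfAdjoint.of_nonneg (CFC.sqrt_nonneg h)).star_eq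
  have e1 : CFC.sqrt h * (1 - e * e) * CFC.sqrt h = star (R * CFC.sqrt h) * (R * CFC.sqrt h) := by
    rw [star_mul, hs, hRs, ← hRR]
    simp only [mul_assoc]
  have e2 : R * CFC.sqrt h * star (R * CFC.sqrt h) = R * h * R := by
    rw [star_mul, hs, hRs, mul_assoc, ← mul_assoc (CFC.sqrt h), CFC.sqrt_mul_sqrt_self h hh0,
      mul_assoc]
  rw [e1, CStarRing.norm_star_mul_self, ← CStarRing.norm_self_mul_star, e2]
  have h1 : R * h * R ≤ R * (p + p) * R := by
    have := star_left_conjugate_le_conjugate hhp R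
    rwa [hRs] at this
  have h0 : 0 ≤ R * h * R := by
    have := star_left_conjugate_nonneg hh0 R
    rwa [hRs] at this
  refine (norm_le_of_nonneg_of_le h0 h1).trans ?_
  have n1 : ‖R * (p - d * d) * R‖ ≤ η := by
    refine (norm_mul_le _ _).trans ((mul_le_of_le_one_right (norm_nonneg _) hR1).trans ?_)
    exact (norm_mul_le _ _).trans ((mul_le_of_le_one_left (norm_nonneg _) hR1).trans hpd)
  have n2 : ‖R * (d * d) * R‖ ≤ 2 * η := by
    have e3 : R * (d * d) * R = R * d * star (R * d) := by
      rw [star_mul, hRs, hds]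
      simp only [mul_assoc]
    have e4 : star (R * d) * (R * d) = -(d * (e * d - d)) - star (e * d - d) * (e * d) := by
      rw [star_mul, hRs, hds, star_sub, star_mul, hds, hes, mul_assoc, ← mul_assoc R, hRR]
      noncomm_ring
    rw [e3, CStarRing.norm_self_mul_star, ← CStarRing.norm_star_mul_self, e4]
    have m1 : ‖d * (e * d - d)‖ ≤ η :=
      (norm_mul_le _ _).trans ((mul_le_of_le_one_left (norm_nonneg _) hd1).trans hed)
    have m2 : ‖star (e * d - d) * (e * d)‖ ≤ η := by
      refine (norm_mul_le _ _).trans ?_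
      rw [norm_star]
      refine (mul_le_of_le_one_right (norm_nonneg _) ?_).trans hed
      exact (norm_mul_le _ _).trans (mul_le_one₀ hen (norm_nonneg _) hd1)
    have := norm_sub_le (-(d * (e * d - d))) (star (e * d - d) * (e * d))
    rw [norm_neg] at this
    linarith
  have e5 : R * (p + p) * R = (R * (p - d * d) * R + R * (d * d) * R) +
      (R * (p - d * d) * R + R * (d * d) * R) := by noncomm_ring
  rw [e5]
  linarith [norm_add_le (R * (p - d * d) * R + R * (d * d) * R)
    (R * (p - d * d) * R + R * (d * d) * R), norm_add_le (R * (p - d * d) * R) (R * (d * d) * R)]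

/-- A map of order zero whose range is almost contained in a hereditary subalgebra can be perturbed
to a map into the subalgebra. -/
lemma IsHereditary.exists_orderZeroOn {S : NonUnitalStarSubalgebra ℂ A} [IsClosed (S : Set A)]
    (hS : IsHereditary S) (N : ℕ) {γ : ℝ} (hγ : 0 < γ) : ∃ η : ℝ, 0 < η ∧
      ∀ (ι : Type) [Fintype ι] (n : ι → Type) [∀ i, Fintype (n i)] (φ : Blocks n →ₗ[ℂ] A)
        (c : ι → Fin (N + 1)) (p d e : A), IsCPC φ → OrderZeroOn c φ → φ 1 ≤ p + p →
        ‖p - d * d‖ ≤ η → star d = d → ‖d‖ ≤ 1 → 0 ≤ e → ‖e‖ ≤ 1 → ‖e * d - d‖ ≤ η → e ∈ S →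
        ∃ φ' : Blocks n →ₗ[ℂ] S, IsCPC φ' ∧ OrderZeroOn c φ' ∧
          ∀ x, ‖(φ' x : A) - φ x‖ ≤ γ * ‖x‖ := by
  -- One τ for the twist and one for restoring contractivity by the factor (1 + τ)⁻¹.
  obtain ⟨τ, hτ, hτγ⟩ : ∃ τ : ℝ, 0 < τ ∧ 2 * τ = γ := ⟨γ / 2, by positivity, by ring⟩
  obtain ⟨γ', hγ', hγτ⟩ : ∃ γ' : ℝ, 0 < γ' ∧ (N + 1) * (2 * γ') = τ :=
    ⟨τ / (2 * (N + 1)), by positivity, by field_simp⟩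
  obtain ⟨κ, hκ, H⟩ := exists_multiplier (Unitization ℂ A) hγ'
  -- 6 is the constant of `norm_sqrt_mul_mul_sqrt_le`. The tolerance is fixed before F and φ are
  -- given, depending only on N and γ, so an approximation may be chosen afterwards.
  refine ⟨κ / 6, by positivity, ?_⟩
  intro ι _ n _ φ c p d e hφ hc hp hpd hds hd1 he0 he1 hed heS
  have hes : star e = e := (IsSelfAdjoint.of_nonneg he0).star_eq
  obtain ⟨χ, hχ⟩ : ∃ χ : Blocks n →ₗ[ℂ] Unitization ℂ A, χ =
      (Unitization.inrNonUnitalStarAlgHom ℂ A : A →ₗ[ℂ] Unitization ℂ A) ∘ₗ φ := ⟨_, rfl⟩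
  have hχa : ∀ x, χ x = (φ x : Unitization ℂ A) := fun x => by rw [hχ]; rfl
  have hχ1 : IsCPC χ := hχ ▸ (isCPC_hom _).comp hφ
  have hχ2 : OrderZeroOn c χ := hχ ▸ hc.hom_comp _
  have he0' : 0 ≤ (e : Unitization ℂ A) := Unitization.inr_nonneg_iff.2 he0
  have he1' : (e : Unitization ℂ A) ≤ 1 := by
    rw [← CStarAlgebra.norm_le_one_iff_of_nonneg _ he0', Unitization.norm_inr]
    exact he1
  have hp' : χ 1 ≤ (p : Unitization ℂ A) + p := by
    rw [← sub_nonneg, hχa, ← Unitization.inr_add, ← Unitization.inr_sub]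
    exact Unitization.inr_nonneg_iff.2 (sub_nonneg.2 hp)
  have hcol0 : ∀ j, 0 ≤ χ (colourProj c j 1) := fun j => by
    have := hχ1.1.map_star_mul_self_nonneg (colourProj c j (1 : Blocks n))
    rwa [← map_star (colourProj c j), ← map_mul (colourProj c j), star_one, one_mul] at this
  have hcol1 : ∀ j, χ (colourProj c j 1) ≤ χ 1 := fun j => by
    have := hχ1.1.map_star_mul_self_nonneg (1 - colourProj c j (1 : Blocks n))
    have h1 : star (1 - colourProj c j (1 : Blocks n)) * (1 - colourProj c j (1 : Blocks n)) =
        1 - colourProj c j (1 : Blocks n) := by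
      rw [star_sub, ← map_star (colourProj c j), star_one, mul_sub, sub_mul, sub_mul,
        ← map_mul (colourProj c j), one_mul, one_mul, mul_one]
      abel
    rw [h1, map_sub] at this
    exact sub_nonneg.1 this
  have hχ11 : χ 1 ≤ 1 := by
    have h0 : 0 ≤ χ 1 := by
      have := hχ1.1.map_star_mul_self_nonneg 1
      rwa [star_one, one_mul] at this
    rw [← CStarAlgebra.norm_le_one_iff_of_nonneg _ h0]
    exact (hχ1.2 1).trans norm_blocks_one_le
  have hE : ∀ j, ‖CFC.sqrt (χ (colourProj c j 1)) *
      (1 - (e : Unitization ℂ A) * (e : Unitization ℂ A)) *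
        CFC.sqrt (χ (colourProj c j 1))‖ ≤ κ := by
    intro j
    have h6 : 6 * (κ / 6) = κ := by ring
    rw [← h6]
    refine norm_sqrt_mul_mul_sqrt_le (p := (p : Unitization ℂ A)) (d := (d : Unitization ℂ A))
      (hcol0 j) ((hcol1 j).trans hp') ?_ ?_ ?_ he0' he1' ?_
    · rw [← Unitization.inr_mul, ← Unitization.inr_sub, Unitization.norm_inr]
      exact hpd
    · rw [← Unitization.inr_star, hds]
    · rw [Unitization.norm_inr]
      exact hd1
    · rw [← Unitization.inr_mul, ← Unitization.inr_sub, Unitization.norm_inr]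
      exact hed
  -- A separate multiplier for each colour, adapted to the image of the unit of that colour.
  choose b y hy1 hy2 hy3 hy4 hy5 using fun j => H (χ (colourProj c j 1)) e (hcol0 j)
    ((hcol1 j).trans hχ11) he0' he1' (hE j)
  have hrange : ∀ x, twist c y χ x ∈ Set.range (inclUnitization S) := by
    intro x
    rw [twist_apply]
    have : ∑ j, y j * χ (colourProj c j x) * star (y j) ∈
        LinearMap.range (inclUnitization S : S →ₗ[ℂ] Unitization ℂ A) := by
      refine Submodule.sum_mem _ fun j _ => ?_
      obtain ⟨w, hw⟩ := hS.conj_mem_range heS hes (hy1 j) (φ (colourProj c j x))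
      refine ⟨w, ?_⟩
      rw [hχa]
      exact hw
    exact this
  obtain ⟨φ', hφ'1, hφ'2⟩ := (isCompletelyPositive_twist c y hχ1.1).exists_hom_comp_eq
    (inclUnitization_injective S) hrange
  have hφ'3 : OrderZeroOn c φ' :=
    (hχ2.twist hy2 hy3).of_hom_comp (inclUnitization_injective S) hφ'2
  have hφ'4 : ∀ x, ‖(φ' x : A) - φ x‖ ≤ τ * ‖x‖ := by
    intro x
    rw [← hγτ, ← Unitization.norm_inr (𝕜 := ℂ), Unitization.inr_sub, ← inclUnitization_apply,
      hφ'2, ← hχa]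
    exact norm_twist_sub_le hχ1 hy4 hy5 x
  have hφ'5 : ∀ x, ‖φ' x‖ ≤ (1 + τ) * ‖x‖ := by
    intro x
    have h1 := norm_sub_norm_le (φ' x : A) (φ x)
    have h2 := hφ'4 x
    have h3 := hφ.2 x
    have h4 : ‖φ' x‖ = ‖(φ' x : A)‖ := rfl
    linarith
  have hτ1 : 0 < 1 + τ := by positivity
  refine ⟨(((1 + τ)⁻¹ : ℝ) : ℂ) • φ', ⟨hφ'1.smul (by positivity), fun x => ?_⟩, ⟨?_, ?_⟩,
    fun x => ?_⟩
  · change ‖(((1 + τ)⁻¹ : ℝ) : ℂ) • φ' x‖ ≤ _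
    rw [norm_smul, Complex.norm_real, Real.norm_of_nonneg (by positivity),
      inv_mul_le_iff₀ hτ1]
    exact hφ'5 x
  · intro i u v huv
    change ((((1 + τ)⁻¹ : ℝ) : ℂ) • blockMap φ' i u) * ((((1 + τ)⁻¹ : ℝ) : ℂ) • blockMap φ' i v) = 0
    rw [smul_mul_smul_comm, hφ'3.block i u v huv, smul_zero]
  · intro i k hik hck u v
    change ((((1 + τ)⁻¹ : ℝ) : ℂ) • blockMap φ' i u) * ((((1 + τ)⁻¹ : ℝ) : ℂ) • blockMap φ' k v) = 0
    rw [smul_mul_smul_comm, hφ'3.orthogonal i k hik hck u v, smul_zero]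
  · have h1 : ((((((1 + τ)⁻¹ : ℝ) : ℂ) • φ') x : S) : A) - φ x =
        ((φ' x : A) - φ x) - ((τ / (1 + τ) : ℝ) : ℂ) • (φ' x : A) := by
      have h2 : (((1 + τ)⁻¹ : ℝ) : ℂ) = 1 - ((τ / (1 + τ) : ℝ) : ℂ) := by
        rw [← Complex.ofReal_one, ← Complex.ofReal_sub]
        congr 1
        field_simp
        ring
      change (((1 + τ)⁻¹ : ℝ) : ℂ) • (φ' x : A) - φ x = _
      rw [h2, sub_smul, one_smul]
      abel
    rw [h1]
    have n1 : ‖((τ / (1 + τ) : ℝ) : ℂ) • (φ' x : A)‖ ≤ τ * ‖x‖ := by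
      rw [norm_smul, Complex.norm_real, Real.norm_of_nonneg (by positivity), div_mul_eq_mul_div,
        div_le_iff₀ hτ1]
      have := mul_le_mul_of_nonneg_left (hφ'5 x) hτ.le
      change τ * ‖(φ' x : A)‖ ≤ _ at this
      linarith
    rw [← hτγ]
    linarith [norm_sub_le ((φ' x : A) - φ x) (((τ / (1 + τ) : ℝ) : ℂ) • (φ' x : A)), hφ'4 x]

end Hereditary

end DecRank

end

open scoped ComplexOrder TensorProduct ENNReal

noncomputable section

namespace DecRank

/-! ### Cutting a model down to a spectral corner. -/

section Corner

open scoped Classical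

attribute [local instance 50] CStarAlgebra.spectralOrder CStarAlgebra.spectralOrderedRing

variable {A : Type*} [NonUnitalCStarAlgebra A]

/-- y(1 − p)y* ≤ 4 y(1 − a)²y*, and the norm of the left side is ‖y(1 − p)‖². The weight l enters
squared on one side and once on the other, which l ≤ 1 absorbs. -/
lemma mul_norm_mul_one_sub_le {m : Type} [Fintype m] {a p r y : CStarMatrix m m ℂ}
    (hps : star p = p) (hpp : p * p = p)
    (hr : (4 : ℂ) • ((1 - a) * (1 - a)) - (1 - p) = star r * r) {l κ : ℝ} (hl0 : 0 ≤ l)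
    (hl1 : l ≤ 1) (hκ : 0 ≤ κ) (h : l * ‖y * ((1 - a) * (1 - a)) * star y‖ ≤ κ ^ 2) :
    l * ‖y * (1 - p)‖ ≤ 2 * κ := by
  have h1 : y * (1 - p) * star (y * (1 - p)) ≤ (4 : ℂ) • (y * ((1 - a) * (1 - a)) * star y) := by
    have e1 : y * (1 - p) * star (y * (1 - p)) = y * (1 - p) * star y := by
      have : (1 - p) * (1 - p) = 1 - p := by
        rw [mul_sub, sub_mul, sub_mul, hpp, one_mul, one_mul, mul_one]
        abel
      rw [star_mul, star_sub, star_one, hps, mul_assoc, ← mul_assoc (1 - p), this, mul_assoc]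
    have e : (4 : ℂ) • (y * ((1 - a) * (1 - a)) * star y) - y * (1 - p) * star (y * (1 - p)) =
        star (r * star y) * (r * star y) := by
      rw [e1]
      generalize (1 - a) * (1 - a) = q at hr ⊢
      generalize 1 - p = u at hr ⊢
      rw [star_mul, star_star, mul_assoc y (star r), ← mul_assoc (star r), ← hr, sub_mul,
        mul_sub, smul_mul_assoc, mul_smul_comm, mul_assoc, mul_assoc]
    rw [← sub_nonneg, e]
    exact star_mul_self_nonneg _
  have h2 := (CStarRing.norm_self_mul_star (x := y * (1 - p))).symm.trans_le
    (norm_le_of_nonneg_of_le (mul_star_self_nonneg _) h1)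
  rw [norm_smul] at h2
  have h3 : ‖(4 : ℂ)‖ = 4 := by norm_num
  rw [h3] at h2
  refine (mul_self_le_mul_self_iff (by positivity) (by positivity)).2 ?_
  calc l * ‖y * (1 - p)‖ * (l * ‖y * (1 - p)‖) = l * (l * (‖y * (1 - p)‖ * ‖y * (1 - p)‖)) := by ring
    _ ≤ l * (‖y * (1 - p)‖ * ‖y * (1 - p)‖) :=
        mul_le_of_le_one_left (by positivity) hl1
    _ ≤ l * (4 * ‖y * ((1 - a) * (1 - a)) * star y‖) := mul_le_mul_of_nonneg_left h2 hl0
    _ ≤ 2 * κ * (2 * κ) := by linarith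

variable {ι : Type} [Fintype ι] {n k : ι → Type} [∀ i, Fintype (n i)] [∀ i, Fintype (k i)]

/-- A blockwise *-homomorphism. -/
def blocksHom (f : ∀ i, CStarMatrix (k i) (k i) ℂ →⋆ₙₐ[ℂ] CStarMatrix (n i) (n i) ℂ) :
    Blocks k →⋆ₙₐ[ℂ] Blocks n where
  toFun z i := f i (z i)
  map_smul' t z := by ext1 i; exact map_smul (f i) t (z i)
  map_zero' := by ext1 i; exact map_zero (f i)
  map_add' z z' := by ext1 i; exact map_add (f i) (z i) (z' i)
  map_mul' z z' := by ext1 i; exact map_mul (f i) (z i) (z' i)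
  map_star' z := by ext1 i; exact map_star (f i) (z i)

lemma blocksHom_apply (f : ∀ i, CStarMatrix (k i) (k i) ℂ →⋆ₙₐ[ℂ] CStarMatrix (n i) (n i) ℂ)
    (z : Blocks k) (i : ι) : blocksHom f z i = f i (z i) := rfl

lemma blocksHom_blockIncl (f : ∀ i, CStarMatrix (k i) (k i) ℂ →⋆ₙₐ[ℂ] CStarMatrix (n i) (n i) ℂ)
    (i : ι) (x : CStarMatrix (k i) (k i) ℂ) :
    blocksHom f (blockIncl i x) = blockIncl i (f i x) := by
  ext1 j
  rw [blocksHom_apply]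
  by_cases hj : j = i
  · subst hj
    rw [blockIncl_same, blockIncl_same]
  · rw [blockIncl_of_ne hj, blockIncl_of_ne hj, map_zero]

lemma OrderZeroOn.comp_blocksHom {κ : Type*} {c : ι → κ} {φ : Blocks n →ₗ[ℂ] A}
    (h : OrderZeroOn c φ)
    (f : ∀ i, CStarMatrix (k i) (k i) ℂ →⋆ₙₐ[ℂ] CStarMatrix (n i) (n i) ℂ) :
    OrderZeroOn c (φ ∘ₗ (blocksHom f : Blocks k →ₗ[ℂ] Blocks n)) := by
  have key : ∀ i x, blockMap (φ ∘ₗ (blocksHom f : Blocks k →ₗ[ℂ] Blocks n)) i x =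
      blockMap φ i (f i x) := fun i x => congrArg φ (blocksHom_blockIncl f i x)
  constructor
  · intro i x y hxy
    rw [key, key]
    exact h.block i _ _ (by rw [← map_mul, hxy, map_zero])
  · intro i j hij hc x y
    rw [key, key]
    exact h.orthogonal i j hij hc _ _

/-- Elements on which `a` almost acts as a unit can be cut down to the spectral subspace of `a`. -/
lemma OrderZeroOn.exists_corner {N : ℕ} {c : ι → Fin (N + 1)} {φ : Blocks n →ₗ[ℂ] A}
    (hc : OrderZeroOn c φ) (hφ : IsCPC φ) {a w v : Blocks n} (hw : a = star w * w)
    (hv : a - a * a = star v * v) :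
    ∃ (k : ι → Type) (_ : ∀ i, Fintype (k i)) (χ : Blocks k →ₗ[ℂ] A), IsCPC χ ∧ OrderZeroOn c χ ∧
      χ 1 ≤ φ a + φ a ∧ ∀ (y : Blocks n) (κ C : ℝ), 0 ≤ κ → ‖y‖ ≤ C →
        ‖φ (y * star y) - φ (y * a * star y)‖ ≤ κ ^ 2 →
        ‖φ (star y * y) - φ (star y * a * y)‖ ≤ κ ^ 2 →
        ∃ z, ‖z‖ ≤ C ∧ ‖χ z - φ y‖ ≤ (N + 1) * (4 * κ) ∧
          ‖χ (z * star z) - φ (y * star y)‖ ≤ (N + 1) * (8 * C * κ) := by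
  choose k hk f hf h1 h2 h3 using fun i => exists_spectral_corner (a := a i) (c := w i)
    (congrFun hw i)
  choose r hr using h1
  choose r' hr' using h2
  obtain ⟨θ, hθ⟩ : ∃ θ : Blocks k →⋆ₙₐ[ℂ] Blocks n, θ = blocksHom f := ⟨_, rfl⟩
  have hθa : ∀ z i, θ z i = f i (z i) := fun z i => by rw [hθ]; rfl
  have hθi : Function.Injective θ := fun x y hxy => by
    ext1 i
    refine hf i ?_
    rw [← hθa, ← hθa, hxy]
  have has : star a = a := by rw [hw, star_mul, star_star]
  have hl : ∀ i j, ‖blockMap φ i (matUnit j j)‖ ≤ 1 := fun i j =>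
    (hφ.2 _).trans ((NonUnitalStarAlgHom.norm_apply_le (B := Blocks n) (blockIncl (n := n) i) _).trans
      (norm_matUnit_self_le j))
  obtain ⟨p, hp⟩ : ∃ p : Blocks n, p = θ 1 := ⟨_, rfl⟩
  have hps : star p = p := by rw [hp, ← map_star θ, star_one]
  have hpp : p * p = p := by rw [hp, ← map_mul θ, one_mul]
  have hp1 : ‖p‖ ≤ 1 := by
    rw [hp]
    exact (NonUnitalStarAlgHom.norm_apply_le θ _).trans norm_blocks_one_le
  have hpi : ∀ i, p i = f i 1 := fun i => by rw [hp, hθa]; rfl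
  refine ⟨k, hk, φ ∘ₗ (θ : Blocks k →ₗ[ℂ] Blocks n),
    hφ.comp (isCPC_hom (A := Blocks k) (B := Blocks n) θ), ?_, ?_, ?_⟩
  · rw [hθ]
    exact hc.comp_blocksHom f
  · have h4 : (2 : ℂ) • a - p = star r * r := by
      ext1 i
      rw [Pi.sub_apply, hpi]
      exact hr i
    have h5 := hφ.1.map_star_mul_self_nonneg r
    rw [← h4, map_sub, map_smul, two_smul, sub_nonneg, hp] at h5
    exact h5
  intro y κ C hκ hyC hy1 hy2
  have hC : 0 ≤ C := (norm_nonneg y).trans hyC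
  -- As a² ≤ a, φ(y(1 − a)²y*) ≤ φ(y y*) − φ(y a y*), whose norm is at most κ². On each block order
  -- zero bounds the weighted norm of y(1 − a)²y*.
  have key : ∀ y : Blocks n, ‖φ (y * star y) - φ (y * a * star y)‖ ≤ κ ^ 2 →
      ∀ i j, ‖blockMap φ i (matUnit j j)‖ * ‖y i * (1 - p i)‖ ≤ 2 * κ := by
    intro y hy i j
    have e1 : star ((1 - a) * star y) * ((1 - a) * star y) = y * ((1 - a) * (1 - a)) * star y := by
      rw [star_mul, star_star, star_sub, star_one, has]
      simp only [mul_assoc]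
    have e2 : 0 ≤ φ (y * star y) - φ (y * a * star y) - φ (y * ((1 - a) * (1 - a)) * star y) := by
      have h4 := hφ.1.map_star_mul_self_nonneg (v * star y)
      have h5 : star (v * star y) * (v * star y) =
          y * star y - y * a * star y - y * ((1 - a) * (1 - a)) * star y := by
        rw [star_mul, star_star, mul_assoc y, ← mul_assoc (star v), ← hv]
        noncomm_ring
      rwa [h5, map_sub, map_sub] at h4
    have e3 := hc.norm_le hφ.1 ((1 - a) * star y) i j
    have e4 : 0 ≤ φ (y * ((1 - a) * (1 - a)) * star y) := by
      rw [← e1]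
      exact hφ.1.map_star_mul_self_nonneg _
    rw [e1] at e3
    have e5 := e3.trans ((norm_le_of_nonneg_of_le e4 (sub_nonneg.1 e2)).trans hy)
    refine mul_norm_mul_one_sub_le (a := a i) (r := r' i) ?_ ?_ ?_ (norm_nonneg _) (hl i j) hκ e5
    · exact congrFun hps i
    · exact congrFun hpp i
    · rw [hpi]
      exact hr' i
  have hk1 := key y hy1
  have hk2 : ∀ i j, ‖blockMap φ i (matUnit j j)‖ * ‖(1 - p i) * y i‖ ≤ 2 * κ := by
    intro i j
    have h4 := key (star y) (by rwa [star_star]) i j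
    have h5 : ‖(1 - p i) * y i‖ = ‖star y i * (1 - p i)‖ := by
      have h6 : star ((1 - p i) * y i) = star y i * (1 - p i) := by
        rw [star_mul, star_sub, star_one]
        exact congrArg (fun q => star (y i) * (1 - q)) (congrFun hps i)
      rw [← h6]
      exact (norm_star _).symm
    rw [h5]
    exact h4
  choose z hz using fun i => h3 i (y i)
  have hz' : θ z = p * y * p := by
    ext1 i
    rw [hθa, hz, ← hpi]
    rfl
  have hpyp : ‖p * y * p‖ ≤ C :=
    (norm_mul_le _ _).trans ((mul_le_of_le_one_right (norm_nonneg _) hp1).trans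
      ((norm_mul_le _ _).trans ((mul_le_of_le_one_left (norm_nonneg _) hp1).trans hyC)))
  -- y − p y p = y(1 − p) + (1 − p) y p, each term costing 2κ; this is where both y y* and y* y are
  -- needed.
  have hdiff : ∀ i j, ‖blockMap φ i (matUnit j j)‖ * ‖(y - p * y * p) i‖ ≤ 4 * κ := by
    intro i j
    have e : (y - p * y * p) i = y i * (1 - p i) + (1 - p i) * y i * p i := by
      change y i - p i * y i * p i = _
      noncomm_ring
    have hpi1 : ‖p i‖ ≤ 1 := (norm_le_pi_norm p i).trans hp1
    have n1 : ‖(1 - p i) * y i * p i‖ ≤ ‖(1 - p i) * y i‖ :=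
      (norm_mul_le _ _).trans (mul_le_of_le_one_right (norm_nonneg _) hpi1)
    have n2 := norm_add_le (y i * (1 - p i)) ((1 - p i) * y i * p i)
    rw [e]
    have n3 := mul_le_mul_of_nonneg_left (n2.trans (add_le_add_right n1 _))
      (norm_nonneg (blockMap φ i (matUnit j j)))
    rw [mul_add] at n3
    linarith [hk1 i j, hk2 i j]
  refine ⟨z, ?_, ?_, ?_⟩
  · rw [← NonUnitalStarAlgHom.norm_map θ hθi, hz']
    exact hpyp
  · change ‖φ (θ z) - φ y‖ ≤ _
    rw [hz', norm_sub_rev, ← map_sub]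
    exact hc.norm_map_le hφ.1 _ (by positivity) hdiff
  · change ‖φ (θ (z * star z)) - φ (y * star y)‖ ≤ _
    rw [map_mul θ, map_star θ, hz', norm_sub_rev, ← map_sub]
    refine hc.norm_map_le hφ.1 _ (by positivity) fun i j => ?_
    -- Two terms, each a factor bounded by C times the difference y − p y p; hence 8Cκ.
    have e : (y * star y - p * y * p * star (p * y * p)) i =
        (y - p * y * p) i * star (y i) + (p * y * p) i * star ((y - p * y * p) i) := by
      have : y * star y - p * y * p * star (p * y * p) =
          (y - p * y * p) * star y + p * y * p * star (y - p * y * p) := by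
        rw [star_sub]
        noncomm_ring
      rw [this]
      rfl
    have n0 : ‖star (y i)‖ ≤ C := (norm_star (y i)).trans_le ((norm_le_pi_norm y i).trans hyC)
    have n0' : ‖star ((y - p * y * p) i)‖ ≤ ‖(y - p * y * p) i‖ :=
      (norm_star ((y - p * y * p) i)).trans_le le_rfl
    have n1 : ‖(y - p * y * p) i * star (y i)‖ ≤ ‖(y - p * y * p) i‖ * C :=
      (norm_mul_le _ _).trans (mul_le_mul_of_nonneg_left n0 (norm_nonneg _))
    have n2 : ‖(p * y * p) i * star ((y - p * y * p) i)‖ ≤ C * ‖(y - p * y * p) i‖ :=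
      (norm_mul_le _ _).trans (mul_le_mul ((norm_le_pi_norm _ i).trans hpyp) n0'
        (norm_nonneg _) hC)
    have n3 := norm_add_le ((y - p * y * p) i * star (y i)) ((p * y * p) i * star ((y - p * y * p) i))
    rw [e]
    have n4 := mul_le_mul_of_nonneg_left (n3.trans (add_le_add n1 n2))
      (norm_nonneg (blockMap φ i (matUnit j j)))
    have n5 := mul_le_mul_of_nonneg_left (hdiff i j) hC
    linarith

end Corner

/-! ### Hereditary subalgebras. -/

section Main

open scoped Classical

attribute [local instance 50] CStarAlgebra.spectralOrder CStarAlgebra.spectralOrderedRing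

lemma IsCompletelyPositive.exists_map_star_mul_self_eq {A B : Type*} [NonUnitalCStarAlgebra A]
    [NonUnitalCStarAlgebra B] {φ : A →ₗ[ℂ] B} (hφ : IsCompletelyPositive φ) (x : A) :
    ∃ w, φ (star x * x) = star w * w :=
  exists_eq_star_mul_self (hφ.map_star_mul_self_nonneg x)

lemma exists_sub_mul_self_eq_star_mul_self {A : Type*} [NonUnitalCStarAlgebra A] {a w : A}
    (hw : a = star w * w) (ha : ‖a‖ ≤ 1) : ∃ v, a - a * a = star v * v := by
  refine exists_eq_star_mul_self (sub_nonneg.2 ?_)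
  have h1 := CStarAlgebra.star_left_conjugate_le_norm_smul (a := w) (b := w * star w)
    (.mul_star_self w)
  have h2 : ‖w * star w‖ ≤ 1 := by
    rw [CStarRing.norm_self_mul_star, ← CStarRing.norm_star_mul_self, ← hw]
    exact ha
  have h3 : star w * (w * star w) * w = a * a := by
    rw [hw]
    simp only [mul_assoc]
  have ha0 : 0 ≤ a := hw ▸ star_mul_self_nonneg w
  rw [h3, ← hw] at h1
  have h4 := smul_le_smul_of_nonneg_right h2 ha0
  rw [one_smul] at h4
  exact h1.trans h4

/-- φ(y a y*) ≈ φ(y) φ(a) φ(y)* ≈ b e b* ≈ b b* ≈ φ(y y*), since y is almost in the multiplicative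
domain: if e almost acts as a unit on b, then a does so on y as seen through φ. -/
lemma IsCPC.norm_map_mul_star_sub_map_mul_mul_star_le {F A : Type*} [NonUnitalCStarAlgebra F]
    [NonUnitalCStarAlgebra A] {φ : F →ₗ[ℂ] A} (hφ : IsCPC φ) {y a : F} {b e : A} {C η t : ℝ}
    (hη0 : 0 ≤ η) (hη1 : η ≤ 1) (ht : 0 < t) (hηt : η * (2 * C + 2) ≤ t ^ 2) (hy : ‖y‖ ≤ C)
    (hb : ‖b‖ ≤ C) (ha : ‖a‖ ≤ 1) (he : ‖e‖ ≤ 1) (h1 : ‖φ y - b‖ ≤ η)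
    (h2 : ‖φ (y * star y) - b * star b‖ ≤ η) (h3 : ‖φ a - e‖ ≤ η) (h4 : ‖b * e - b‖ ≤ η) :
    ‖φ (y * star y) - φ (y * a * star y)‖ ≤ η * (1 + 3 * C + C ^ 2) + 8 * t * C := by
  have hC : 0 ≤ C := (norm_nonneg y).trans hy
  have hdef := hφ.norm_mulDefect_le_of_le ht ((hφ.norm_map_mul_star_sub_le hη1 hb h1 h2).trans hηt)
  simp only [mulDefect_apply, star_star, hφ.1.map_star] at hdef
  have hX : ‖φ y‖ ≤ C := (hφ.2 y).trans hy
  have hP : ‖φ a‖ ≤ 1 := (hφ.2 a).trans ha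
  -- Telescoping; the last two terms are defects of multiplicativity and produce 8tC, the others
  -- produce the multiple of η.
  have e1 : φ (y * star y) - φ (y * a * star y) =
      (φ (y * star y) - b * star b) - (b * e - b) * star b - (φ y - b) * e * star b -
        φ y * (φ a - e) * star b - φ y * φ a * star (φ y - b) -
        φ y * star (φ (y * star a) - φ y * φ (star a)) -
        (φ (y * (a * star y)) - φ y * φ (a * star y)) := by
    rw [← mul_assoc y, star_sub (φ (y * star a)), ← hφ.1.map_star (y * star a), star_mul y,
      star_star, star_mul (φ y) (φ (star a)), hφ.1.map_star a, star_star, star_sub]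
    noncomm_ring
  have n1 : ‖(b * e - b) * star b‖ ≤ η * C := by
    refine (norm_mul_le _ _).trans ?_
    rw [norm_star]
    exact mul_le_mul h4 hb (norm_nonneg _) hη0
  have n2 : ‖(φ y - b) * e * star b‖ ≤ η * C := by
    refine (norm_mul_le _ _).trans ?_
    rw [norm_star]
    refine mul_le_mul ((norm_mul_le _ _).trans ?_) hb (norm_nonneg _) hη0
    exact (mul_le_of_le_one_right (norm_nonneg _) he).trans h1
  have n3 : ‖φ y * (φ a - e) * star b‖ ≤ C * η * C := by
    refine (norm_mul_le _ _).trans ?_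
    rw [norm_star]
    refine mul_le_mul ((norm_mul_le _ _).trans ?_) hb (norm_nonneg _) (by positivity)
    exact mul_le_mul hX h3 (norm_nonneg _) hC
  have n4 : ‖φ y * φ a * star (φ y - b)‖ ≤ C * η := by
    refine (norm_mul_le _ _).trans ?_
    rw [norm_star]
    refine mul_le_mul ((norm_mul_le _ _).trans ?_) h1 (norm_nonneg _) hC
    exact (mul_le_of_le_one_right (norm_nonneg _) hP).trans hX
  have n5 : ‖φ y * star (φ (y * star a) - φ y * φ (star a))‖ ≤ C * (4 * t) := by
    refine (norm_mul_le _ _).trans ?_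
    rw [norm_star]
    refine mul_le_mul hX ((hdef (star a)).trans ?_) (norm_nonneg _) hC
    rw [norm_star]
    exact mul_le_of_le_one_right (by positivity) ha
  have n6 : ‖φ (y * (a * star y)) - φ y * φ (a * star y)‖ ≤ 4 * t * C := by
    refine (hdef _).trans (mul_le_mul_of_nonneg_left ((norm_mul_le _ _).trans ?_) (by positivity))
    rw [norm_star]
    exact (mul_le_of_le_one_left (norm_nonneg _) ha).trans hy
  rw [e1]
  refine (norm_sub_le_of_le (norm_sub_le_of_le (norm_sub_le_of_le (norm_sub_le_of_le
    (norm_sub_le_of_le (norm_sub_le_of_le h2 n1) n2) n3) n4) n5) n6).trans (le_of_eq ?_)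
  ring

variable {A : Type*} [NonUnitalCStarAlgebra A]

/-- Start from a full approximation, since ψ supplies a = ψ(d²) and the bounds ‖ψ(b)‖ ≤ ‖b‖. As d²
almost acts as a unit on T, cutting to the corner of a hardly moves φ on ψ(b) and ψ(b)ψ(b)*. The
corner's unit maps below 2φ(a) ≈ 2d², which allows the map to be pushed into S. -/
lemma IsHereditary.hasApproximateModels {S : NonUnitalStarSubalgebra ℂ A} [IsClosed (S : Set A)]
    (hS : IsHereditary S) {N : ℕ} (h : HasDecomposableApproximations A N) :
    HasApproximateModels S N := by
  intro T ε hε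
  obtain ⟨C, hC0, hC⟩ : ∃ C : ℝ, 0 ≤ C ∧ ∀ b ∈ T, ‖b‖ ≤ C :=
    ⟨∑ b ∈ T, ‖b‖, Finset.sum_nonneg fun _ _ => norm_nonneg _, fun b hb =>
      Finset.single_le_sum (f := fun b => ‖b‖) (fun _ _ => norm_nonneg _) hb⟩
  -- Of ε, a quarter each goes to the corner (κ), to the push into S (γ) and to the approximation
  -- itself (η).
  obtain ⟨κ, hκ, hκ1, hκ2⟩ : ∃ κ : ℝ, 0 < κ ∧ (N + 1) * (4 * κ) ≤ ε / 4 ∧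
      (N + 1) * (8 * C * κ) ≤ ε / 4 := by
    have h0 : (0 : ℝ) < (N + 1) * (8 * C + 4) := by positivity
    have hk : (N + 1) * (8 * C + 4) * (ε / 4 / ((N + 1) * (8 * C + 4))) = ε / 4 :=
      mul_div_cancel₀ _ h0.ne'
    have hk0 : 0 < ε / 4 / ((N + 1) * (8 * C + 4)) := by positivity
    have a1 : 0 ≤ (N + 1) * (8 * C * (ε / 4 / ((N + 1) * (8 * C + 4)))) := by positivity
    have a2 : 0 ≤ (N + 1) * (4 * (ε / 4 / ((N + 1) * (8 * C + 4)))) := by positivity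
    exact ⟨ε / 4 / ((N + 1) * (8 * C + 4)), hk0, by linarith, by linarith⟩
  obtain ⟨γ, hγ, hγ1, hγ2⟩ : ∃ γ : ℝ, 0 < γ ∧ γ * C ≤ ε / 4 ∧ γ * (C * C) ≤ ε / 4 := by
    refine ⟨ε / 4 / (C * C + C + 1), by positivity, ?_, ?_⟩ <;>
    · rw [div_mul_eq_mul_div, div_le_iff₀ (by positivity)]
      exact mul_le_mul_of_nonneg_left (by nlinarith) (by positivity)
  obtain ⟨η', hη', H⟩ := hS.exists_orderZeroOn N hγ
  obtain ⟨t, ht, htC⟩ : ∃ t : ℝ, 0 < t ∧ 8 * t * C ≤ κ ^ 2 / 2 := by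
    refine ⟨κ ^ 2 / (16 * (C + 1)), by positivity, ?_⟩
    rw [mul_div_assoc', div_mul_eq_mul_div, div_le_iff₀ (by positivity)]
    nlinarith [sq_nonneg κ]
  obtain ⟨η, hη, hη1, hηη, hηε, hηt, hηκ⟩ : ∃ η : ℝ, 0 < η ∧ η ≤ 1 ∧ η ≤ η' ∧ η ≤ ε / 4 ∧
      η * (2 * C + 2) ≤ t ^ 2 ∧ η * (1 + 3 * C + C ^ 2) ≤ κ ^ 2 / 2 := by
    refine ⟨min (min (min 1 η') (ε / 4)) (min (t ^ 2 / (2 * C + 2))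
      (κ ^ 2 / 2 / (1 + 3 * C + C ^ 2))), by positivity, ?_, ?_, ?_, ?_, ?_⟩
    · exact ((min_le_left _ _).trans (min_le_left _ _)).trans (min_le_left _ _)
    · exact ((min_le_left _ _).trans (min_le_left _ _)).trans (min_le_right _ _)
    · exact (min_le_left _ _).trans (min_le_right _ _)
    · rw [← le_div_iff₀ (by positivity)]
      exact (min_le_right _ _).trans (min_le_left _ _)
    · rw [← le_div_iff₀ (by positivity)]
      exact (min_le_right _ _).trans (min_le_right _ _)
  -- Adjoints are included because the corner requires estimates for y y* and for y* y; η/2 because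
  -- d² rather than d acts on b.
  obtain ⟨d', hd'0, hd'1, hd'⟩ := exists_contraction_forall_norm_sub_lt (T ∪ T.image star)
    (half_pos hη)
  -- A second almost unit, for d: it generates the right ideal containing the multipliers.
  obtain ⟨e', he'0, he'1, he'⟩ := exists_contraction_forall_norm_sub_lt {d'} hη
  have hS' := isCompletelyPositive_hom (NonUnitalStarSubalgebraClass.subtype S)
  have he'2 : (0 : A) ≤ e' := hS'.map_nonneg he'0
  obtain ⟨d, hd⟩ : ∃ d : A, d = d' := ⟨_, rfl⟩
  have hd0 : 0 ≤ d := hd ▸ hS'.map_nonneg hd'0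
  have hds : star d = d := (IsSelfAdjoint.of_nonneg hd0).star_eq
  have hd1 : ‖d‖ ≤ 1 := hd ▸ hd'1
  have hdd1 : ‖d * d‖ ≤ 1 := (norm_mul_le _ _).trans (mul_le_one₀ hd1 (norm_nonneg _) hd1)
  have hdb : ∀ b ∈ T ∪ T.image star, ‖d * d * (b : A) - b‖ ≤ η := by
    intro b hb
    have h1 : ‖d * (b : A) - b‖ < η / 2 := hd ▸ hd' b hb
    have e1 : d * d * (b : A) - b = d * (d * (b : A) - b) + (d * (b : A) - b) := by noncomm_ring
    have n1 : ‖d * (d * (b : A) - b)‖ ≤ ‖d * (b : A) - b‖ :=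
      (norm_mul_le _ _).trans (mul_le_of_le_one_left (norm_nonneg _) hd1)
    rw [e1]
    linarith [norm_add_le (d * (d * (b : A) - b)) (d * (b : A) - b)]
  have hbd : ∀ b ∈ T ∪ T.image star, ‖(b : A) * (d * d) - b‖ ≤ η := by
    intro b hb
    have hb' : star b ∈ T ∪ T.image star := by
      rcases Finset.mem_union.1 hb with hb | hb
      · exact Finset.mem_union_right _ (Finset.mem_image_of_mem _ hb)
      · obtain ⟨x, hx, rfl⟩ := Finset.mem_image.1 hb
        rw [star_star]
        exact Finset.mem_union_left _ hx
    have h1 := hdb _ hb'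
    rw [← norm_star, star_sub, star_mul, star_mul, hds] at h1
    change ‖star (star (b : A)) * (d * d) - star (star (b : A))‖ ≤ η at h1
    rwa [star_star] at h1
  obtain ⟨ι, _, n, _, ψ, φ, c, hψ, hφ, hc, hψφ⟩ := h.exists_factorization
    ((T ∪ T.image star).image (fun b : S => (b : A)) ∪ {d * d}) hη
  have hψd := hψφ (d * d) (Finset.mem_union_right _ (Finset.mem_singleton_self _))
  have hψT : ∀ b ∈ T ∪ T.image star, ‖φ (ψ (b : A)) - b‖ < η ∧
      ‖φ (ψ (b : A) * star (ψ (b : A))) - (b : A) * star (b : A)‖ < η := fun b hb =>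
    hψφ b (Finset.mem_union_left _ (Finset.mem_image_of_mem _ hb))
  obtain ⟨a, ha⟩ : ∃ a, a = ψ (d * d) := ⟨_, rfl⟩
  have ha1 : ‖a‖ ≤ 1 := ha ▸ (hψ.2 _).trans hdd1
  obtain ⟨w, hw⟩ : ∃ w, a = star w * w := by
    have := hψ.1.exists_map_star_mul_self_eq d
    rwa [hds, ← ha] at this
  obtain ⟨v, hv⟩ := exists_sub_mul_self_eq_star_mul_self hw ha1
  obtain ⟨k, _, χ, hχ, hχc, hχ1, hcorner⟩ := hc.exists_corner hφ hw hv
  obtain ⟨φ', hφ', hφ'c, hφ'χ⟩ := H ι k χ c (φ a) d e' hχ hχc hχ1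
    (ha ▸ hψd.1.le.trans hηη) hds hd1 he'2 he'1
    (hd ▸ (he' d' (Finset.mem_singleton_self _)).le.trans hηη) e'.2
  have hnorm : ∀ b ∈ T ∪ T.image star, ‖(b : A)‖ ≤ C := by
    intro b hb
    rcases Finset.mem_union.1 hb with hb | hb
    · exact hC b hb
    · obtain ⟨x, hx, rfl⟩ := Finset.mem_image.1 hb
      exact (norm_star (x : A)).trans_le (hC x hx)
  have hest : ∀ b ∈ T ∪ T.image star, ‖φ (ψ (b : A) * star (ψ (b : A))) -
      φ (ψ (b : A) * a * star (ψ (b : A)))‖ ≤ κ ^ 2 := by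
    intro b hb
    have := hφ.norm_map_mul_star_sub_map_mul_mul_star_le hη.le hη1 ht hηt
      ((hψ.2 _).trans (hnorm b hb)) (hnorm b hb) ha1 hdd1 (hψT b hb).1.le (hψT b hb).2.le
      (ha ▸ hψd.1.le) (hbd b hb)
    linarith
  refine ⟨ι, _, k, _, φ', c, hφ', hφ'c, fun b hb => ?_⟩
  have hb1 : b ∈ T ∪ T.image star := Finset.mem_union_left _ hb
  have hb2 : star b ∈ T ∪ T.image star :=
    Finset.mem_union_right _ (Finset.mem_image_of_mem _ hb)
  have hs2 := hest _ hb2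
  change ‖φ (ψ (star (b : A)) * star (ψ (star (b : A)))) -
      φ (ψ (star (b : A)) * a * star (ψ (star (b : A))))‖ ≤ κ ^ 2 at hs2
  rw [hψ.1.map_star, star_star] at hs2
  obtain ⟨z, hz0, hz1, hz2⟩ := hcorner (ψ (b : A)) κ C hκ.le ((hψ.2 _).trans (hnorm b hb1))
    (hest b hb1) hs2
  have hzz : ‖z * star z‖ ≤ C * C := by
    refine (CStarRing.norm_self_mul_star (x := z)).trans_le ?_
    exact mul_le_mul hz0 hz0 (norm_nonneg _) hC0
  refine ⟨z, ?_, ?_⟩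
  · change ‖(φ' z : A) - b‖ < ε
    have e1 : (φ' z : A) - b = (φ' z - χ z) + (χ z - φ (ψ b)) + (φ (ψ b) - b) := by abel
    rw [e1]
    have := norm_add₃_le (a := (φ' z : A) - χ z) (b := χ z - φ (ψ b)) (c := φ (ψ (b : A)) - b)
    linarith [hφ'χ z, mul_le_mul_of_nonneg_left hz0 hγ.le, (hψT b hb1).1]
  · change ‖(φ' (z * star z) : A) - b * star (b : A)‖ < ε
    have e1 : (φ' (z * star z) : A) - b * star (b : A) = (φ' (z * star z) - χ (z * star z)) +
        (χ (z * star z) - φ (ψ b * star (ψ (b : A)))) +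
        (φ (ψ b * star (ψ (b : A))) - b * star (b : A)) := by abel
    rw [e1]
    have := norm_add₃_le (a := (φ' (z * star z) : A) - χ (z * star z))
      (b := χ (z * star z) - φ (ψ b * star (ψ (b : A))))
      (c := φ (ψ b * star (ψ (b : A))) - b * star (b : A))
    linarith [hφ'χ (z * star z), mul_le_mul_of_nonneg_left hzz hγ.le, (hψT b hb1).2]

lemma decompositionRank_le_of_isHereditary (S : NonUnitalStarSubalgebra ℂ A)
    [IsClosed (S : Set A)] (hS : IsHereditary S) : decompositionRank S ≤ decompositionRank A :=
  decompositionRank_le_of_forall fun _ hN => hS.hasApproximateModels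
    (hasDecomposableApproximations_iff.2 (decompositionRank_le_iff.1 hN))

end Main

end DecRank

end

theorem mainTheorem11 {A : Type*} {B : Type*}
    [NonUnitalCStarAlgebra A] [TopologicalSpace.SeparableSpace A]
    [NonUnitalCStarAlgebra B] [TopologicalSpace.SeparableSpace B] :
    -- direct sums
    DecRank.decompositionRank (A × B) =
        max (DecRank.decompositionRank A) (DecRank.decompositionRank B) ∧
    -- inductive limits
    (∀ (D : ℕ → Type*) [∀ n, NonUnitalCStarAlgebra (D n)]
        [∀ n, TopologicalSpace.SeparableSpace (D n)]
        (σ : ∀ n, D n →⋆ₙₐ[ℂ] D (n + 1)) (μ : ∀ n, D n →⋆ₙₐ[ℂ] A),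
        DecRank.IsInductiveLimit σ μ →
        DecRank.decompositionRank A ≤
          Filter.liminf (fun n => DecRank.decompositionRank (D n)) Filter.atTop) ∧
    -- quotients
    (∀ J : DecRank.ClosedIdeal A,
        DecRank.decompositionRank J.Quotient ≤ DecRank.decompositionRank A) ∧
    -- hereditary subalgebras
    (∀ (S : NonUnitalStarSubalgebra ℂ A) [IsClosed (S : Set A)],
        DecRank.IsHereditary S → DecRank.decompositionRank S ≤ DecRank.decompositionRank A) ∧
    -- tensor products
    DecRank.decompositionRank (DecRank.MinTensor A B) ≤
        (DecRank.decompositionRank A + 1) * (DecRank.decompositionRank B + 1) - 1 ∧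
    (DecRank.IsAF B →
        DecRank.decompositionRank (DecRank.MinTensor A B) ≤ DecRank.decompositionRank A) := by
  exact ⟨DecRank.decompositionRank_prod, fun D _ _ σ μ h => DecRank.decompositionRank_le_liminf h,
    fun J => DecRank.decompositionRank_quotient_le J,
    fun S _ hS => DecRank.decompositionRank_le_of_isHereditary S hS,
    DecRank.decompositionRank_minTensor_le,
    fun h => DecRank.decompositionRank_minTensor_le_of_isAF h⟩
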